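/- Let $T$ be a complete (possibly many-sorted) first-order theory, $|L|$ the number of $L$-formulas, and let $M\models T$ be $\kappa$-saturated and strongly $\kappa$-homogeneous for some $\kappa>2^{|L|}$. Let $S(M)$ be the space of complete types $p(x)$ over $M$, where $x$ consists of countably many variables of each sort. View it as a relational structure for the pattern language $\mathcal L$: for formulas $\varphi_1(x_1,y),\dots,\varphi_n(x_n,y),\alpha(y)$, the relation $R_{\varphi_1,\dots,\varphi_n;\alpha}(p_1,\dots,p_n)$ holds iff there is no $b\in\alpha(M)$ with $\varphi_i(x_i,b)\in p_i$ for all $i$. Let $\mathcal T$ be the common theory of these type spaces consisting of negations of positive primitive (pp) sentences, i.e. the set of negations of pp sentences true in $S(M')$ for all $M'\models T$. The core of $T$ is the universal existentially closed model of $\mathcal T$ (with respect to homomorphisms): existentially closed, and admitting a homomorphism from each model of $\mathcal T$. For a copy $J\subseteq S(M)$ of the core, give $J$ the topology with pre-basic open sets $\{p:\neg R(p,c_1,\dots,c_k)\}$, and $\mathrm{Aut}(J)$ the topology with pre-basic open sets $\{g:\neg R(ga_1,\dots,ga_n,b_1,\dots,b_m)\}$, with $R$ pp and $a_i,b_i,c_i\in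 J$. Let $\mathfrak g=\{g\in\mathrm{Aut}(J): gU\cap U\neq\emptyset\text{ for all nonempty open }U\subseteq J\}$, a normal subgroup, and $\mathcal G=\mathrm{Aut}(J)/\mathfrak g$ with the quotient topology. Say that $L_1(p,p')$ holds for $p,p'\in J$ if there is a type $q(x,x')$ in the core with restrictions $p(x)$ and $p'(x')$ which contains, for every $0$-definable family $(E_d)_{d\in D}$ ($D\ne\emptyset$) of partitions into boundedly finitely many classes, the formula $(\exists d\in D)\,xE_dx'$. Let $L_1\subseteq\mathcal G$ be the image of $\{g\in\mathrm{Aut}(J): L_1(p,gp)\text{ for all }p\in J\}$. Let $\mathrm{Aut}_L(M)$ be the subgroup of $\mathrm{Aut}(M)$ generated by the automorphisms that fix some elementary submodel of $M$ pointwise. **Proposition.** There is a copy of the core in $S(M)$, and for every such copy $J$ there is a retraction ($\mathcal L$-homomorphism that is the identity on $J$) $r:S(M)\to J$. The set $L_1\subseteq\mathcal G$ is closed and invariant under conjugation. For every retraction $r:S(M)\to J$ and every $\sigma\in\mathrm{Aut}(M)$, the map $r\circ\sigma|_J$ is an automorphism of $J$, and $\sigma\mapsto r\circ\sigma|_J$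 induces an isomorphism of groups $$G_{\mathrm{Las}}=\mathrm{Aut}(M)/\mathrm{Aut}_L(M)\;\cong\;\mathcal G/\langle L_1\rangle .$$ -/

import Mathlib

open FirstOrder FirstOrder.Language Cardinal Topology

universe u v w x y z

/-! ## Many-sorted first-order logic (with named variables) -/

/-- A many-sorted first-order language.  `Functions n a s` are the function symbols of arity `n`,
with argument sorts `a` and value sort `s` (constants are the case `n = 0`). -/
structure MSLanguage where
  Sorts : Type u
  Functions : (n : ℕ) → (Fin n → Sorts) → Sorts → Type v
  Relations : (n : ℕ) → (Fin n → Sorts) → Type v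

namespace MSLanguage

/-- Assignments of elements of `M` to variables; `V` is the set of variable names of each sort. -/
abbrev Assign {S : Type u} (V : Type x) (M : S → Type w) : Type (max u x w) :=
  ∀ s, V → M s

namespace Assign

variable {S : Type u} {V : Type x} {W : Type y} {M : S → Type w}

/-- Change the value of the variable `n` of sort `s` to `m`. -/
noncomputable def update (a : Assign V M) (s : S) (n : V) (m : M s) : Assign V M :=
  open Classical in Function.update a s (Function.update (a s) n m)

/-- The assignment given by two assignments to disjoint sets of variables. -/
def sum (a : Assign V M) (b : Assign W M) : Assign (V ⊕ W) M :=
  fun s => Sum.elim (a s) (b s)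

/-- The image of an assignment under a family of maps. -/
def map {N : S → Type z} (f : ∀ s, M s → N s) (a : Assign V M) : Assign V N :=
  fun s n => f s (a s n)

theorem map_update {N : S → Type z} (f : ∀ s, M s → N s) (a : Assign V M) (s : S) (n : V)
    (m : M s) : (a.update s n m).map f = (a.map f).update s n (f s m) := by
  classical
  funext t k
  by_cases ht : t = s
  · subst ht
    by_cases hk : k = n
    · subst hk; simp [map, update]
    · simp [map, update, hk]
  · simp [map, update, ht]

end Assign

variable (L : MSLanguage.{u, v})

/-- Terms, over `V` variable names in each sort. -/
inductive Term (V : Type x) : L.Sorts → Type (max u v x)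
  | var {s : L.Sorts} (n : V) : Term V s
  | func {n : ℕ} {a : Fin n → L.Sorts} {s : L.Sorts} (f : L.Functions n a s)
      (ts : ∀ i, Term V (a i)) : Term V s

/-- Formulas, over `V` variable names in each sort.  The quantifier `all s n φ` binds the variable
with name `n` of sort `s`. -/
inductive Formula (V : Type x) : Type (max u v x)
  | falsum : Formula V
  | equal {s : L.Sorts} (t t' : L.Term V s) : Formula V
  | rel {n : ℕ} {a : Fin n → L.Sorts} (R : L.Relations n a) (ts : ∀ i, L.Term V (a i)) : Formula V
  | imp (φ ψ : Formula V) : Formula V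
  | all (s : L.Sorts) (n : V) (φ : Formula V) : Formula V

/-- An `L`-structure on a family of sets indexed by the sorts. -/
class Structure (M : L.Sorts → Type w) where
  funMap : ∀ {n : ℕ} {a : Fin n → L.Sorts} {s : L.Sorts}, L.Functions n a s → (∀ i, M (a i)) → M s
  RelMap : ∀ {n : ℕ} {a : Fin n → L.Sorts}, L.Relations n a → (∀ i, M (a i)) → Prop

variable {L}
variable {V : Type x} {W : Type y}

namespace Term

/-- The value of a term. -/
def eval {M : L.Sorts → Type w} [L.Structure M] (a : Assign V M) : ∀ {s}, L.Term V s → M s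
  | s, var n => a s n
  | _, func f ts => Structure.funMap f fun i => (ts i).eval a

/-- The set of variables of a term. -/
def vars : ∀ {s}, L.Term V s → Set (L.Sorts × V)
  | s, var n => {(s, n)}
  | _, func _ ts => ⋃ i, (ts i).vars

/-- Rename the variables. -/
def rename (e : V → W) : ∀ {s}, L.Term V s → L.Term W s
  | _, var n => var (e n)
  | _, func f ts => func f fun i => (ts i).rename e

end Term

namespace Formula

/-- Negation. -/
def neg (φ : L.Formula V) : L.Formula V := φ.imp falsum

/-- The true formula. -/
def truth : L.Formula V := falsum.imp falsum

/-- Satisfaction of a formula in a structure. -/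
def Realize {M : L.Sorts → Type w} [L.Structure M] : L.Formula V → Assign V M → Prop
  | falsum, _ => False
  | equal t t', a => t.eval a = t'.eval a
  | rel R ts, a => Structure.RelMap R fun i => (ts i).eval a
  | imp φ ψ, a => φ.Realize a → ψ.Realize a
  | all s n φ, a => ∀ m : M s, φ.Realize (a.update s n m)

/-- The set of free variables. -/
def freeVars : L.Formula V → Set (L.Sorts × V)
  | falsum => ∅
  | equal t t' => t.vars ∪ t'.vars
  | rel _ ts => ⋃ i, (ts i).vars
  | imp φ ψ => φ.freeVars ∪ ψ.freeVars
  | all s n φ => φ.freeVars \ {(s, n)}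

/-- Rename all variables, free and bound.  It is used only for injective `e`, where it is the
substitution of the variables `e n` for the variables `n`. -/
def rename (e : V → W) : L.Formula V → L.Formula W
  | falsum => falsum
  | equal t t' => equal (t.rename e) (t'.rename e)
  | rel R ts => rel R fun i => (ts i).rename e
  | imp φ ψ => imp (φ.rename e) (ψ.rename e)
  | all s n φ => all s (e n) (φ.rename e)

end Formula

variable (L)

/-- Sentences: formulas (in countably many variables of each sort) without free variables. -/
def Sentence : Type (max u v) := {φ : L.Formula ℕ // φ.freeVars = ∅}

/-- Theories. -/
abbrev Theory : Type (max u v) := Set L.Sentence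

variable {L}

/-- `σ` is true in `M`. -/
def Sentence.IsTrue (σ : L.Sentence) (M : L.Sorts → Type w) [L.Structure M] : Prop :=
  ∀ a : Assign ℕ M, σ.1.Realize a

/-- `M` is a model of `T`; all sorts of a model are nonempty. -/
structure Theory.IsModel (T : L.Theory) (M : L.Sorts → Type w) [L.Structure M] : Prop where
  nonempty : ∀ s, Nonempty (M s)
  isTrue : ∀ σ ∈ T, σ.IsTrue M

/-- `T` is complete: each sentence is decided by `T`. -/
def Theory.IsComplete (T : L.Theory) : Prop :=
  ∀ σ : L.Sentence,
    (∀ (M : L.Sorts → Type w) [L.Structure M], T.IsModel M → σ.IsTrue M) ∨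
    (∀ (M : L.Sorts → Type w) [L.Structure M], T.IsModel M → ¬ σ.IsTrue M)

/-- Elementary maps between structures. -/
def IsElementary {N : L.Sorts → Type z} {M : L.Sorts → Type w} [L.Structure N] [L.Structure M]
    (f : ∀ s, N s → M s) : Prop :=
  ∀ (φ : L.Formula ℕ) (a : Assign ℕ N), φ.Realize (a.map f) ↔ φ.Realize a

section Automorphisms

variable (M : L.Sorts → Type w) [L.Structure M]

/-- The automorphisms of a many-sorted structure, as a subgroup of the group of families of
permutations. -/
def autSubgroup : Subgroup (∀ s, Equiv.Perm (M s)) where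
  carrier := {σ |
    (∀ {n : ℕ} {a : Fin n → L.Sorts} {s : L.Sorts} (f : L.Functions n a s) (x : ∀ i, M (a i)),
      σ s (Structure.funMap f x) = Structure.funMap f fun i => σ (a i) (x i)) ∧
    (∀ {n : ℕ} {a : Fin n → L.Sorts} (R : L.Relations n a) (x : ∀ i, M (a i)),
      Structure.RelMap R (fun i => σ (a i) (x i)) ↔ Structure.RelMap R x)}
  one_mem' := ⟨fun _ _ => rfl, fun _ _ => Iff.rfl⟩
  mul_mem' := by
    rintro σ τ ⟨hσ, hσ'⟩ ⟨hτ, hτ'⟩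
    refine ⟨fun {n a s} f x => ?_, fun {n a} R x => ?_⟩
    · simp only [Pi.mul_apply, Equiv.Perm.mul_apply, hτ, hσ]
    · simp only [Pi.mul_apply, Equiv.Perm.mul_apply]
      rw [hσ' R fun i => τ (a i) (x i), hτ']
  inv_mem' := by
    rintro σ ⟨hσ, hσ'⟩
    refine ⟨fun {n a s} f x => ?_, fun {n a} R x => ?_⟩
    · simp only [Pi.inv_apply]
      rw [Equiv.Perm.inv_eq_iff_eq, hσ]
      simp
    · simp only [Pi.inv_apply]
      rw [← hσ' R]
      simp

/-- The automorphism group of a many-sorted structure. -/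
def Aut : Type (max u w) := autSubgroup M

instance Aut.group : Group (Aut M) := inferInstanceAs (Group (autSubgroup M))

variable {M}

/-- The underlying family of maps of an automorphism. -/
def Aut.toFun (σ : Aut M) : ∀ s, M s → M s := fun s => σ.1 s

theorem Aut.toFun_mul (σ τ : Aut M) (s : L.Sorts) (m : M s) :
    (σ * τ).toFun s m = σ.toFun s (τ.toFun s m) := rfl

theorem Aut.toFun_inv_toFun (σ : Aut M) (s : L.Sorts) (m : M s) :
    σ⁻¹.toFun s (σ.toFun s m) = m := (σ.1 s).symm_apply_apply m

theorem Aut.toFun_toFun_inv (σ : Aut M) (s : L.Sorts) (m : M s) :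
    σ.toFun s (σ⁻¹.toFun s m) = m := (σ.1 s).apply_symm_apply m

theorem Aut.eval_map (σ : Aut M) (a : Assign V M) {s : L.Sorts} (t : L.Term V s) :
    t.eval (a.map σ.toFun) = σ.toFun s (t.eval a) := by
  induction t with
  | var n => rfl
  | func f ts ih =>
    simp only [Term.eval, ih]
    exact (σ.2.1 f _).symm

theorem Aut.realize_map (σ : Aut M) (φ : L.Formula V) (a : Assign V M) :
    φ.Realize (a.map σ.toFun) ↔ φ.Realize a := by
  induction φ generalizing a with
  | falsum => rfl
  | equal t t' =>
    simp only [Formula.Realize, Aut.eval_map]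
    exact (σ.1 _).injective.eq_iff
  | rel R ts =>
    simp only [Formula.Realize, Aut.eval_map]
    exact σ.2.2 R _
  | imp φ ψ ih ih' => simp only [Formula.Realize, ih, ih']
  | all s n φ ih =>
    simp only [Formula.Realize]
    refine ⟨fun h m => ?_, fun h m => ?_⟩
    · have := h (σ.toFun s m)
      rwa [← Assign.map_update, ih] at this
    · obtain ⟨m, rfl⟩ := (σ.1 s).surjective m
      have := (ih _).2 (h m)
      rwa [Assign.map_update] at this

variable (M)

/-- The automorphisms fixing (pointwise) some elementary submodel of `M`. -/
def fixesModel : Set (Aut M) :=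
  {σ | ∃ (N : L.Sorts → Type w) (_ : L.Structure N) (f : ∀ s, N s → M s),
    (∀ s, Nonempty (N s)) ∧ IsElementary f ∧ ∀ s m, σ.toFun s (f s m) = f s m}

/-- The group `Aut_L(M)` of strong Lascar automorphisms: the subgroup generated by the
automorphisms fixing a model. -/
def AutL : Subgroup (Aut M) := Subgroup.closure (fixesModel M)

end Automorphisms

end MSLanguage

theorem Subgroup.closure_normal_of_conj {G : Type*} [Group G] {S : Set G}
    (h : ∀ g, ∀ s ∈ S, g * s * g⁻¹ ∈ S) : (Subgroup.closure S).Normal := by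
  refine ⟨fun n hn g => ?_⟩
  induction hn using Subgroup.closure_induction with
  | mem s hs => exact Subgroup.subset_closure (h g s hs)
  | one => simp
  | mul a b _ _ ha hb => simpa [mul_assoc] using mul_mem ha hb
  | inv a _ ha => simpa [mul_assoc] using inv_mem ha

namespace MSLanguage

variable {L : MSLanguage.{u, v}}

instance AutL.normal (M : L.Sorts → Type w) [L.Structure M] : (AutL M).Normal := by
  refine Subgroup.closure_normal_of_conj fun τ σ hσ => ?_
  obtain ⟨N, iN, f, hN, hf, hfix⟩ := hσ
  refine ⟨N, iN, fun s m => τ.toFun s (f s m), hN, fun φ a => ?_, fun s m => ?_⟩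
  · rw [← hf φ a]
    exact τ.realize_map φ (a.map f)
  · have h1 : (τ * σ * τ⁻¹).toFun s (τ.toFun s (f s m)) = τ.toFun s (σ.toFun s (f s m)) := by
      rw [Aut.toFun_mul, Aut.toFun_mul, Aut.toFun_inv_toFun]
    rw [h1, hfix]

/-! ### Saturation and homogeneity -/

/-- `M` is `κ`-saturated: a set of formulas in fewer than `κ` variables over fewer than `κ`
parameters that is finitely satisfiable in `M` is satisfied in `M`. -/
def IsSaturated (κ : Cardinal.{max u v w}) (M : L.Sorts → Type w) [L.Structure M] : Prop :=
  ∀ (V W : Type (max u v w)), lift.{max v w} #L.Sorts * #V < κ → lift.{max v w} #L.Sorts * #W < κ →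
    ∀ (b : Assign W M) (p : Set (L.Formula (V ⊕ W))),
      (∀ F : Finset (L.Formula (V ⊕ W)), ↑F ⊆ p →
        ∃ a : Assign V M, ∀ φ ∈ F, φ.Realize (a.sum b)) →
      ∃ a : Assign V M, ∀ φ ∈ p, φ.Realize (a.sum b)

/-- `M` is strongly `κ`-homogeneous: two tuples of length less than `κ` with the same type
over `∅` are conjugate under `Aut M`.  (Infinitely many variable names are used so that
there is no shortage of names for bound variables; tuples may have repetitions.) -/
def IsStronglyHomogeneous (κ : Cardinal.{max u v w}) (M : L.Sorts → Type w) [L.Structure M] :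
    Prop :=
  ∀ (W : Type (max u v w)) [Infinite W], lift.{max v w} #L.Sorts * #W < κ →
    ∀ a b : Assign W M, (∀ φ : L.Formula W, φ.Realize a ↔ φ.Realize b) →
      ∃ σ : Aut M, a.map σ.toFun = b

/-! ## Type spaces and the pattern language

The types considered are in the distinguished variables `x`, countably many in each sort, and
formulas `φ(x, y)` have parameter variables `y`, again countably many in each sort.  In
`L.Formula (ℕ ⊕ ℕ)`, the names `Sum.inl n` are for distinguished variables and the names
`Sum.inr n` for parameter variables. -/

/-- The space `S(M)` of complete types `p(x)` over `M`.  A pair `(φ, b) ∈ p` stands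
for the formula `φ(x, b)` of `p`.  Finite satisfiability in `M` amounts to realizability in an
elementary extension of `M`. -/
@[ext]
structure TypeSpace (M : L.Sorts → Type w) [L.Structure M] where
  formulas : Set (L.Formula (ℕ ⊕ ℕ) × Assign ℕ M)
  finSat : ∀ F : Finset (L.Formula (ℕ ⊕ ℕ) × Assign ℕ M), ↑F ⊆ formulas →
    ∃ a : Assign ℕ M, ∀ φ ∈ F, φ.1.Realize (a.sum φ.2)
  complete : ∀ φ b, (φ, b) ∈ formulas ∨ (φ.neg, b) ∈ formulas

/-- The action of `Aut M` on `S(M)`: `φ(x, b) ∈ p` iff `φ(x, σ b) ∈ σ p`. -/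
def TypeSpace.act {M : L.Sorts → Type w} [L.Structure M] (σ : Aut M) (p : TypeSpace M) :
    TypeSpace M where
  formulas := {φ | (φ.1, φ.2.map σ⁻¹.toFun) ∈ p.formulas}
  finSat := by
    classical
    intro F hF
    obtain ⟨a, ha⟩ := p.finSat (F.image fun φ => (φ.1, φ.2.map σ⁻¹.toFun)) (by
      intro ψ hψ
      simp only [Finset.coe_image, Set.mem_image] at hψ
      obtain ⟨φ, hφ, rfl⟩ := hψ
      exact hF hφ)
    refine ⟨a.map σ.toFun, fun φ hφ => ?_⟩
    have h1 := ha (φ.1, φ.2.map σ⁻¹.toFun) (Finset.mem_image_of_mem _ hφ)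
    rw [← σ.realize_map] at h1
    convert h1 using 1
    funext s n
    cases n <;> simp [Assign.sum, Assign.map, Aut.toFun_toFun_inv]
  complete := fun φ b => p.complete φ _

variable (L)

/-- The pattern language: an `n`-ary relation symbol `R_t` for each
`t = (φ₁(x₁, y), …, φₙ(xₙ, y); α(y))`. -/
def patternLanguage : FirstOrder.Language.{0, max u v} where
  Functions := fun _ => Empty
  Relations := fun n => (Fin n → L.Formula (ℕ ⊕ ℕ)) × L.Formula ℕ

variable {L}

/-- The relation symbol `R_t` for `t = (φ₁, …, φₙ; α)`. -/
def pat {n : ℕ} (φ : Fin n → L.Formula (ℕ ⊕ ℕ)) (α : L.Formula ℕ) :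
    L.patternLanguage.Relations n := (φ, α)

/-- `S(M)` as a structure for the pattern language: `R_t(p₁, …, pₙ)` says that there is no
`b ∈ α(M)` with `φᵢ(xᵢ, b) ∈ pᵢ` for all `i`. -/
instance TypeSpace.structure (M : L.Sorts → Type w) [L.Structure M] :
    L.patternLanguage.Structure (TypeSpace M) where
  funMap := fun f _ => f.elim
  RelMap := fun t p => ¬ ∃ b : Assign ℕ M, t.2.Realize b ∧ ∀ i, (t.1 i, b) ∈ (p i).formulas

end MSLanguage

/-! ## Positive primitive formulas, existentially closed models -/

namespace FirstOrder.Language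

variable {K : FirstOrder.Language.{u, v}}

/-- Finite conjunctions of atomic formulas. -/
inductive BoundedFormula.IsAtomicConj {α : Type x} : ∀ {n : ℕ}, K.BoundedFormula α n → Prop
  | top {n : ℕ} : IsAtomicConj (⊤ : K.BoundedFormula α n)
  | atomic {n : ℕ} {φ : K.BoundedFormula α n} (h : φ.IsAtomic) : IsAtomicConj φ
  | inf {n : ℕ} {φ ψ : K.BoundedFormula α n} (hφ : IsAtomicConj φ) (hψ : IsAtomicConj ψ) :
      IsAtomicConj (φ ⊓ ψ)

/-- Positive primitive formulas: `∃ x₁ … x_k, ⋀ⱼ φⱼ` with `φⱼ` atomic. -/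
inductive BoundedFormula.IsPP {α : Type x} : ∀ {n : ℕ}, K.BoundedFormula α n → Prop
  | conj {n : ℕ} {φ : K.BoundedFormula α n} (h : φ.IsAtomicConj) : IsPP φ
  | ex {n : ℕ} {φ : K.BoundedFormula α (n + 1)} (h : IsPP φ) : IsPP φ.ex

/-- Existentially closed models of a theory (with respect to homomorphisms and positive primitive
formulas with parameters). -/
def IsExistentiallyClosed (Θ : K.Theory) (A : Type w) [K.Structure A] : Prop :=
  A ⊨ Θ ∧ ∀ (B : Type w) [K.Structure B], B ⊨ Θ → ∀ f : A →[K] B,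
    ∀ (n : ℕ) (φ : K.Formula (Fin n)), BoundedFormula.IsPP φ →
      ∀ a : Fin n → A, φ.Realize (fun i => f (a i)) → φ.Realize a

/-- Universal existentially closed models: every model of the theory has a homomorphism to it. -/
def IsUniversalEC (Θ : K.Theory) (A : Type w) [K.Structure A] : Prop :=
  IsExistentiallyClosed Θ A ∧
    ∀ (B : Type w) [K.Structure B], B ⊨ Θ → Nonempty (B →[K] A)

section PPTopology

variable (A : Type w) [K.Structure A]

/-- The pp topology: the sets `{x : ¬ R(x, c₁, …, c_k)}`, with `R` pp, are a pre-basis. -/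
@[reducible] def ppTopology : TopologicalSpace A :=
  TopologicalSpace.generateFrom
    {U | ∃ (k : ℕ) (R : K.Formula (Fin (k + 1))) (c : Fin k → A), BoundedFormula.IsPP R ∧
      U = {a | ¬ R.Realize (Fin.cons a c : Fin (k + 1) → A)}}

/-- The automorphism group of a structure, under composition. -/
instance autGroup : Group (A ≃[K] A) where
  mul g h := g.comp h
  one := Language.Equiv.refl K A
  inv g := g.symm
  mul_assoc _ _ _ := rfl
  one_mul _ := rfl
  mul_one _ := rfl
  inv_mul_cancel g := by
    ext a
    exact g.toEquiv.symm_apply_apply a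

variable {A}

theorem aut_mul_apply (g h : A ≃[K] A) (a : A) : (g * h) a = g (h a) := rfl

theorem aut_inv_apply_self (g : A ≃[K] A) (a : A) : g⁻¹ (g a) = a :=
  g.toEquiv.symm_apply_apply a

theorem aut_apply_inv_self (g : A ≃[K] A) (a : A) : g (g⁻¹ a) = a :=
  g.toEquiv.apply_symm_apply a

variable (A)

/-- The topology of pointwise convergence on the automorphism group: the sets
`{g : ¬ R(g a₁, …, g aₙ, b₁, …, b_m)}`, with `R` pp, are a pre-basis. -/
instance autTopology : TopologicalSpace (A ≃[K] A) :=
  TopologicalSpace.generateFrom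
    {U | ∃ (n m : ℕ) (R : K.Formula (Fin n ⊕ Fin m)) (a : Fin n → A) (b : Fin m → A),
      BoundedFormula.IsPP R ∧ U = {g | ¬ R.Realize (Sum.elim (fun i => g (a i)) b)}}

variable {A}

theorem aut_continuous (g : A ≃[K] A) :
    @Continuous A A (ppTopology (K := K) A) (ppTopology (K := K) A) g := by
  let _ := ppTopology (K := K) A
  refine continuous_generateFrom_iff.2 ?_
  rintro U ⟨k, R, c, hR, rfl⟩
  refine TopologicalSpace.isOpen_generateFrom_of_mem ⟨k, R, fun i => g⁻¹ (c i), hR, ?_⟩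
  ext a
  simp only [Set.mem_preimage, Set.mem_ofPred_eq]
  rw [← StrongHomClass.realize_formula g R (v := Fin.cons a fun i => g⁻¹ (c i))]
  have : (g ∘ (Fin.cons a fun i => g⁻¹ (c i) : Fin (k + 1) → A)) = Fin.cons (g a) c := by
    funext i
    refine Fin.cases ?_ (fun j => ?_) i
    · simp
    · simpa using aut_apply_inv_self g (c j)
  rw [this]

theorem aut_isOpen_image (g : A ≃[K] A) {U : Set A} (hU : IsOpen[ppTopology (K := K) A] U) :
    IsOpen[ppTopology (K := K) A] (g '' U) := by
  have h : g '' U = (g⁻¹ : A ≃[K] A) ⁻¹' U := by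
    ext a
    constructor
    · rintro ⟨b, hb, rfl⟩
      simpa [aut_inv_apply_self] using hb
    · intro ha
      exact ⟨_, ha, aut_apply_inv_self g a⟩
  rw [h]
  exact @IsOpen.preimage A A (ppTopology (K := K) A) (ppTopology (K := K) A) _
    (aut_continuous g⁻¹) _ hU

variable (K A)

/-- The group of infinitesimal automorphisms: `g U` meets `U` for each nonempty open `U`. -/
def infinitesimal : Subgroup (A ≃[K] A) where
  carrier := {g | ∀ U : Set A, IsOpen[ppTopology (K := K) A] U → U.Nonempty → (g '' U ∩ U).Nonempty}
  one_mem' := by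
    rintro U - ⟨a, ha⟩
    exact ⟨a, ⟨a, ha, rfl⟩, ha⟩
  mul_mem' := by
    intro g h hg hh U hU hne
    obtain ⟨_, ⟨b, ⟨⟨c, hc, rfl⟩, -⟩, rfl⟩, ⟨-, h2⟩⟩ := hg (h '' U ∩ U)
      (@IsOpen.inter A (ppTopology (K := K) A) _ _ (aut_isOpen_image h hU) hU) (hh U hU hne)
    exact ⟨_, ⟨c, hc, rfl⟩, h2⟩
  inv_mem' := by
    intro g hg U hU hne
    obtain ⟨_, ⟨b, hb, rfl⟩, h2⟩ := hg U hU hne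
    exact ⟨b, ⟨g b, h2, aut_inv_apply_self g b⟩, hb⟩

instance infinitesimal_normal : (infinitesimal K A).Normal := by
  refine ⟨fun g hg h U hU hne => ?_⟩
  obtain ⟨_, ⟨b, ⟨c, hc, rfl⟩, rfl⟩, ⟨d, hd, h2⟩⟩ :=
    hg ((h⁻¹ : A ≃[K] A) '' U) (aut_isOpen_image h⁻¹ hU) (hne.image _)
  refine ⟨d, ⟨c, hc, ?_⟩, hd⟩
  rw [aut_mul_apply, aut_mul_apply, ← h2, aut_apply_inv_self]

end PPTopology

end FirstOrder.Language

/-! ## The core, the Lascar neighbour relation -/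

namespace MSLanguage

variable {L : MSLanguage.{u, v}} (T : L.Theory)

/-- The theory of `T`-patterns: the negations of pp sentences that are true in the type spaces
of all models of `T`. -/
def patternTheory : L.patternLanguage.Theory :=
  {θ | ∃ ψ : L.patternLanguage.Sentence, BoundedFormula.IsPP ψ ∧ θ = Formula.not ψ ∧
    ∀ (M : L.Sorts → Type w) [L.Structure M], T.IsModel M → ¬ (TypeSpace M ⊨ ψ)}

/-- `A` is the core of `T`: the universal existentially closed model of the theory
of `T`-patterns. -/
def IsCore (A : Type (max u v w)) [L.patternLanguage.Structure A] : Prop :=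
  IsUniversalEC (patternTheory.{u, v, w} T) A

/-- `(δ, E)` is a `0`-definable family of finite partitions: in all models of `T`, the set `δ` is
nonempty, and each `E_d`, with `d ∈ δ`, is an equivalence relation with finitely many (at
most `m`) classes.  In `E`, the names `inl (inl n)`, `inl (inr n)`, `inr n` are for the
variables `x`, `x'` and `d`. -/
def IsPartitionFamily (δ : L.Formula ℕ) (E : L.Formula ((ℕ ⊕ ℕ) ⊕ ℕ)) : Prop :=
  ∃ m : ℕ, ∀ (M : L.Sorts → Type w) [L.Structure M], T.IsModel M →
    (∃ d : Assign ℕ M, δ.Realize d) ∧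
    ∀ d : Assign ℕ M, δ.Realize d →
      Equivalence (fun a a' : Assign ℕ M => E.Realize ((a.sum a').sum d)) ∧
      ∃ c : Fin m → Assign ℕ M, ∀ a : Assign ℕ M, ∃ i, E.Realize ((a.sum (c i)).sum d)

/-- The partial type `L₁²(x, x')` of Lascar neighbours consists of the formulas
`∃ d ∈ δ, x E_d x'`, for all `0`-definable families of finite partitions. -/
def lascarNeighbours : Set (L.Formula (ℕ ⊕ ℕ)) :=
  {θ | ∃ (δ : L.Formula ℕ) (E : L.Formula ((ℕ ⊕ ℕ) ⊕ ℕ)), IsPartitionFamily.{u, v, w} T δ E ∧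
    ∀ (M : L.Sorts → Type w) [L.Structure M], T.IsModel M → ∀ a a' : Assign ℕ M,
      θ.Realize (a.sum a') ↔ ∃ d : Assign ℕ M, δ.Realize d ∧ E.Realize ((a.sum a').sum d)}

/-- The identification of pairs `(x, x')` of tuples of distinguished variables with
tuples `x`: the `n`-th variable of `x` is sent to the `2n`-th and the `n`-th variable of `x'`
to the `2n+1`-st (in each sort). -/
def pairName : ℕ ⊕ ℕ → ℕ := Sum.elim (fun n => 2 * n) (fun n => 2 * n + 1)

/-- The relation `p = e^* q` of the pattern language, where `e^* q = {φ(x, b) : φ(e x, b) ∈ q}`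
is the pullback of the type `q` under the change of variables `e`: for all `φ`, both
`φ(e x, y), ¬ φ(x, y)` and `¬ φ(e x, y), φ(x, y)` are not represented in `(q, p)`. -/
def IsPullback (L : MSLanguage.{u, v}) {A : Type z} [L.patternLanguage.Structure A]
    (e : ℕ → ℕ) (q p : A) : Prop :=
  ∀ φ : L.Formula (ℕ ⊕ ℕ),
    FirstOrder.Language.Structure.RelMap (pat ![φ.rename (Sum.map e id), φ.neg] Formula.truth) ![q, p] ∧
    FirstOrder.Language.Structure.RelMap (pat ![(φ.rename (Sum.map e id)).neg, φ] Formula.truth) ![q, p]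

/-- The relation `L₁(p, p')` of Lascar distance at most one, as a relation defined in all
structures for the pattern language: there is `q(x, x')`, with restrictions `p(x)` and `p'(x')`,
that contains `L₁²(x, x')`. -/
def LascarDistLEOne {A : Type z} [L.patternLanguage.Structure A] (p p' : A) : Prop :=
  ∃ q : A, IsPullback L (fun n => pairName (Sum.inl n)) q p ∧
    IsPullback L (fun n => pairName (Sum.inr n)) q p' ∧
    ∀ θ ∈ lascarNeighbours.{u, v, w} T,
      FirstOrder.Language.Structure.RelMap (pat ![(θ.rename fun i => Sum.inl (pairName i)).neg] Formula.truth) ![q]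

variable (A : Type z) [L.patternLanguage.Structure A]

/-- The set `L₁` of automorphisms `g` of `A` with `L₁(p, g p)` for all `p`. -/
def lascarSet : Set (A ≃[L.patternLanguage] A) :=
  {g | ∀ p : A, LascarDistLEOne.{u, v, w, z} T p (g p)}

/-- The quotient of the automorphism group by the infinitesimal automorphisms; it carries the
quotient topology. -/
abbrev HausdorffAut (L : MSLanguage.{u, v}) (A : Type z) [L.patternLanguage.Structure A] :
    Type z :=
  (A ≃[L.patternLanguage] A) ⧸ FirstOrder.Language.infinitesimal L.patternLanguage A

/-- The image of `L₁` in the quotient by the infinitesimal automorphisms. -/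
def lascarSetQuot : Set (HausdorffAut L A) :=
  (fun g : A ≃[L.patternLanguage] A => (g : HausdorffAut L A)) '' lascarSet.{u, v, w, z} T A

/-- The subgroup generated by `L₁`. -/
def lascarSubgroup : Subgroup (HausdorffAut L A) :=
  Subgroup.closure (lascarSetQuot.{u, v, w, z} T A)

variable {A}

theorem LascarDistLEOne.map (g : A ≃[L.patternLanguage] A) {p p' : A}
    (h : LascarDistLEOne.{u, v, w, z} T p p') : LascarDistLEOne.{u, v, w, z} T (g p) (g p') := by
  obtain ⟨q, h1, h2, h3⟩ := h
  have key2 : ∀ (R : L.patternLanguage.Relations 2) (a b : A), FirstOrder.Language.Structure.RelMap R ![a, b] →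
      FirstOrder.Language.Structure.RelMap R ![g a, g b] := by
    intro R a b hR
    rw [← g.map_rel R] at hR
    convert hR using 1
    funext i
    fin_cases i <;> rfl
  have key1 : ∀ (R : L.patternLanguage.Relations 1) (a : A), FirstOrder.Language.Structure.RelMap R ![a] →
      FirstOrder.Language.Structure.RelMap R ![g a] := by
    intro R a hR
    rw [← g.map_rel R] at hR
    convert hR using 1
    funext i
    fin_cases i; rfl
  exact ⟨g q, fun φ => ⟨key2 _ _ _ (h1 φ).1, key2 _ _ _ (h1 φ).2⟩,
    fun φ => ⟨key2 _ _ _ (h2 φ).1, key2 _ _ _ (h2 φ).2⟩, fun θ hθ => key1 _ _ (h3 θ hθ)⟩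

variable (A)

theorem lascarSet_conj (h g : A ≃[L.patternLanguage] A) (hg : g ∈ lascarSet.{u, v, w, z} T A) :
    h * g * h⁻¹ ∈ lascarSet.{u, v, w, z} T A := by
  intro p
  have h1 := (hg (h⁻¹ p)).map T h
  rwa [FirstOrder.Language.aut_apply_inv_self] at h1

theorem lascarSetQuot_conj (h g : HausdorffAut L A) (hg : g ∈ lascarSetQuot.{u, v, w, z} T A) :
    h * g * h⁻¹ ∈ lascarSetQuot.{u, v, w, z} T A := by
  obtain ⟨g, hg, rfl⟩ := hg
  induction h using QuotientGroup.induction_on with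
  | H h => exact ⟨h * g * h⁻¹, lascarSet_conj T A h g hg, rfl⟩

instance lascarSubgroup_normal : (lascarSubgroup.{u, v, w, z} T A).Normal :=
  Subgroup.closure_normal_of_conj (lascarSetQuot_conj T A)

end MSLanguage

/-! Let E be the equivalence relation on S(M) generated by L₁. The patterns, pp formulas and L₁ are
closed conditions on types, so compactness is used throughout as passage to limits along
ultrafilters.

Core. The endomorphisms of S(M) form a compact Hausdorff semigroup with continuous right
multiplications. It has an idempotent e for which the elements exe form a group
(`exists_idempotent_isGroup`), and every endomorphism of J = im e is then an automorphism. Every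
model of 𝒯 maps to S(M) (`exists_hom_of_model`): a finite set of its pattern facts occurs in S(N)
for some N ⊨ T, which is expressed by a first-order formula and so passes to M. Hence J is
universal; and a homomorphism from J to a model of 𝒯 can be continued to an automorphism of J, which
pulls pp formulas back. Any core is isomorphic to this one, so its endomorphisms are automorphisms
as well (`IsCore.exists_equiv`); correcting a homomorphism S(M) → J by an automorphism gives a
retraction.

Closedness. Limits of automorphisms, retracted to J, are endomorphisms, hence automorphisms. So the
preimage of L₁ in Aut(J) is compact, and 𝒢 is Hausdorff.

Comparison. Fix a small elementary submodel enumerated by n. Types that agree over n are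
L₁-neighbours, because each class of a finite partition defined over n is defined over n. By
`SmallModel.exists_aut_of_endo`, every endomorphism f of S(M) agrees over n with σ ∘ i, where σ ∈
Aut(M) and the endomorphism i changes nothing over n; thus f(p) E σp for all p. For f = r this shows
that r moves types within E-classes; for f = g ∘ r with g ∈ Aut(J) it gives surjectivity.

The other input is a criterion for σ ∈ Aut_L(M), `SmallModel.mem_AutL_of_nearChain`: by saturation,
chains of bounded length between finite approximations yield a factorisation of σ into automorphisms
fixing models. It applies to every σ that preserves all E-classes (`SmallModel.mem_AutL_of_eqvGen`),
and to every σ approximating an infinitesimal g (`SmallModel.mem_AutL_of_infinitesimal`).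
Consequently the subgroup of Aut(J) generated by L₁ contains 𝔤 and equals {g : gp E p for all p}
(`SmallModel.closure_lascarSet`). So equality in 𝒢/⟨L₁⟩ means equality up to E, and the map σ ↦ r ∘
σ|_J can be computed modulo E, where r is invisible. -/

/-! ## Calculus of formulas with named variables -/

namespace MSLanguage

variable {L : MSLanguage.{u, v}}

namespace Assign

/-- Reindexing of an assignment along a sort-dependent map of variable names. -/
def pull {S : Type u} {V : Type x} {W : Type y} {M : S → Type w} (e : S → V → W)
    (a : Assign W M) : Assign V M := fun s v => a s (e s v)

variable {S : Type u} {V : Type x} {W : Type y} {M : S → Type w}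

theorem map_sum {N : S → Type z} (f : ∀ s, M s → N s) (a : Assign V M) (b : Assign W M) :
    (a.sum b).map f = (a.map f).sum (b.map f) := by
  funext s i
  cases i <;> rfl

theorem pull_map {N : S → Type z} (f : ∀ s, M s → N s) (e : S → V → W) (a : Assign W M) :
    (a.pull e).map f = (a.map f).pull e := rfl

end Assign

section Congr

variable {V : Type x} {W : Type y} {M : L.Sorts → Type z} [L.Structure M]

theorem Term.eval_congr {s : L.Sorts} (t : L.Term V s) {a b : Assign V M}
    (h : ∀ p ∈ t.vars, a p.1 p.2 = b p.1 p.2) : t.eval a = t.eval b := by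
  induction t with
  | var n => exact h _ rfl
  | func f ts ih =>
    simp only [Term.eval]
    congr 1
    funext i
    exact ih i fun p hp => h p (Set.mem_iUnion.2 ⟨i, hp⟩)

theorem Formula.realize_congr (φ : L.Formula V) {a b : Assign V M}
    (h : ∀ p ∈ φ.freeVars, a p.1 p.2 = b p.1 p.2) : φ.Realize a ↔ φ.Realize b := by
  induction φ generalizing a b with
  | falsum => rfl
  | equal t t' =>
    simp only [Formula.Realize]
    rw [t.eval_congr fun p hp => h p (Or.inl hp), t'.eval_congr fun p hp => h p (Or.inr hp)]
  | rel R ts =>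
    simp only [Formula.Realize]
    rw [show (fun i => (ts i).eval a) = fun i => (ts i).eval b from
      funext fun i => (ts i).eval_congr fun p hp => h p (Set.mem_iUnion.2 ⟨i, hp⟩)]
  | imp φ ψ ih ih' =>
    simp only [Formula.Realize]
    rw [ih fun p hp => h p (Or.inl hp), ih' fun p hp => h p (Or.inr hp)]
  | all s n φ ih =>
    simp only [Formula.Realize]
    refine forall_congr' fun m => ih fun p hp => ?_
    by_cases hps : p = (s, n)
    · subst hps; simp [Assign.update]
    · have h1 := h p ⟨hp, hps⟩
      obtain ⟨t, k⟩ := p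
      by_cases ht : t = s
      · subst ht
        have hk : k ≠ n := fun hk => hps (by rw [hk])
        simpa [Assign.update, hk] using h1
      · simpa [Assign.update, ht] using h1

theorem Term.finite_vars {s : L.Sorts} (t : L.Term V s) : t.vars.Finite := by
  induction t with
  | var n => exact Set.finite_singleton _
  | func f ts ih => exact Set.finite_iUnion ih

theorem Formula.finite_freeVars (φ : L.Formula V) : φ.freeVars.Finite := by
  induction φ with
  | falsum => exact Set.finite_empty
  | equal t t' => exact t.finite_vars.union t'.finite_vars
  | rel R ts => exact Set.finite_iUnion fun i => (ts i).finite_vars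
  | imp φ ψ ih ih' => exact ih.union ih'
  | all s n φ ih => exact ih.subset Set.sdiff_subset

theorem Term.eval_rename (e : V → W) {s : L.Sorts} (t : L.Term V s) (a : Assign W M) :
    (t.rename e).eval a = t.eval (a.pull fun _ => e) := by
  induction t with
  | var n => rfl
  | func f ts ih => simp only [Term.rename, Term.eval, ih]

theorem Formula.realize_rename {e : V → W} (he : Function.Injective e) (φ : L.Formula V)
    (a : Assign W M) : (φ.rename e).Realize a ↔ φ.Realize (a.pull fun _ => e) := by
  induction φ generalizing a with
  | falsum => rfl
  | equal t t' => simp only [Formula.rename, Formula.Realize, Term.eval_rename]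
  | rel R ts => simp only [Formula.rename, Formula.Realize, Term.eval_rename]
  | imp φ ψ ih ih' => simp only [Formula.rename, Formula.Realize, ih, ih']
  | all s n φ ih =>
    simp only [Formula.rename, Formula.Realize, ih]
    refine forall_congr' fun m => ?_
    have : (a.update s (e n) m).pull (fun _ => e) = (a.pull fun _ => e).update s n m := by
      funext t k
      by_cases ht : t = s
      · subst ht
        by_cases hk : k = n
        · subst hk; simp [Assign.pull, Assign.update]
        · simp [Assign.pull, Assign.update, hk, he.ne hk]
      · simp [Assign.pull, Assign.update, ht]
    rw [this]

end Congr

/-- Substitution of variables for variables in terms. -/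
def Term.subst {V : Type x} {W : Type y} (e : L.Sorts → V → W) : ∀ {s}, L.Term V s → L.Term W s
  | s, Term.var n => Term.var (e s n)
  | _, Term.func f ts => Term.func f fun i => (ts i).subst e

namespace Formula

open Classical in
/-- Capture-avoiding substitution of variables for the free variables. -/
noncomputable def subst {V : Type x} {W : Type y} [Nonempty W] :
    (L.Sorts → V → W) → L.Formula V → L.Formula W
  | _, falsum => falsum
  | e, equal t t' => equal (t.subst e) (t'.subst e)
  | e, rel R ts => rel R fun i => (ts i).subst e
  | e, imp φ ψ => imp (φ.subst e) (ψ.subst e)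
  | e, all s n φ =>
    -- The bound variable is renamed away from the images of all free variables of the body. Such a
    -- name exists if `W` is infinite.
    let k := Classical.epsilon fun k : W => ∀ p ∈ φ.freeVars, e p.1 p.2 ≠ k
    all s k (φ.subst fun t m => if t = s ∧ m = n then k else e t m)

/-- Conjunction. -/
def and {V : Type x} (φ ψ : L.Formula V) : L.Formula V := (φ.imp ψ.neg).neg

/-- Equivalence. -/
def iff {V : Type x} (φ ψ : L.Formula V) : L.Formula V := (φ.imp ψ).and (ψ.imp φ)

/-- Existential quantification. -/
def ex {V : Type x} (s : L.Sorts) (n : V) (φ : L.Formula V) : L.Formula V := (all s n φ.neg).neg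

/-- Conjunction of a finite family. -/
noncomputable def bigAnd {V : Type x} {ι : Type y} (F : Finset ι) (f : ι → L.Formula V) :
    L.Formula V := F.toList.foldr (fun i φ => (f i).and φ) truth

/-- Disjunction of a finite family. -/
noncomputable def bigOr {V : Type x} {ι : Type y} (F : Finset ι) (f : ι → L.Formula V) :
    L.Formula V := (bigAnd F fun i => (f i).neg).neg

/-- Existential quantification over a list of variables. -/
def exList {V : Type x} (l : List (L.Sorts × V)) (φ : L.Formula V) : L.Formula V :=
  l.foldr (fun p ψ => ψ.ex p.1 p.2) φ

open Classical in
/-- Existential quantification over all the variables with names in `V`. -/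
noncomputable def exL {V : Type x} {W : Type y} [Nonempty W] (φ : L.Formula (V ⊕ W)) :
    L.Formula W :=
  -- After the quantification no name from `V` is free, so the default name substituted for these
  -- never matters.
  (exList (φ.finite_freeVars.toFinset.filter fun p => p.2.isLeft).toList φ).subst
    fun _ => Sum.elim (fun _ => Classical.arbitrary W) id

/-- Universal quantification over all the variables with names in `V`. -/
noncomputable def allL {V : Type x} {W : Type y} [Nonempty W] (φ : L.Formula (V ⊕ W)) :
    L.Formula W := (exL φ.neg).neg

section Realize

variable {V : Type x} {W : Type y} {M : L.Sorts → Type z} [L.Structure M]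

@[simp] theorem realize_neg (φ : L.Formula V) (a : Assign V M) :
    φ.neg.Realize a ↔ ¬ φ.Realize a := Iff.rfl

@[simp] theorem realize_truth (a : Assign V M) : (truth : L.Formula V).Realize a := fun h => h

@[simp] theorem realize_imp (φ ψ : L.Formula V) (a : Assign V M) :
    (φ.imp ψ).Realize a ↔ (φ.Realize a → ψ.Realize a) := Iff.rfl

@[simp] theorem realize_and (φ ψ : L.Formula V) (a : Assign V M) :
    (φ.and ψ).Realize a ↔ φ.Realize a ∧ ψ.Realize a := by
  simp only [and, realize_neg, realize_imp]; tauto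

@[simp] theorem realize_iff (φ ψ : L.Formula V) (a : Assign V M) :
    (φ.iff ψ).Realize a ↔ (φ.Realize a ↔ ψ.Realize a) := by
  simp only [iff, realize_and, realize_imp]; tauto

@[simp] theorem realize_ex (s : L.Sorts) (n : V) (φ : L.Formula V) (a : Assign V M) :
    (φ.ex s n).Realize a ↔ ∃ m : M s, φ.Realize (a.update s n m) := by
  simp only [ex, realize_neg, Realize]; push Not; rfl

@[simp] theorem realize_bigAnd {ι : Type*} (F : Finset ι) (f : ι → L.Formula V) (a : Assign V M) :
    (bigAnd F f).Realize a ↔ ∀ i ∈ F, (f i).Realize a := by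
  have : ∀ l : List ι, (l.foldr (fun i φ => (f i).and φ) truth).Realize a ↔
      ∀ i ∈ l, (f i).Realize a := by
    intro l
    induction l with
    | nil => simp
    | cons i l ih => simp [ih]
  simpa [bigAnd] using this F.toList

@[simp] theorem realize_bigOr {ι : Type*} (F : Finset ι) (f : ι → L.Formula V) (a : Assign V M) :
    (bigOr F f).Realize a ↔ ∃ i ∈ F, (f i).Realize a := by
  simp [bigOr]

theorem realize_exList (l : List (L.Sorts × V)) (φ : L.Formula V) (a : Assign V M) :
    (exList l φ).Realize a ↔
      ∃ b : Assign V M, (∀ p ∉ l, b p.1 p.2 = a p.1 p.2) ∧ φ.Realize b := by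
  classical
  induction l generalizing a with
  | nil =>
    refine ⟨fun h => ⟨a, fun _ _ => rfl, h⟩, ?_⟩
    rintro ⟨b, hb, h⟩
    have : b = a := funext fun s => funext fun n => hb (s, n) (by simp)
    rwa [this] at h
  | cons q l ih =>
    change ((exList l φ).ex q.1 q.2).Realize a ↔ _
    simp only [realize_ex, ih]
    constructor
    · rintro ⟨m, b, hb, h⟩
      refine ⟨b, fun p hp => ?_, h⟩
      simp only [List.mem_cons, not_or] at hp
      rw [hb p hp.2]
      obtain ⟨t, k⟩ := p
      obtain ⟨s, n⟩ := q
      by_cases ht : t = s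
      · subst ht
        have : k ≠ n := fun hk => hp.1 (by rw [hk])
        simp [Assign.update, this]
      · simp [Assign.update, ht]
    · rintro ⟨b, hb, h⟩
      refine ⟨b q.1 q.2, b, fun p hp => ?_, h⟩
      by_cases hpq : p = q
      · subst hpq; simp [Assign.update]
      · rw [hb p (by simp [hpq, hp])]
        obtain ⟨t, k⟩ := p
        obtain ⟨s, n⟩ := q
        by_cases ht : t = s
        · subst ht
          have : k ≠ n := fun hk => hpq (by rw [hk])
          simp [Assign.update, this]
        · simp [Assign.update, ht]

theorem _root_.MSLanguage.Term.eval_subst (e : L.Sorts → V → W) {s : L.Sorts} (t : L.Term V s)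
    (a : Assign W M) : (t.subst e).eval a = t.eval (a.pull e) := by
  induction t with
  | var n => rfl
  | func f ts ih => simp only [Term.subst, Term.eval, ih]

@[simp] theorem realize_subst [Infinite W] (e : L.Sorts → V → W) (φ : L.Formula V)
    (a : Assign W M) : (φ.subst e).Realize a ↔ φ.Realize (a.pull e) := by
  classical
  induction φ generalizing e a with
  | falsum => rfl
  | equal t t' => simp only [subst, Realize, Term.eval_subst]
  | rel R ts => simp only [subst, Realize, Term.eval_subst]
  | imp φ ψ ih ih' => simp only [subst, Realize, ih, ih']
  | all s n φ ih =>
    have hk : ∃ k : W, ∀ p ∈ φ.freeVars, e p.1 p.2 ≠ k := by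
      obtain ⟨k, hk⟩ := (φ.finite_freeVars.image fun p => e p.1 p.2).exists_notMem
      exact ⟨k, fun p hp h => hk ⟨p, hp, h⟩⟩
    have hk' := Classical.epsilon_spec hk
    simp only [subst, Realize, ih]
    refine forall_congr' fun m => realize_congr _ fun p hp => ?_
    have hkp := hk' p hp
    generalize (Classical.epsilon fun k : W => ∀ p ∈ φ.freeVars, e p.1 p.2 ≠ k) = k at hkp ⊢
    obtain ⟨t, j⟩ := p
    by_cases ht : t = s
    · subst ht
      by_cases hj : j = n
      · subst hj; simp [Assign.pull, Assign.update]
      · simp [Assign.pull, Assign.update, hj, hkp]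
    · simp [Assign.pull, Assign.update, ht]

theorem realize_exL [Infinite W] [∀ s, Nonempty (M s)] (φ : L.Formula (V ⊕ W)) (b : Assign W M) :
    φ.exL.Realize b ↔ ∃ a : Assign V M, φ.Realize (a.sum b) := by
  classical
  simp only [exL, realize_subst, realize_exList]
  constructor
  · rintro ⟨c, hc, h⟩
    refine ⟨fun s v => c s (.inl v), (realize_congr _ ?_).1 h⟩
    rintro ⟨s, i⟩ hi
    cases i with
    | inl i => rfl
    | inr i => exact hc (s, .inr i) (by simp)
  · rintro ⟨a, h⟩
    -- Off the free variables of `φ` the assignment has to be the one dictated by the substitution,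
    -- default name included.
    refine ⟨fun s i => if (s, i) ∈ φ.freeVars then (a.sum b) s i else
      b s (Sum.elim (fun _ => Classical.arbitrary W) id i), ?_, (realize_congr _ ?_).1 h⟩
    · rintro ⟨s, i⟩ hi
      by_cases hf : (s, i) ∈ φ.freeVars
      · cases i with
        | inl i => simp [hf] at hi
        | inr i => simp [hf, Assign.sum, Assign.pull]
      · simp [hf, Assign.pull]
    · rintro ⟨s, i⟩ hi
      simp [hi]

theorem realize_allL [Infinite W] [∀ s, Nonempty (M s)] (φ : L.Formula (V ⊕ W)) (b : Assign W M) :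
    φ.allL.Realize b ↔ ∀ a : Assign V M, φ.Realize (a.sum b) := by
  simp [allL, realize_exL]

end Realize

end Formula

/-- A finite set of names can be coded by natural numbers. -/
theorem exists_nat_coding {V : Type x} [Nonempty V] (F : Set V) (hF : F.Finite) :
    ∃ (e : ℕ → V) (e' : V → ℕ), ∀ v ∈ F, e (e' v) = v := by
  classical
  obtain ⟨f, hf⟩ := Set.countable_iff_exists_injOn.1 hF.countable
  exact ⟨Function.invFunOn f F, f, fun v hv => Set.InjOn.leftInvOn_invFunOn hf hv⟩

/-- Coding of the free variables of a formula by natural numbers. -/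
theorem Formula.exists_nat_coding {V : Type x} [Nonempty V] (φ : L.Formula V) :
    ∃ (e : ℕ → V) (e' : V → ℕ), ∀ (M : L.Sorts → Type z) [L.Structure M] (a : Assign V M),
      (φ.subst fun _ => e').Realize (a.pull fun _ => e) ↔ φ.Realize a := by
  obtain ⟨e, e', h⟩ := MSLanguage.exists_nat_coding _ (φ.finite_freeVars.image Prod.snd)
  refine ⟨e, e', fun M _ a => ?_⟩
  rw [Formula.realize_subst]
  exact φ.realize_congr fun p hp => congrArg (a p.1) (h _ ⟨p, hp, rfl⟩)

/-- The universal closure of a formula. -/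
noncomputable def Formula.close (φ : L.Formula ℕ) : L.Sentence :=
  ⟨(Formula.exList φ.finite_freeVars.toFinset.toList φ.neg).neg, by
    have : ∀ (l : List (L.Sorts × ℕ)) (ψ : L.Formula ℕ),
        (Formula.exList l ψ).freeVars = ψ.freeVars \ {p | p ∈ l} := by
      intro l ψ
      induction l with
      | nil => simp [Formula.exList]
      | cons q l ih =>
        change (Formula.ex q.1 q.2 (Formula.exList l ψ)).freeVars = _
        simp only [Formula.ex, Formula.neg, Formula.freeVars, ih]
        ext p
        simp only [Set.union_empty, Set.mem_sdiff, Set.mem_singleton_iff, List.mem_cons,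
          Set.mem_ofPred_eq]
        tauto
    change (Formula.exList _ _).freeVars ∪ ∅ = ∅
    rw [this]
    ext p
    simp [Formula.neg, Formula.freeVars]⟩

theorem Formula.isTrue_close (φ : L.Formula ℕ) (M : L.Sorts → Type z) [L.Structure M]
    [∀ s, Nonempty (M s)] : φ.close.IsTrue M ↔ ∀ a : Assign ℕ M, φ.Realize a := by
  constructor
  · intro h a
    by_contra hc
    exact h a ((realize_exList _ _ _).2 ⟨a, fun _ _ => rfl, hc⟩)
  · intro h a h'
    obtain ⟨b, -, hb⟩ := (realize_exList _ _ _).1 h'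
    exact hb (h b)

/-- The models of a complete theory satisfy the same universally closed formulas. -/
theorem Theory.IsComplete.forall_realize {T : L.Theory} (hT : Theory.IsComplete.{u, v, w} T)
    {M N : L.Sorts → Type w} [L.Structure M] [L.Structure N] (hM : T.IsModel M) (hN : T.IsModel N)
    {V : Type x} [Nonempty V] (φ : L.Formula V) (h : ∀ a : Assign V M, φ.Realize a)
    (a : Assign V N) : φ.Realize a := by
  have := hM.nonempty
  have := hN.nonempty
  -- Sentences use names in ℕ, so the finitely many free variables are first coded by numbers.
  obtain ⟨e, e', he⟩ := φ.exists_nat_coding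
  rw [← he]
  have h1 : (φ.subst fun _ => e').close.IsTrue M := by
    rw [Formula.isTrue_close]
    intro b
    rw [Formula.realize_subst]
    exact h _
  rcases hT (φ.subst fun _ => e').close with h2 | h2
  · exact (Formula.isTrue_close _ N).1 (h2 N hN) _
  · exact absurd h1 (h2 M hM)

theorem Theory.IsComplete.exists_realize {T : L.Theory} (hT : Theory.IsComplete.{u, v, w} T)
    {M N : L.Sorts → Type w} [L.Structure M] [L.Structure N] (hM : T.IsModel M) (hN : T.IsModel N)
    {V : Type x} [Nonempty V] (φ : L.Formula V) (h : ∃ a : Assign V M, φ.Realize a) :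
    ∃ a : Assign V N, φ.Realize a := by
  by_contra hc
  push Not at hc
  obtain ⟨a, ha⟩ := h
  exact hT.forall_realize hN hM φ.neg hc a ha

/-- Elementary maps preserve formulas with arbitrary variable names. -/
theorem IsElementary.realize_map {N : L.Sorts → Type z} {M : L.Sorts → Type w} [L.Structure N]
    [L.Structure M] {f : ∀ s, N s → M s} (hf : IsElementary f) {V : Type x} [Nonempty V]
    (φ : L.Formula V) (a : Assign V N) : φ.Realize (a.map f) ↔ φ.Realize a := by
  obtain ⟨e, e', h⟩ := MSLanguage.exists_nat_coding _ (φ.finite_freeVars.image Prod.snd)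
  have key : ∀ {M : L.Sorts → Type _} [L.Structure M] (a : Assign V M),
      (φ.subst fun _ => e').Realize (a.pull fun _ => e) ↔ φ.Realize a := by
    intro M _ a
    rw [Formula.realize_subst]
    exact φ.realize_congr fun p hp => congrArg (a p.1) (h _ ⟨p, hp, rfl⟩)
  have key' : ∀ {M : L.Sorts → Type _} [L.Structure M] (a : Assign V M),
      (φ.subst fun _ => e').Realize (a.pull fun _ => e) ↔ φ.Realize a := by
    intro M _ a
    rw [Formula.realize_subst]
    exact φ.realize_congr fun p hp => congrArg (a p.1) (h _ ⟨p, hp, rfl⟩)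
  rw [← key a, ← key' (a.map f), ← Assign.pull_map]
  exact hf _ _

end MSLanguage

/-! ## Type spaces: consequences, limits along ultrafilters, the action of automorphisms -/

/-- An ultrafilter containing a family of conditions that is finitely satisfiable. -/
theorem exists_ultrafilter_of_finite {I : Type x} {X : Type y} (C : I → X → Prop)
    (h : ∀ F : Finset I, ∃ x, ∀ i ∈ F, C i x) : ∃ U : Ultrafilter X, ∀ i, ∀ᶠ x in U, C i x := by
  classical
  choose ξ hξ using h
  refine ⟨(Ultrafilter.of Filter.atTop).map ξ, fun i => ?_⟩
  have h1 : ∀ᶠ F : Finset I in (Ultrafilter.of Filter.atTop : Ultrafilter (Finset I)), {i} ≤ F :=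
    (Filter.eventually_ge_atTop ({i} : Finset I)).filter_mono (Ultrafilter.of_le _)
  exact h1.mono fun F hF => hξ F i (hF (Finset.mem_singleton_self i))

namespace MSLanguage

namespace Assign

variable {S : Type u} {M : S → Type w}

/-- A pair of tuples as a tuple. -/
def merge (a a' : Assign ℕ M) : Assign ℕ M :=
  (a.sum a').pull fun _ => Equiv.natSumNatEquivNat.symm

theorem merge_inl (a a' : Assign ℕ M) : (merge a a').pull (fun _ n => pairName (.inl n)) = a := by
  funext s n
  have : Equiv.natSumNatEquivNat.symm (pairName (.inl n)) = Sum.inl n := by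
    rw [Equiv.symm_apply_eq]; rfl
  simp [merge, Assign.pull, this, Assign.sum]

theorem merge_inr (a a' : Assign ℕ M) : (merge a a').pull (fun _ n => pairName (.inr n)) = a' := by
  funext s n
  have : Equiv.natSumNatEquivNat.symm (pairName (.inr n)) = Sum.inr n := by
    rw [Equiv.symm_apply_eq]; rfl
  simp [merge, Assign.pull, this, Assign.sum]

end Assign

variable {L : MSLanguage.{u, v}} {M : L.Sorts → Type w} [L.Structure M]

namespace TypeSpace

/-- Finite satisfiability is applied to the formulas of `G` in `p` and the negations of the others.
This replaces a type by a tuple of `M` in every argument that involves finitely many formulas. -/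
theorem exists_realize_iff (p : TypeSpace M) (G : Set (L.Formula (ℕ ⊕ ℕ) × Assign ℕ M))
    (hG : G.Finite) :
    ∃ a : Assign ℕ M, ∀ φ ∈ G, (φ.1.Realize (a.sum φ.2) ↔ φ ∈ p.formulas) := by
  classical
  obtain ⟨a, ha⟩ := p.finSat
    (hG.toFinset.image fun φ => if φ ∈ p.formulas then φ else (φ.1.neg, φ.2)) (by
      intro ψ hψ
      simp only [Finset.coe_image, Set.mem_image, Set.Finite.coe_toFinset] at hψ
      obtain ⟨φ, -, rfl⟩ := hψ
      split_ifs with h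
      · exact h
      · exact (p.complete φ.1 φ.2).resolve_left h)
  refine ⟨a, fun φ hφ => ?_⟩
  have h1 := ha _ (Finset.mem_image_of_mem _ (hG.mem_toFinset.2 hφ))
  split_ifs at h1 with h
  · exact ⟨fun _ => h, fun _ => h1⟩
  · exact ⟨fun h2 => absurd h2 h1, fun h2 => absurd h2 h⟩

theorem mem_of_forall (p : TypeSpace M) {G : Set (L.Formula (ℕ ⊕ ℕ) × Assign ℕ M)}
    (hG : G.Finite) (hGp : G ⊆ p.formulas) {φ : L.Formula (ℕ ⊕ ℕ)} {b : Assign ℕ M}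
    (h : ∀ a : Assign ℕ M, (∀ ψ ∈ G, ψ.1.Realize (a.sum ψ.2)) → φ.Realize (a.sum b)) :
    (φ, b) ∈ p.formulas := by
  obtain ⟨a, ha⟩ := p.exists_realize_iff (insert (φ, b) G) (hG.insert _)
  exact (ha _ (Set.mem_insert _ _)).1 (h a fun ψ hψ => (ha _ (Or.inr hψ)).2 (hGp hψ))

theorem mem_congr (p : TypeSpace M) {φ φ' : L.Formula (ℕ ⊕ ℕ)} {b b' : Assign ℕ M}
    (h : ∀ a : Assign ℕ M, φ.Realize (a.sum b) ↔ φ'.Realize (a.sum b')) :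
    (φ, b) ∈ p.formulas ↔ (φ', b') ∈ p.formulas := by
  obtain ⟨a, ha⟩ := p.exists_realize_iff {(φ, b), (φ', b')} (Set.toFinite _)
  rw [← ha (φ, b) (by simp), ← ha (φ', b') (by simp)]
  exact h a

theorem neg_mem (p : TypeSpace M) {φ : L.Formula (ℕ ⊕ ℕ)} {b : Assign ℕ M} :
    (φ.neg, b) ∈ p.formulas ↔ (φ, b) ∉ p.formulas := by
  obtain ⟨a, ha⟩ := p.exists_realize_iff {(φ, b), (φ.neg, b)} (Set.toFinite _)
  rw [← ha (φ, b) (by simp), ← ha (φ.neg, b) (by simp)]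
  rfl

theorem ext_of_imp {p p' : TypeSpace M} (h : ∀ φ b, (φ, b) ∈ p.formulas → (φ, b) ∈ p'.formulas) :
    p = p' := by
  ext ⟨φ, b⟩
  exact ⟨h φ b, fun h' => by_contra fun hc => p'.neg_mem.1 (h _ _ (p.neg_mem.2 hc)) h'⟩

/-- The type of a tuple of elements of `M`. -/
def tp (m : Assign ℕ M) : TypeSpace M where
  formulas := {φ | φ.1.Realize (m.sum φ.2)}
  finSat := fun _ hF => ⟨m, fun _ hφ => hF hφ⟩
  complete := fun φ b => em (φ.Realize (m.sum b))

theorem mem_tp {m : Assign ℕ M} {φ : L.Formula (ℕ ⊕ ℕ)} {b : Assign ℕ M} :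
    (φ, b) ∈ (tp m).formulas ↔ φ.Realize (m.sum b) := Iff.rfl

/-- The limit of a family of types along an ultrafilter. -/
def lim {I : Type x} (U : Ultrafilter I) (p : I → TypeSpace M) : TypeSpace M where
  formulas := {φ | ∀ᶠ i in U, φ ∈ (p i).formulas}
  finSat := fun F hF => by
    have h : ∀ᶠ i in (U : Filter I), ∀ φ ∈ F, φ ∈ (p i).formulas :=
      (Filter.eventually_all_finset F).2 fun φ hφ => hF hφ
    obtain ⟨i, hi⟩ := h.exists
    exact (p i).finSat F hi
  complete := fun φ b => by
    rcases U.em fun i => (φ, b) ∈ (p i).formulas with h | h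
    · exact Or.inl h
    · exact Or.inr (h.mono fun i hi => (p i).neg_mem.2 hi)

theorem mem_lim {I : Type x} {U : Ultrafilter I} {p : I → TypeSpace M}
    {φ : L.Formula (ℕ ⊕ ℕ)} {b : Assign ℕ M} :
    (φ, b) ∈ (lim U p).formulas ↔ ∀ᶠ i in U, (φ, b) ∈ (p i).formulas := Iff.rfl

theorem lim_const {I : Type x} (U : Ultrafilter I) (p : TypeSpace M) : lim U (fun _ => p) = p :=
  ext_of_imp fun φ b h => by
    obtain ⟨-, h⟩ := (mem_lim.1 h).exists
    exact h

theorem lim_congr {I : Type x} {U : Ultrafilter I} {p p' : I → TypeSpace M}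
    (h : ∀ᶠ i in U, p i = p' i) : lim U p = lim U p' :=
  ext_of_imp fun _ _ h' => ((mem_lim.1 h').and h).mono fun _ hi => hi.2 ▸ hi.1

theorem relMap_iff {n : ℕ} (t : L.patternLanguage.Relations n) (p : Fin n → TypeSpace M) :
    FirstOrder.Language.Structure.RelMap t p ↔
      ∀ b : Assign ℕ M, t.2.Realize b → ∃ i, (t.1 i, b) ∉ (p i).formulas := by
  change (¬ ∃ b : Assign ℕ M, t.2.Realize b ∧ ∀ i, (t.1 i, b) ∈ (p i).formulas) ↔ _
  push Not
  rfl

theorem relMap_pat_one (φ : L.Formula (ℕ ⊕ ℕ)) (p : TypeSpace M) :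
    FirstOrder.Language.Structure.RelMap (pat ![φ] Formula.truth) ![p] ↔
      ∀ b : Assign ℕ M, (φ, b) ∉ p.formulas := by
  rw [relMap_iff]
  simp [pat]

theorem relMap_pat_two (φ φ' : L.Formula (ℕ ⊕ ℕ)) (p p' : TypeSpace M) :
    FirstOrder.Language.Structure.RelMap (pat ![φ, φ'] Formula.truth) ![p, p'] ↔
      ∀ b : Assign ℕ M, (φ, b) ∈ p.formulas → (φ', b) ∉ p'.formulas := by
  rw [relMap_iff]
  simp only [pat, Fin.exists_fin_two, Formula.realize_truth, true_implies, Matrix.cons_val_zero,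
    Matrix.cons_val_one]
  simp only [imp_iff_not_or]

/-- A failure of a pattern relation is witnessed by a single `b` and finitely many memberships, so a
failure at the limit would occur at almost all indices. -/
theorem relMap_lim {I : Type x} {U : Ultrafilter I} {n : ℕ} (t : L.patternLanguage.Relations n)
    (p : I → Fin n → TypeSpace M)
    (h : ∀ᶠ j in U, FirstOrder.Language.Structure.RelMap t (p j)) :
    FirstOrder.Language.Structure.RelMap t fun i => lim U fun j => p j i := by
  rw [relMap_iff]
  intro b hb
  by_contra hc
  push Not at hc
  have h1 : ∀ᶠ j in (U : Filter I), ∀ i, (t.1 i, b) ∈ (p j i).formulas :=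
    Filter.eventually_all.2 hc
  obtain ⟨j, hj, hj'⟩ := (h.and h1).exists
  obtain ⟨i, hi⟩ := (relMap_iff t (p j)).1 hj b hb
  exact hi (hj' i)

/-- The pattern is required for one `b` at a time: no single `ξ` has to omit it for all parameters,
only the limit does. -/
theorem relMap_lim_tp {A : Type x} {U : Ultrafilter (A → Assign ℕ M)} {n : ℕ}
    (t : L.patternLanguage.Relations n) (a : Fin n → A)
    (h : ∀ b : Assign ℕ M, ∀ᶠ ξ : A → Assign ℕ M in U, t.2.Realize b →
      ∃ i, ¬ (t.1 i).Realize ((ξ (a i)).sum b)) :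
    FirstOrder.Language.Structure.RelMap t fun i => lim U fun ξ => tp (ξ (a i)) := by
  rw [relMap_iff]
  intro b hb
  by_contra hc
  push Not at hc
  have h1 : ∀ᶠ ξ in (U : Filter (A → Assign ℕ M)), ∀ i, (t.1 i).Realize ((ξ (a i)).sum b) :=
    Filter.eventually_all.2 hc
  obtain ⟨ξ, hξ, hξ'⟩ := ((h b).and h1).exists
  obtain ⟨i, hi⟩ := hξ hb
  exact hi (hξ' i)

theorem mem_act {σ : Aut M} {p : TypeSpace M} {φ : L.Formula (ℕ ⊕ ℕ)} {b : Assign ℕ M} :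
    (φ, b) ∈ (act σ p).formulas ↔ (φ, b.map σ⁻¹.toFun) ∈ p.formulas := Iff.rfl

theorem map_map_inv (σ : Aut M) {V : Type x} (b : Assign V M) :
    (b.map σ⁻¹.toFun).map σ.toFun = b :=
  funext fun s => funext fun n => σ.toFun_toFun_inv s (b s n)

theorem map_inv_map (σ : Aut M) {V : Type x} (b : Assign V M) :
    (b.map σ.toFun).map σ⁻¹.toFun = b :=
  funext fun s => funext fun n => σ.toFun_inv_toFun s (b s n)

theorem mem_act_map {σ : Aut M} {p : TypeSpace M} {φ : L.Formula (ℕ ⊕ ℕ)} {b : Assign ℕ M} :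
    (φ, b.map σ.toFun) ∈ (act σ p).formulas ↔ (φ, b) ∈ p.formulas := by
  rw [mem_act, map_inv_map]

theorem act_mul (σ τ : Aut M) (p : TypeSpace M) : act (σ * τ) p = act σ (act τ p) := by
  ext ⟨φ, b⟩
  rw [mem_act, mem_act, mem_act, mul_inv_rev]
  rfl

theorem act_one (p : TypeSpace M) : act 1 p = p := by
  ext ⟨φ, b⟩
  rw [mem_act, inv_one]
  rfl

theorem act_tp (σ : Aut M) (m : Assign ℕ M) : act σ (tp m) = tp (m.map σ.toFun) := by
  ext ⟨φ, b⟩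
  rw [mem_act, mem_tp, mem_tp, ← σ.realize_map, Assign.map_sum, map_map_inv]

variable (M) in
/-- The action of an automorphism on types is a homomorphism of pattern structures. -/
def actHom (σ : Aut M) : TypeSpace M →[L.patternLanguage] TypeSpace M where
  toFun := act σ
  map_fun' := fun f _ => f.elim
  map_rel' := fun t p h => by
    rw [relMap_iff] at h ⊢
    intro b hb
    obtain ⟨i, hi⟩ := h (b.map σ⁻¹.toFun) ((σ⁻¹.realize_map _ _).2 hb)
    exact ⟨i, hi⟩

@[simp] theorem actHom_apply (σ : Aut M) (p : TypeSpace M) : actHom M σ p = act σ p := rfl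

end TypeSpace

/-! ### Lascar neighbours in type spaces -/

/-- The relation of Lascar distance at most one is preserved by homomorphisms. -/
theorem LascarDistLEOne.hom {T : L.Theory} {A : Type y} {B : Type z}
    [L.patternLanguage.Structure A] [L.patternLanguage.Structure B]
    (f : A →[L.patternLanguage] B) {p p' : A} (h : LascarDistLEOne.{u, v, w} T p p') :
    LascarDistLEOne.{u, v, w} T (f p) (f p') := by
  obtain ⟨q, h1, h2, h3⟩ := h
  have key2 : ∀ (R : L.patternLanguage.Relations 2) (a b : A),
      FirstOrder.Language.Structure.RelMap R ![a, b] →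
      FirstOrder.Language.Structure.RelMap R ![f a, f b] := by
    intro R a b hR
    convert f.map_rel R _ hR using 1
    funext i
    fin_cases i <;> rfl
  have key1 : ∀ (R : L.patternLanguage.Relations 1) (a : A),
      FirstOrder.Language.Structure.RelMap R ![a] →
      FirstOrder.Language.Structure.RelMap R ![f a] := by
    intro R a hR
    convert f.map_rel R _ hR using 1
    funext i
    fin_cases i; rfl
  exact ⟨f q, fun φ => ⟨key2 _ _ _ (h1 φ).1, key2 _ _ _ (h1 φ).2⟩,
    fun φ => ⟨key2 _ _ _ (h2 φ).1, key2 _ _ _ (h2 φ).2⟩, fun θ hθ => key1 _ _ (h3 θ hθ)⟩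

namespace TypeSpace

theorem isPullback_iff {e : ℕ → ℕ} {q p : TypeSpace M} :
    IsPullback L e q p ↔
      ∀ φ b, (φ.rename (Sum.map e id), b) ∈ q.formulas ↔ (φ, b) ∈ p.formulas := by
  simp only [IsPullback, relMap_pat_two, neg_mem, not_not]
  exact forall_congr' fun φ => ⟨fun h b => ⟨h.1 b, fun h' => by_contra fun hc => h.2 b hc h'⟩,
    fun h => ⟨fun b => (h b).1, fun b h1 h2 => h1 ((h b).2 h2)⟩⟩

theorem lascarDistLEOne_iff {T : L.Theory} {p p' : TypeSpace M} :
    LascarDistLEOne.{u, v, w} T p p' ↔ ∃ q : TypeSpace M,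
      (∀ φ b, (φ.rename (Sum.map (fun n => pairName (Sum.inl n)) id), b) ∈ q.formulas ↔
        (φ, b) ∈ p.formulas) ∧
      (∀ φ b, (φ.rename (Sum.map (fun n => pairName (Sum.inr n)) id), b) ∈ q.formulas ↔
        (φ, b) ∈ p'.formulas) ∧
      ∀ θ ∈ lascarNeighbours.{u, v, w} T, ∀ b,
        (θ.rename fun i => Sum.inl (pairName i), b) ∈ q.formulas := by
  simp only [LascarDistLEOne, isPullback_iff, relMap_pat_one, neg_mem, not_not]

theorem pairName_injective : Function.Injective pairName := by
  rintro (a | a) (b | b) h <;> simp [pairName] at h ⊢ <;> omega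

theorem sum_map_injective {e : ℕ → ℕ} (he : Function.Injective e) :
    Function.Injective (Sum.map e (id : ℕ → ℕ)) := he.sumMap Function.injective_id

theorem inl_pairName_injective : Function.Injective fun n => pairName (Sum.inl n) :=
  pairName_injective.comp Sum.inl_injective

theorem inr_pairName_injective : Function.Injective fun n => pairName (Sum.inr n) :=
  pairName_injective.comp Sum.inr_injective

theorem realize_rename_sum {e : ℕ → ℕ} (he : Function.Injective e) (φ : L.Formula (ℕ ⊕ ℕ))
    (a b : Assign ℕ M) : (φ.rename (Sum.map e id)).Realize (a.sum b) ↔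
      φ.Realize ((a.pull fun _ => e).sum b) := by
  rw [Formula.realize_rename (sum_map_injective he)]
  have : (a.sum b).pull (fun _ => Sum.map e id) = (a.pull fun _ => e).sum b := by
    funext s i; cases i <;> rfl
  rw [this]

theorem realize_rename_pairName (θ : L.Formula (ℕ ⊕ ℕ)) (c b : Assign ℕ M) :
    (θ.rename fun i => (Sum.inl (pairName i) : ℕ ⊕ ℕ)).Realize (c.sum b) ↔
      θ.Realize ((c.pull fun _ n => pairName (.inl n)).sum (c.pull fun _ n => pairName (.inr n))) := by
  rw [Formula.realize_rename (e := fun i => (Sum.inl (pairName i) : ℕ ⊕ ℕ))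
    (Sum.inl_injective.comp pairName_injective)]
  have : (c.sum b).pull (fun _ i => (Sum.inl (pairName i) : ℕ ⊕ ℕ)) =
      (c.pull fun _ n => pairName (.inl n)).sum (c.pull fun _ n => pairName (.inr n)) := by
    funext s i; cases i <;> rfl
  rw [this]

/-- Compactness: an ultrafilter on pairs of tuples makes the first components converge to `p` and
the second to `p'`; the limit of the types of the merged pairs is the required `q`. -/
theorem lascarDistLEOne_of_finite {T : L.Theory} {p p' : TypeSpace M}
    (h : ∀ F F' : Finset (L.Formula (ℕ ⊕ ℕ) × Assign ℕ M), ↑F ⊆ p.formulas → ↑F' ⊆ p'.formulas →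
      ∀ Θ : Finset (L.Formula (ℕ ⊕ ℕ)), ↑Θ ⊆ lascarNeighbours.{u, v, w} T →
      ∃ a a' : Assign ℕ M, (∀ φ ∈ F, φ.1.Realize (a.sum φ.2)) ∧
        (∀ φ ∈ F', φ.1.Realize (a'.sum φ.2)) ∧ ∀ θ ∈ Θ, θ.Realize (a.sum a')) :
    LascarDistLEOne.{u, v, w} T p p' := by
  classical
  obtain ⟨U, hU⟩ := exists_ultrafilter_of_finite
    (I := p.formulas ⊕ p'.formulas ⊕ lascarNeighbours.{u, v, w} T)
    (X := Assign ℕ M × Assign ℕ M)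
    (fun i x => Sum.elim (fun φ => φ.1.1.Realize (x.1.sum φ.1.2))
      (Sum.elim (fun φ => φ.1.1.Realize (x.2.sum φ.1.2)) fun θ => θ.1.Realize (x.1.sum x.2)) i)
    (by
      intro F
      obtain ⟨a, a', h1, h2, h3⟩ := h
        (F.preimage Sum.inl Sum.inl_injective.injOn |>.image Subtype.val)
        (F.preimage (Sum.inr ∘ Sum.inl) (Sum.inr_injective.comp Sum.inl_injective).injOn
          |>.image Subtype.val)
        (by intro φ hφ; simp at hφ; exact hφ.1) (by intro φ hφ; simp at hφ; exact hφ.1)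
        (F.preimage (Sum.inr ∘ Sum.inr) (Sum.inr_injective.comp Sum.inr_injective).injOn
          |>.image Subtype.val)
        (by intro φ hφ; simp at hφ; exact hφ.1)
      refine ⟨(a, a'), ?_⟩
      rintro (φ | φ | θ) hi
      · exact h1 _ (Finset.mem_image_of_mem _ (Finset.mem_preimage.2 hi))
      · exact h2 _ (Finset.mem_image_of_mem _ (Finset.mem_preimage.2 hi))
      · exact h3 _ (Finset.mem_image_of_mem _ (Finset.mem_preimage.2 hi)))
  rw [lascarDistLEOne_iff]
  refine ⟨lim U fun x => tp (Assign.merge x.1 x.2), fun φ b => ?_, fun φ b => ?_, fun θ hθ b => ?_⟩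
  · have h1 : lim U (fun x => tp x.1) = p :=
      (ext_of_imp (p := p) (p' := lim U fun x => tp x.1) fun φ b hφ => hU (.inl ⟨(φ, b), hφ⟩)).symm
    rw [← h1, mem_lim, mem_lim]
    simp only [mem_tp, realize_rename_sum inl_pairName_injective, Assign.merge_inl]
  · have h1 : lim U (fun x => tp x.2) = p' :=
      (ext_of_imp (p := p') (p' := lim U fun x => tp x.2) fun φ b hφ => hU (.inr (.inl ⟨(φ, b), hφ⟩))).symm
    rw [← h1, mem_lim, mem_lim]
    simp only [mem_tp, realize_rename_sum inr_pairName_injective, Assign.merge_inr]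
  · rw [mem_lim]
    simp only [mem_tp, realize_rename_pairName, Assign.merge_inl, Assign.merge_inr]
    exact hU (.inr (.inr ⟨θ, hθ⟩))

/-- The joint type `q` contains both `θ(x, x')` and `ψ(x', c)`, hence each consequence in `x`. This
is how the lengths of definable chains are tracked from a type to its neighbour. -/
theorem mem_left_of_lascarDistLEOne {T : L.Theory} {p p' : TypeSpace M}
    (h : LascarDistLEOne.{u, v, w} T p p') {θ : L.Formula (ℕ ⊕ ℕ)}
    (hθ : θ ∈ lascarNeighbours.{u, v, w} T) {ψ χ : L.Formula (ℕ ⊕ ℕ)} {c d : Assign ℕ M}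
    (hψ : (ψ, c) ∈ p'.formulas)
    (hχ : ∀ a z : Assign ℕ M, θ.Realize (a.sum z) → ψ.Realize (z.sum c) → χ.Realize (a.sum d)) :
    (χ, d) ∈ p.formulas := by
  obtain ⟨q, h1, h2, h3⟩ := lascarDistLEOne_iff.1 h
  rw [← h1]
  rw [← h2] at hψ
  refine q.mem_of_forall (Set.toFinite {_, _})
    (Set.insert_subset (h3 θ hθ d) (Set.singleton_subset_iff.2 hψ)) fun a ha => ?_
  rw [realize_rename_sum inl_pairName_injective]
  have h4 := ha _ (Set.mem_insert _ _)
  have h5 := ha _ (Set.mem_insert_of_mem _ (Set.mem_singleton _))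
  rw [realize_rename_pairName] at h4
  rw [realize_rename_sum inr_pairName_injective] at h5
  exact hχ _ _ h4 h5

theorem mem_right_of_lascarDistLEOne {T : L.Theory} {p p' : TypeSpace M}
    (h : LascarDistLEOne.{u, v, w} T p p') {θ : L.Formula (ℕ ⊕ ℕ)}
    (hθ : θ ∈ lascarNeighbours.{u, v, w} T) {ψ χ : L.Formula (ℕ ⊕ ℕ)} {c d : Assign ℕ M}
    (hψ : (ψ, c) ∈ p.formulas)
    (hχ : ∀ a z : Assign ℕ M, θ.Realize (z.sum a) → ψ.Realize (z.sum c) → χ.Realize (a.sum d)) :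
    (χ, d) ∈ p'.formulas := by
  obtain ⟨q, h1, h2, h3⟩ := lascarDistLEOne_iff.1 h
  rw [← h2]
  rw [← h1] at hψ
  refine q.mem_of_forall (Set.toFinite {_, _})
    (Set.insert_subset (h3 θ hθ d) (Set.singleton_subset_iff.2 hψ)) fun a ha => ?_
  rw [realize_rename_sum inr_pairName_injective]
  have h4 := ha _ (Set.mem_insert _ _)
  have h5 := ha _ (Set.mem_insert_of_mem _ (Set.mem_singleton _))
  rw [realize_rename_pairName] at h4
  rw [realize_rename_sum inl_pairName_injective] at h5
  exact hχ _ _ h4 h5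

end TypeSpace

end MSLanguage

/-! ## Enumerated elementary submodels -/

namespace MSLanguage

variable {L : MSLanguage.{u, v}}

/-- The tuple `n` enumerates a subset satisfying the Tarski-Vaught criterion. -/
def IsModelEnum {M : L.Sorts → Type w} [L.Structure M] {W : Type x} (n : Assign W M) : Prop :=
  ∀ (φ : L.Formula ℕ) (e : L.Sorts → ℕ → W) (s : L.Sorts) (k : ℕ),
    (∃ m, φ.Realize ((n.pull e).update s k m)) → ∃ i, φ.Realize ((n.pull e).update s k (n s i))

/-! ### Small elementary submodels from Skolem terms. -/

section SkolemTerms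

variable (L) in
/-- Trees of Skolem terms. -/
abbrev SkolemTree : Type (max u v) :=
  WType fun p : L.Formula ℕ × ℕ => (p.1.freeVars : Set (L.Sorts × ℕ))

open Classical in
/-- The values of a Skolem term, one in each sort. -/
noncomputable def SkolemTree.value (M : L.Sorts → Type w) [L.Structure M] [∀ s, Nonempty (M s)] :
    L.SkolemTree → ∀ s, M s
  | ⟨p, ch⟩ => fun s => Classical.epsilon fun m => p.1.Realize (Assign.update
      (fun t k => if h : (t, k) ∈ p.1.freeVars then SkolemTree.value M (ch ⟨(t, k), h⟩) t
        else Classical.arbitrary _) s p.2 m)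

/-- A witness for `φ` over values of trees is the value of the tree with root `(φ, k)` and these
trees as children. A tree has a value in every sort, so one index set serves all sorts. -/
theorem isModelEnum_skolem (M : L.Sorts → Type w) [L.Structure M] [∀ s, Nonempty (M s)] :
    IsModelEnum (fun s (i : ULift.{w} L.SkolemTree) => i.down.value M s : Assign _ M) := by
  classical
  rintro φ e s k ⟨m, hm⟩
  have key : ∀ m : M s, φ.Realize (Assign.update (Assign.pull e
        (fun s (i : ULift.{w} L.SkolemTree) => i.down.value M s : Assign _ M)) s k m) ↔
      φ.Realize (Assign.update
        (fun t j => if h : (t, j) ∈ φ.freeVars then SkolemTree.value M (e t j).down t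
          else Classical.arbitrary _) s k m) := by
    refine fun m => φ.realize_congr ?_
    rintro ⟨t, j⟩ hp
    by_cases ht : t = s
    · subst ht
      by_cases hj : j = k
      · subst hj; simp [Assign.update]
      · simp [Assign.update, hj, Assign.pull, hp]
    · simp [Assign.update, ht, Assign.pull, hp]
  refine ⟨⟨WType.mk (φ, k) fun p => (e p.1.1 p.1.2).down⟩, ?_⟩
  rw [key]
  exact Classical.epsilon_spec (p := fun m => φ.Realize (Assign.update
        (fun t j => if h : (t, j) ∈ φ.freeVars then SkolemTree.value M (e t j).down t
          else Classical.arbitrary _) s k m)) ⟨m, (key m).1 hm⟩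

theorem aleph0_le_mk_formula : ℵ₀ ≤ #(L.Formula ℕ) := by
  have h : Function.Injective fun n : ℕ => (Formula.neg^[n] Formula.falsum : L.Formula ℕ) := by
    intro m n
    induction m generalizing n with
    | zero =>
      cases n with
      | zero => simp
      | succ n => simp [Function.iterate_succ_apply', Formula.neg]
    | succ m ih =>
      cases n with
      | zero => simp [Function.iterate_succ_apply', Formula.neg]
      | succ n =>
        simp only [Function.iterate_succ_apply', Formula.neg, Formula.imp.injEq, and_true]
        exact fun h => congrArg _ (ih h)
  have : Infinite (L.Formula ℕ) := Infinite.of_injective _ h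
  exact aleph0_le_mk _

theorem mk_sorts_le : lift.{v} #L.Sorts ≤ #(L.Formula ℕ) := by
  have h : Function.Injective fun s : L.Sorts => (Formula.all s 0 Formula.falsum : L.Formula ℕ) :=
    fun s t h => by injection h
  have := mk_le_of_injective (α := ULift.{v} L.Sorts) (β := L.Formula ℕ) (f := fun s =>
    Formula.all s.down 0 Formula.falsum) fun s t hst => ULift.down_injective (h hst)
  simpa using this

/-- Nodes are labelled by formulas and branch only over the finitely many free variables, so there
are at most |L| trees. -/
theorem mk_skolemTree_le : #L.SkolemTree ≤ #(L.Formula ℕ) := by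
  have h : ∀ p : L.Formula ℕ × ℕ, Finite (p.1.freeVars : Set (L.Sorts × ℕ)) :=
    fun p => p.1.finite_freeVars.to_subtype
  refine (WType.cardinalMk_le_max_aleph0_of_finite' (α := L.Formula ℕ × ℕ)).trans ?_
  have := aleph0_le_mk_formula (L := L)
  simp only [mk_prod, mk_nat, lift_aleph0, lift_mul, lift_id']
  rw [show lift.{u, max u v} #(L.Formula ℕ) = #(L.Formula ℕ) from lift_id'.{u, v} _,
    mul_aleph0_eq this]
  simp [this]

/-- A structure has a small elementary submodel. -/
theorem exists_isModelEnum {κ : Cardinal.{max u v w}}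
    (hκ : (2 : Cardinal.{max u v w}) ^ Cardinal.lift.{w} #(L.Formula ℕ) < κ)
    (M : L.Sorts → Type w) [L.Structure M] [∀ s, Nonempty (M s)] :
    ∃ (W : Type (max u v w)) (_ : Infinite W) (n : Assign W M), IsModelEnum n ∧
      lift.{max v w} #L.Sorts * #W < κ := by
  have hinf := aleph0_le_mk_formula (L := L)
  -- The factor ℕ only serves to make the set of names infinite.
  refine ⟨ULift.{w} L.SkolemTree × ℕ, ?_, fun s i => i.1.down.value M s, ?_, ?_⟩
  · have : Nonempty (ULift.{w} L.SkolemTree) :=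
      ⟨⟨WType.mk (Formula.falsum, 0) fun p => (Set.notMem_empty _ p.2).elim⟩⟩
    infer_instance
  · intro φ e s k h
    obtain ⟨i, hi⟩ := isModelEnum_skolem M φ (fun t j => (e t j).1) s k h
    exact ⟨(i, 0), hi⟩
  -- The sorts and the trees number at most |L|, and |L| < 2^|L| < κ.
  · refine lt_of_le_of_lt ?_ ((cantor _).trans hκ)
    have h1 : lift.{max v w} #L.Sorts ≤ lift.{w} #(L.Formula ℕ) := by
      have := lift_le.{w}.2 (mk_sorts_le (L := L))
      simpa using this
    have h2 : #(ULift.{w} L.SkolemTree × ℕ) ≤ lift.{w} #(L.Formula ℕ) := by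
      have h3 : lift.{w} #L.SkolemTree ≤ lift.{w} #(L.Formula ℕ) :=
        lift_le.2 mk_skolemTree_le
      have h4 : ℵ₀ ≤ lift.{w} #(L.Formula ℕ) := by simpa using hinf
      simp only [mk_prod, mk_uLift, lift_lift, mk_nat, lift_aleph0]
      refine (mul_le_mul' ?_ h4).trans (mul_eq_self h4).le
      simpa using h3
    have h4 : ℵ₀ ≤ lift.{w} #(L.Formula ℕ) := by simpa using hinf
    exact (mul_le_mul' h1 h2).trans (mul_eq_self h4).le

end SkolemTerms

/-! ### The elementary submodel carried by an enumeration. -/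

section Submodel

variable {M : L.Sorts → Type w} [L.Structure M] {W : Type x} {n : Assign W M}

theorem IsModelEnum.funMap_mem [Nonempty W] (hn : IsModelEnum n) {k : ℕ} {a : Fin k → L.Sorts} {s : L.Sorts}
    (f : L.Functions k a s) (i : Fin k → W) :
    ∃ j, n s j = Structure.funMap f fun l => n (a l) (i l) := by
  classical
  -- The criterion is applied to the formula x₀ = f(x₁, …, x_k): variable 0 is kept for the value,
  -- whence the shift by one.
  let e : L.Sorts → ℕ → W := fun _ j => if h : ∃ l : Fin k, l.1 + 1 = j then i h.choose else
    Classical.arbitrary W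
  have he : ∀ t (l : Fin k), e t (l.1 + 1) = i l := by
    intro t l
    have h : ∃ l' : Fin k, l'.1 + 1 = l.1 + 1 := ⟨l, rfl⟩
    have h1 : h.choose = l := Fin.ext (by have := h.choose_spec; omega)
    simp only [e, dif_pos h, h1]
  have key : ∀ m : M s, (Formula.equal (.var 0) (.func f fun l => .var (l.1 + 1)) :
      L.Formula ℕ).Realize ((n.pull e).update s 0 m) ↔
      m = Structure.funMap f fun l => n (a l) (i l) := by
    intro m
    simp only [Formula.Realize, Term.eval]
    have h1 : (n.pull e).update s 0 m s 0 = m := by simp [Assign.update]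
    have h2 : ∀ l : Fin k, (n.pull e).update s 0 m (a l) (l.1 + 1) = n (a l) (i l) := by
      intro l
      rw [← he (a l) l]
      by_cases hs : a l = s
      · generalize a l = t at hs
        subst hs
        simp [Assign.update, Assign.pull]
      · simp [Assign.update, Assign.pull, hs]
    rw [h1]
    simp only [h2]
  obtain ⟨j, hj⟩ := hn _ e s 0 ⟨_, (key _).2 rfl⟩
  exact ⟨j, (key _).1 hj⟩

/-- The substructure on the range of an enumeration of a model. -/
@[reducible] noncomputable def IsModelEnum.structure [Nonempty W] (hn : IsModelEnum n) :
    L.Structure fun s => Set.range (n s) where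
  funMap := fun {_ a _} f x => ⟨Structure.funMap f fun l => (x l).1, by
    obtain ⟨j, hj⟩ := hn.funMap_mem f fun l => (x l).2.choose
    refine ⟨j, hj.trans ?_⟩
    congr 1
    funext l
    exact (x l).2.choose_spec⟩
  RelMap := fun R x => Structure.RelMap R fun l => (x l).1

theorem IsModelEnum.isElementary [Nonempty W] (hn : IsModelEnum n) :
    @IsElementary L (fun s => Set.range (n s)) M hn.structure _ fun _ m => m.1 := by
  let _ := hn.structure
  have ht : ∀ {s} (t : L.Term ℕ s) (a : Assign ℕ fun s => Set.range (n s)),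
      t.eval (a.map fun _ m => m.1) = (t.eval a).1 := by
    intro s t a
    induction t with
    | var k => rfl
    | func f ts ih =>
      simp only [Term.eval, ih]
      rfl
  intro φ
  induction φ with
  | falsum => exact fun a => Iff.rfl
  | equal t t' =>
    intro a
    simp only [Formula.Realize, ht]
    exact Subtype.ext_iff.symm
  | rel R ts =>
    intro a
    simp only [Formula.Realize, ht]
    exact Iff.rfl
  | imp φ ψ ih ih' => intro a; simp only [Formula.Realize, ih, ih']
  | all s k φ ih =>
    intro a
    simp only [Formula.Realize]
    refine ⟨fun h m => ?_, fun h => ?_⟩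
    · rw [← ih, Assign.map_update]
      exact h m.1
    · by_contra hc
      push Not at hc
      have ha : a.map (fun _ m => m.1) = n.pull fun t j => (a t j).2.choose :=
        funext fun t => funext fun j => (a t j).2.choose_spec.symm
      rw [ha] at hc
      obtain ⟨i, hi⟩ := hn φ.neg _ s k hc
      refine hi ?_
      rw [← ha]
      have := (ih _).2 (h ⟨n s i, i, rfl⟩)
      rwa [Assign.map_update] at this

theorem IsModelEnum.mem_fixesModel [Nonempty W] (hn : IsModelEnum n) {σ : Aut M} (h : n.map σ.toFun = n) :
    σ ∈ fixesModel M := by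
  refine ⟨fun s => Set.range (n s), hn.structure, fun _ m => m.1, fun s => ?_, hn.isElementary,
    fun s m => ?_⟩
  · exact ⟨⟨_, Classical.arbitrary W, rfl⟩⟩
  · obtain ⟨_, i, rfl⟩ := m
    exact congrFun (congrFun h s) i

theorem IsModelEnum.map (hn : IsModelEnum n) (σ : Aut M) : IsModelEnum (n.map σ.toFun) := by
  intro φ e s k ⟨m, hm⟩
  have key : ∀ m : M s, φ.Realize (((n.map σ.toFun).pull e).update s k (σ.toFun s m)) ↔
      φ.Realize ((n.pull e).update s k m) := by
    intro m
    rw [← σ.realize_map φ ((n.pull e).update s k m), Assign.map_update, Assign.pull_map]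
  obtain ⟨i, hi⟩ := hn φ e s k ⟨σ⁻¹.toFun s m, by rwa [← key, Aut.toFun_toFun_inv]⟩
  exact ⟨i, (key _).2 hi⟩

end Submodel

/-! ### Elementary submodels and Lascar neighbours. -/

section Elementary

variable {T : L.Theory} {M N : L.Sorts → Type w} [L.Structure M] [L.Structure N]
  {f : ∀ s, N s → M s}

theorem IsElementary.isModel (hf : IsElementary f) (hN : ∀ s, Nonempty (N s))
    (hM : T.IsModel M) : T.IsModel N :=
  ⟨hN, fun σ hσ _ => (hf _ _).1 (hM.isTrue σ hσ _)⟩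

/-- Finitely many formulas over an elementary submodel cover all tuples by sets of
Lascar neighbours. -/
theorem IsElementary.exists_cover (hf : IsElementary f) (hN : ∀ s, Nonempty (N s))
    (hM : T.IsModel M) {θ : L.Formula (ℕ ⊕ ℕ)} (hθ : θ ∈ lascarNeighbours.{u, v, w} T) :
    ∃ (m : ℕ) (χ : L.Formula (ℕ ⊕ ℕ)) (g : Fin m → Assign ℕ N),
      (∀ a : Assign ℕ M, ∃ i, χ.Realize (a.sum ((g i).map f))) ∧
      ∀ i (a a' : Assign ℕ M), χ.Realize (a.sum ((g i).map f)) →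
        χ.Realize (a'.sum ((g i).map f)) → θ.Realize (a.sum a') := by
  have := hM.nonempty
  obtain ⟨δ, E, ⟨m, hE⟩, hθ⟩ := hθ
  obtain ⟨⟨d, hd⟩, h2⟩ := hE N (hf.isModel hN hM)
  obtain ⟨-, c, hc⟩ := h2 d hd
  have hd' := (hf.realize_map _ _).2 hd
  obtain ⟨heq, -⟩ := (hE M hM).2 _ hd'
  -- That the representatives found in `N` meet every class is a first-order statement about them
  -- and `d`, so it persists in `M`.
  have hrep : ∀ a : Assign ℕ M, ∃ i, E.Realize ((a.sum ((c i).map f)).sum (d.map f)) := by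
    let ψ : L.Formula (ℕ ⊕ ((Fin m × ℕ) ⊕ ℕ)) := Formula.bigOr Finset.univ fun i : Fin m =>
      E.subst fun _ => Sum.elim (Sum.elim Sum.inl fun k => Sum.inr (Sum.inl (i, k)))
        fun k => Sum.inr (Sum.inr k)
    have hψ : ∀ {M : L.Sorts → Type w} [L.Structure M] (a : Assign ℕ M) (c : Fin m → Assign ℕ M)
        (d : Assign ℕ M), ψ.Realize (a.sum (Assign.sum (fun s p => c p.1 s p.2) d)) ↔
          ∃ i, E.Realize ((a.sum (c i)).sum d) := by
      intro M _ a c d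
      simp only [ψ, Formula.realize_bigOr, Formula.realize_subst, Finset.mem_univ, true_and]
      refine exists_congr fun i => ?_
      have : (a.sum (Assign.sum (fun s p => c p.1 s p.2) d : Assign ((Fin m × ℕ) ⊕ ℕ) M)).pull
          (fun _ => Sum.elim (Sum.elim Sum.inl fun k => Sum.inr (Sum.inl (i, k)))
            fun k => Sum.inr (Sum.inr k)) = (a.sum (c i)).sum d := by
        funext s j
        rcases j with (j | j) | j <;> rfl
      rw [this]
    have h3 : ψ.allL.Realize (Assign.sum (fun s p => c p.1 s p.2) d : Assign _ N) := by
      rw [Formula.realize_allL]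
      exact fun a => (hψ a c d).2 (hc a)
    rw [← hf.realize_map, Assign.map_sum, Formula.realize_allL] at h3
    exact fun a => (hψ a (fun i => (c i).map f) (d.map f)).1 (h3 a)
  let χ : L.Formula (ℕ ⊕ ℕ) := E.subst fun _ => Sum.elim
    (Sum.elim Sum.inl fun k => Sum.inr (pairName (.inl k))) fun k => Sum.inr (pairName (.inr k))
  have hχ : ∀ (a : Assign ℕ M) i, χ.Realize (a.sum ((Assign.merge (c i) d).map f)) ↔
      E.Realize ((a.sum ((c i).map f)).sum (d.map f)) := by
    intro a i
    simp only [χ, Formula.realize_subst]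
    have : (a.sum ((Assign.merge (c i) d).map f)).pull (fun _ => Sum.elim
        (Sum.elim Sum.inl fun k => Sum.inr (pairName (.inl k)))
          fun k => Sum.inr (pairName (.inr k))) = (a.sum ((c i).map f)).sum (d.map f) := by
      funext s j
      rcases j with (j | j) | j
      · rfl
      · exact congrFun (congrFun (congrArg (Assign.map f) (Assign.merge_inl (c i) d)) s) j
      · exact congrFun (congrFun (congrArg (Assign.map f) (Assign.merge_inr (c i) d)) s) j
    rw [this]
  refine ⟨m, χ, fun i => Assign.merge (c i) d, fun a => ?_, fun i a a' h h' => ?_⟩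
  · simp only [hχ]
    exact hrep a
  · rw [hχ] at h h'
    exact (hθ M hM a a').2 ⟨_, hd', heq.trans h (heq.symm h')⟩

/-- Types that agree over an elementary submodel are Lascar neighbours. -/
theorem IsElementary.lascarDistLEOne (hf : IsElementary f) (hN : ∀ s, Nonempty (N s))
    (hM : T.IsModel M) {p p' : TypeSpace M}
    (h : ∀ φ (g : Assign ℕ N), (φ, g.map f) ∈ p.formulas → (φ, g.map f) ∈ p'.formulas) :
    LascarDistLEOne.{u, v, w} T p p' := by
  classical
  refine TypeSpace.lascarDistLEOne_of_finite fun F F' hF hF' Θ hΘ => ?_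
  -- For each `θ` the type `p` lies in one class of a finite cover defined over `N`. As `p'` agrees
  -- with `p` there, it lies in the same class, so approximate realizations of the two types satisfy
  -- `θ`.
  have h1 : ∀ θ : Θ, ∃ (χ : L.Formula (ℕ ⊕ ℕ)) (g : Assign ℕ N), (χ, g.map f) ∈ p.formulas ∧
      ∀ a a' : Assign ℕ M, χ.Realize (a.sum (g.map f)) → χ.Realize (a'.sum (g.map f)) →
        θ.1.Realize (a.sum a') := by
    intro θ
    obtain ⟨m, χ, g, hg, hg'⟩ := hf.exists_cover hN hM (hΘ θ.2)
    obtain ⟨a, ha⟩ := p.exists_realize_iff (Set.range fun i : Fin m => (χ, (g i).map f))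
      (Set.finite_range _)
    obtain ⟨i, hi⟩ := hg a
    exact ⟨χ, g i, (ha _ ⟨i, rfl⟩).1 hi, hg' i⟩
  choose χ g hχ hχ' using h1
  obtain ⟨a, ha⟩ := p.finSat (F ∪ Finset.univ.image fun θ => (χ θ, (g θ).map f)) (by
    intro φ hφ
    simp only [Finset.coe_union, Finset.coe_image, Finset.coe_univ, Set.image_univ,
      Set.mem_union, Set.mem_range] at hφ
    rcases hφ with hφ | ⟨θ, rfl⟩
    exacts [hF hφ, hχ θ])
  obtain ⟨a', ha'⟩ := p'.finSat (F' ∪ Finset.univ.image fun θ => (χ θ, (g θ).map f)) (by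
    intro φ hφ
    simp only [Finset.coe_union, Finset.coe_image, Finset.coe_univ, Set.image_univ,
      Set.mem_union, Set.mem_range] at hφ
    rcases hφ with hφ | ⟨θ, rfl⟩
    exacts [hF' hφ, h _ _ (hχ θ)])
  refine ⟨a, a', fun φ hφ => ha φ (Finset.mem_union_left _ hφ),
    fun φ hφ => ha' φ (Finset.mem_union_left _ hφ), fun θ hθ => hχ' ⟨θ, hθ⟩ a a' ?_ ?_⟩
  · exact ha (χ ⟨θ, hθ⟩, (g ⟨θ, hθ⟩).map f)
      (Finset.mem_union_right _ (Finset.mem_image_of_mem _ (Finset.mem_univ _)))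
  · exact ha' (χ ⟨θ, hθ⟩, (g ⟨θ, hθ⟩).map f)
      (Finset.mem_union_right _ (Finset.mem_image_of_mem _ (Finset.mem_univ _)))

theorem lascarDistLEOne_act (hM : T.IsModel M) {σ : Aut M} (hσ : σ ∈ fixesModel M)
    (p : TypeSpace M) : LascarDistLEOne.{u, v, w} T p (TypeSpace.act σ p) := by
  obtain ⟨N, _, f, hN, hf, hfix⟩ := hσ
  refine hf.lascarDistLEOne hN hM fun φ g hg => ?_
  have : (g.map f).map σ.toFun = g.map f := funext fun s => funext fun k => hfix s (g s k)
  rw [← this, TypeSpace.mem_act_map]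
  exact hg

end Elementary

/-- Types that agree over an enumerated model are Lascar neighbours. -/
theorem IsModelEnum.lascarDistLEOne {T : L.Theory} {M : L.Sorts → Type w} [L.Structure M]
    {W : Type x} [Nonempty W] {n : Assign W M} (hn : IsModelEnum n) (hM : T.IsModel M)
    {p p' : TypeSpace M}
    (h : ∀ φ (e : L.Sorts → ℕ → W), (φ, n.pull e) ∈ p.formulas → (φ, n.pull e) ∈ p'.formulas) :
    LascarDistLEOne.{u, v, w} T p p' := by
  let _ := hn.structure
  refine hn.isElementary.lascarDistLEOne (fun s => ⟨⟨_, Classical.arbitrary W, rfl⟩⟩) hM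
    fun φ g hg => ?_
  have : g.map (fun _ m => m.1) = n.pull fun t j => (g t j).2.choose :=
    funext fun t => funext fun j => (g t j).2.choose_spec.symm
  rw [this] at hg ⊢
  exact h _ _ hg

end MSLanguage

/-! ## Chains of Lascar neighbours -/

namespace MSLanguage

variable {L : MSLanguage.{u, v}} {M : L.Sorts → Type w} [L.Structure M]

/-- Some `d` satisfying `δ` exists over which `a` and `a'` satisfy the same formulas of `Ψ`. -/
def Near (δ : L.Formula ℕ) (Ψ : Finset (L.Formula (ℕ ⊕ ℕ))) (a a' : Assign ℕ M) : Prop :=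
  ∃ d : Assign ℕ M, δ.Realize d ∧ ∀ ψ ∈ Ψ, (ψ.Realize (a.sum d) ↔ ψ.Realize (a'.sum d))

/-- There is a chain of length `k + 1` for `Near` from `a` to `a'`. -/
def NearChain (δ : L.Formula ℕ) (Ψ : Finset (L.Formula (ℕ ⊕ ℕ))) :
    ℕ → Assign ℕ M → Assign ℕ M → Prop
  | 0 => Near δ Ψ
  | k + 1 => fun a a' => ∃ z, Near δ Ψ a z ∧ NearChain δ Ψ k z a'

section Near

variable {δ : L.Formula ℕ} {Ψ : Finset (L.Formula (ℕ ⊕ ℕ))}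

theorem Near.refl (hδ : ∃ d : Assign ℕ M, δ.Realize d) (a : Assign ℕ M) : Near δ Ψ a a :=
  ⟨hδ.choose, hδ.choose_spec, fun _ _ => Iff.rfl⟩

theorem Near.symm {a a' : Assign ℕ M} (h : Near δ Ψ a a') : Near δ Ψ a' a := by
  obtain ⟨d, hd, h⟩ := h
  exact ⟨d, hd, fun ψ hψ => (h ψ hψ).symm⟩

theorem Near.map {a a' : Assign ℕ M} (h : Near δ Ψ a a') (σ : Aut M) :
    Near δ Ψ (a.map σ.toFun) (a'.map σ.toFun) := by
  obtain ⟨d, hd, h⟩ := h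
  refine ⟨d.map σ.toFun, (σ.realize_map _ _).2 hd, fun ψ hψ => ?_⟩
  rw [← Assign.map_sum, ← Assign.map_sum, σ.realize_map, σ.realize_map]
  exact h ψ hψ

/-- The index `k` stands for `k + 1` steps, so composition adds an extra one. -/
theorem NearChain.trans {j k : ℕ} {a b c : Assign ℕ M} (h : NearChain δ Ψ j a b)
    (h' : NearChain δ Ψ k b c) : NearChain δ Ψ (j + k + 1) a c := by
  induction j generalizing a with
  | zero => rw [Nat.zero_add]; exact ⟨b, h, h'⟩
  | succ j ih =>
    obtain ⟨z, h1, h2⟩ := h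
    rw [show j + 1 + k + 1 = (j + k + 1) + 1 by omega]
    exact ⟨z, h1, ih h2⟩

theorem NearChain.symm {k : ℕ} {a b : Assign ℕ M} (h : NearChain δ Ψ k a b) :
    NearChain δ Ψ k b a := by
  induction k generalizing a with
  | zero => exact Near.symm h
  | succ k ih =>
    obtain ⟨z, h1, h2⟩ := h
    exact NearChain.trans (k := 0) (ih h2) h1.symm

theorem NearChain.map {k : ℕ} {a b : Assign ℕ M} (h : NearChain δ Ψ k a b) (σ : Aut M) :
    NearChain δ Ψ k (a.map σ.toFun) (b.map σ.toFun) := by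
  induction k generalizing a with
  | zero => exact Near.map h σ
  | succ k ih =>
    obtain ⟨z, h1, h2⟩ := h
    exact ⟨_, h1.map σ, ih h2⟩

/-- The chain is continued by the constant `b`, so the step condition holds for all indices and no
bound on `i` has to be carried. -/
theorem NearChain.exists_seq {k : ℕ} {a b : Assign ℕ M} (h : NearChain δ Ψ k a b) :
    ∃ z d : ℕ → Assign ℕ M, z 0 = a ∧ z (k + 1) = b ∧ ∀ i, δ.Realize (d i) ∧
      ∀ ψ ∈ Ψ, (ψ.Realize ((z i).sum (d i)) ↔ ψ.Realize ((z (i + 1)).sum (d i))) := by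
  induction k generalizing a with
  | zero =>
    obtain ⟨d, hd, h⟩ := h
    refine ⟨fun i => i.casesOn a fun _ => b, fun _ => d, rfl, rfl, fun i => ⟨hd, ?_⟩⟩
    cases i with
    | zero => exact h
    | succ i => exact fun _ _ => Iff.rfl
  | succ k ih =>
    obtain ⟨c, ⟨d₀, hd₀, h₀⟩, h2⟩ := h
    obtain ⟨z, d, h3, h4, h5⟩ := ih h2
    refine ⟨fun i => i.casesOn a z, fun i => i.casesOn d₀ d, rfl, h4, fun i => ?_⟩
    cases i with
    | zero => exact ⟨hd₀, fun ψ hψ => (h₀ ψ hψ).trans (by subst h3; rfl)⟩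
    | succ i => exact h5 i

/-- Used to return from one tuple coding countably many tuples to a single one of them. -/
theorem NearChain.pull [DecidableEq (L.Formula (ℕ ⊕ ℕ))] {e : ℕ → ℕ} {k : ℕ} {a b : Assign ℕ M}
    (h : NearChain δ (Ψ.image fun ψ => ψ.subst fun _ => Sum.map e id) k a b) :
    NearChain δ Ψ k (a.pull fun _ => e) (b.pull fun _ => e) := by
  have h0 : ∀ {a b : Assign ℕ M}, Near δ (Ψ.image fun ψ => ψ.subst fun _ => Sum.map e id) a b →
      Near δ Ψ (a.pull fun _ => e) (b.pull fun _ => e) := by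
    rintro a b ⟨d, hd, h⟩
    refine ⟨d, hd, fun ψ hψ => ?_⟩
    have h1 := h _ (Finset.mem_image_of_mem _ hψ)
    rw [Formula.realize_subst, Formula.realize_subst] at h1
    have h2 : ∀ a : Assign ℕ M, (a.sum d).pull (fun _ => Sum.map e id) =
        (a.pull fun _ => e).sum d := fun a => by funext s i; cases i <;> rfl
    rwa [h2, h2] at h1
  induction k generalizing a with
  | zero => exact h0 h
  | succ k ih =>
    obtain ⟨z, h1, h2⟩ := h
    exact ⟨_, h0 h1, ih h2⟩

variable (δ Ψ) in
/-- The formula expressing `Near`. -/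
noncomputable def nearFormula : L.Formula (ℕ ⊕ ℕ) :=
  Formula.exL (V := ℕ) ((δ.subst fun _ => Sum.inl).and (Formula.bigAnd Ψ fun ψ =>
    (ψ.subst fun _ => Sum.elim (Sum.inr ∘ Sum.inl) Sum.inl).iff
      (ψ.subst fun _ => Sum.elim (Sum.inr ∘ Sum.inr) Sum.inl)))

theorem realize_nearFormula [∀ s, Nonempty (M s)] {a a' : Assign ℕ M} :
    (nearFormula δ Ψ).Realize (a.sum a') ↔ Near δ Ψ a a' := by
  rw [nearFormula, Formula.realize_exL]
  refine exists_congr fun d => ?_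
  simp only [Formula.realize_and, Formula.realize_bigAnd, Formula.realize_iff,
    Formula.realize_subst]
  have h1 : (d.sum (a.sum a')).pull (fun _ => Sum.inl) = d := rfl
  have h2 : (d.sum (a.sum a')).pull (fun _ => Sum.elim (Sum.inr ∘ Sum.inl) Sum.inl) = a.sum d := by
    funext s i; cases i <;> rfl
  have h3 : (d.sum (a.sum a')).pull (fun _ => Sum.elim (Sum.inr ∘ Sum.inr) Sum.inl) =
      a'.sum d := by
    funext s i; cases i <;> rfl
  rw [h1, h2, h3]

variable (δ Ψ) in
/-- The formula expressing `NearChain`. -/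
noncomputable def chainFormula : ℕ → L.Formula (ℕ ⊕ ℕ)
  | 0 => nearFormula δ Ψ
  | k + 1 => Formula.exL (V := ℕ)
      (((nearFormula δ Ψ).subst fun _ => Sum.elim (Sum.inr ∘ Sum.inl) Sum.inl).and
        ((chainFormula k).subst fun _ => Sum.elim Sum.inl (Sum.inr ∘ Sum.inr)))

theorem realize_chainFormula [∀ s, Nonempty (M s)] {k : ℕ} {a a' : Assign ℕ M} :
    (chainFormula δ Ψ k).Realize (a.sum a') ↔ NearChain δ Ψ k a a' := by
  induction k generalizing a with
  | zero => exact realize_nearFormula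
  | succ k ih =>
    rw [chainFormula, Formula.realize_exL]
    refine exists_congr fun z => ?_
    have h2 : (z.sum (a.sum a')).pull (fun _ => Sum.elim (Sum.inr ∘ Sum.inl) Sum.inl) =
        a.sum z := by
      funext s i; cases i <;> rfl
    have h3 : (z.sum (a.sum a')).pull (fun _ => Sum.elim Sum.inl (Sum.inr ∘ Sum.inr)) =
        z.sum a' := by
      funext s i; cases i <;> rfl
    rw [Formula.realize_and, Formula.realize_subst, Formula.realize_subst, h2, h3, ih,
      realize_nearFormula]

/-- For fixed `d`, satisfying the same formulas of `Ψ` over `d` is an equivalence relation with at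
most 2^|Ψ| classes. By completeness `δ` is satisfiable in all models. -/
theorem nearFormula_mem {T : L.Theory} (hT : Theory.IsComplete.{u, v, w} T) (hM : T.IsModel M)
    (hδ : ∃ d : Assign ℕ M, δ.Realize d) :
    nearFormula δ Ψ ∈ lascarNeighbours.{u, v, w} T := by
  classical
  let E : L.Formula ((ℕ ⊕ ℕ) ⊕ ℕ) := Formula.bigAnd Ψ fun ψ =>
    (ψ.subst fun _ => Sum.elim (Sum.inl ∘ Sum.inl) Sum.inr).iff
      (ψ.subst fun _ => Sum.elim (Sum.inl ∘ Sum.inr) Sum.inr)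
  have hE : ∀ {M : L.Sorts → Type w} [L.Structure M] (a a' d : Assign ℕ M),
      E.Realize ((a.sum a').sum d) ↔
        ∀ ψ ∈ Ψ, (ψ.Realize (a.sum d) ↔ ψ.Realize (a'.sum d)) := by
    intro M _ a a' d
    have h2 : ((a.sum a').sum d).pull (fun _ => Sum.elim (Sum.inl ∘ Sum.inl) Sum.inr) =
        a.sum d := by
      funext s i; cases i <;> rfl
    have h3 : ((a.sum a').sum d).pull (fun _ => Sum.elim (Sum.inl ∘ Sum.inr) Sum.inr) =
        a'.sum d := by
      funext s i; cases i <;> rfl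
    simp only [E, Formula.realize_bigAnd, Formula.realize_iff, Formula.realize_subst, h2, h3]
  refine ⟨δ, E, ⟨Nat.card (Ψ → Prop), fun N _ hN => ⟨hT.exists_realize hM hN δ hδ, fun d _ => ?_⟩⟩,
    fun N _ hN a a' => ?_⟩
  · have := hN.nonempty
    simp only [hE]
    refine ⟨⟨fun _ _ _ => Iff.rfl, fun h ψ hψ => (h ψ hψ).symm,
      fun h h' ψ hψ => (h ψ hψ).trans (h' ψ hψ)⟩, ?_⟩
    let F : Assign ℕ N → Ψ → Prop := fun a ψ => ψ.1.Realize (a.sum d)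
    -- Representatives are indexed by truth patterns on `Ψ`; for a pattern that is not realized the
    -- value is irrelevant.
    refine ⟨fun i => Function.invFun F ((Finite.equivFin (Ψ → Prop)).symm i), fun a =>
      ⟨Finite.equivFin (Ψ → Prop) (F a), fun ψ hψ => ?_⟩⟩
    beta_reduce
    rw [Equiv.symm_apply_apply]
    exact Eq.to_iff (congrFun (Function.invFun_eq (f := F) ⟨a, rfl⟩) ⟨ψ, hψ⟩).symm
  · have := hN.nonempty
    simp only [hE]
    exact realize_nearFormula

end Near

/-! ### Strong Lascar automorphisms -/

theorem mk_prod_nat_eq (W : Type x) [Infinite W] : #(W × ℕ) = #W := by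
  simp only [mk_prod, mk_nat, lift_aleph0, lift_uzero]
  exact mul_aleph0_eq (aleph0_le_mk W)

theorem mk_sum_self_eq (W : Type x) [Infinite W] : #(W ⊕ W) = #W := by
  simp only [mk_sum, lift_id]
  exact add_eq_self (aleph0_le_mk W)

theorem Assign.map_mul (σ τ : Aut M) {V : Type x} (a : Assign V M) :
    a.map (σ * τ).toFun = (a.map τ.toFun).map σ.toFun := rfl

/-- The data of a saturated homogeneous structure with a small enumerated elementary submodel. -/
structure SmallModel (κ : Cardinal.{max u v w}) (M : L.Sorts → Type w) [L.Structure M]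
    (W : Type (max u v w)) : Prop where
  nonempty : ∀ s, Nonempty (M s)
  sat : IsSaturated κ M
  hom : IsStronglyHomogeneous κ M
  infinite : Infinite W
  small : lift.{max v w} #L.Sorts * #W < κ

namespace SmallModel

variable {κ : Cardinal.{max u v w}} {W : Type (max u v w)}

theorem exists_realize (S : SmallModel κ M W) {V V' : Type (max u v w)} (hV : #V ≤ #W)
    (hV' : #V' ≤ #W) (b : Assign V' M) {I : Type x} (C : I → L.Formula (V ⊕ V'))
    (h : ∀ F : Finset I, ∃ a : Assign V M, ∀ i ∈ F, (C i).Realize (a.sum b)) :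
    ∃ a : Assign V M, ∀ i, (C i).Realize (a.sum b) := by
  classical
  obtain ⟨a, ha⟩ := S.sat V V' (lt_of_le_of_lt (mul_le_mul_right hV _) S.small)
    (lt_of_le_of_lt (mul_le_mul_right hV' _) S.small) b (Set.range C) (by
      intro F hF
      choose g hg using fun φ : F => hF φ.2
      obtain ⟨a, ha⟩ := h (Finset.univ.image g)
      refine ⟨a, fun φ hφ => ?_⟩
      have := ha (g ⟨φ, hφ⟩) (Finset.mem_image_of_mem _ (Finset.mem_univ _))
      rwa [hg ⟨φ, hφ⟩] at this)
  exact ⟨a, fun i => ha _ ⟨i, rfl⟩⟩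

theorem exists_aut (S : SmallModel κ M W) {V : Type (max u v w)} [Infinite V] (hV : #V ≤ #W)
    (a b : Assign V M) (h : ∀ φ : L.Formula V, φ.Realize a → φ.Realize b) :
    ∃ σ : Aut M, a.map σ.toFun = b :=
  S.hom V (lt_of_le_of_lt (mul_le_mul_right hV _) S.small) a b fun φ =>
    ⟨h φ, fun hb => by_contra fun hc => h φ.neg hc hb⟩

/-- A criterion for being a strong Lascar automorphism. -/
theorem mem_AutL_of_nearChain (S : SmallModel κ M W) {n : Assign W M} (hn : IsModelEnum n)
    {σ : Aut M} (k : ℕ)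
    (h : ∀ (χ : L.Formula ℕ) (e : ℕ → W), χ.Realize (n.pull fun _ => e) →
      ∀ Ψ : Finset (L.Formula (ℕ ⊕ ℕ)), ∃ m : Assign ℕ M, χ.Realize m ∧
        NearChain χ Ψ k m (m.map σ.toFun)) : σ ∈ AutL M := by
  classical
  have := S.infinite
  -- The unknowns are zᵢ and yᵢ. The conditions say z₀ ≡ n, yᵢ ≡ n, (z₀, n) ≡ (z_{k+1}, σn) and (zᵢ,
  -- yᵢ) ≡ (zᵢ₊₁, yᵢ). The image σz₀ is not available as a parameter, so z_{k+1} is only asked to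
  -- have the right type over σn.
  let C : {χ : L.Formula W // χ.Realize n} × Option ℕ ⊕ L.Formula (W ⊕ W) × Option ℕ →
      L.Formula (((W × ℕ) ⊕ (W × ℕ)) ⊕ (W ⊕ W))
    | .inl (χ, none) => χ.1.subst fun _ j => .inl (.inl (j, 0))
    | .inl (χ, some i) => χ.1.subst fun _ j => .inl (.inr (j, i))
    | .inr (ψ, none) => (ψ.subst fun _ => Sum.elim (fun j => .inl (.inl (j, 0)))
        fun j => .inr (.inl j)).iff (ψ.subst fun _ => Sum.elim (fun j => .inl (.inl (j, k + 1)))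
          fun j => .inr (.inr j))
    | .inr (ψ, some i) => (ψ.subst fun _ => Sum.elim (fun j => .inl (.inl (j, i)))
        fun j => .inl (.inr (j, i))).iff (ψ.subst fun _ =>
          Sum.elim (fun j => .inl (.inl (j, i + 1))) fun j => .inl (.inr (j, i)))
  have hV : #((W × ℕ) ⊕ (W × ℕ)) ≤ #W := by
    rw [mk_sum_self_eq, mk_prod_nat_eq]
  have hpull : ∀ {A B : Type (max u v w)} (f : W → A) (g : W → A) (c : Assign A M),
      c.pull (fun _ => Sum.elim f g) = (c.pull fun _ => f).sum (c.pull fun _ => g) := by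
    intro A B f g c
    funext s i; cases i <;> rfl
  obtain ⟨a, ha⟩ := S.exists_realize hV (mk_sum_self_eq W).le (n.sum (n.map σ.toFun)) C (by
    intro F
    -- The finitely many conditions on single tuples are combined into one formula true of `n`; it
    -- serves both as `χ` for `m` and as the domain of the parameters `d` of the chain.
    let χ₀ : L.Formula W := Formula.bigAnd F fun i =>
      Sum.elim (fun χ => χ.1.1) (fun _ => Formula.truth) i
    have hχ₀ : χ₀.Realize n := by
      rw [Formula.realize_bigAnd]
      rintro (χ | ψ) -
      · exact χ.1.2
      · exact fun h => h
    obtain ⟨e, e', he⟩ := χ₀.exists_nat_coding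
    obtain ⟨m, hm, hc⟩ := h _ e ((he M n).2 hχ₀) (F.image fun i =>
      Sum.elim (fun _ => Formula.truth) (fun ψ => ψ.1.subst fun _ => Sum.map e' e') i)
    obtain ⟨z, d, h0, h1, h2⟩ := hc.exists_seq
    have hχ : ∀ c : Assign ℕ M, (χ₀.subst fun _ => e').Realize c → ∀ χ j, Sum.inl (χ, j) ∈ F →
        χ.1.Realize (c.pull fun _ => e') := by
      intro c hc χ j hj
      rw [Formula.realize_subst, Formula.realize_bigAnd] at hc
      exact hc _ hj
    have hψ : ∀ ψ j, Sum.inr (ψ, j) ∈ F → ∀ i,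
        (ψ.Realize (((z i).pull fun _ => e').sum ((d i).pull fun _ => e')) ↔
          ψ.Realize (((z (i + 1)).pull fun _ => e').sum ((d i).pull fun _ => e'))) := by
      intro ψ j hj i
      have h3 := (h2 i).2 _ (Finset.mem_image_of_mem _ hj)
      simp only [Sum.elim_inr, Formula.realize_subst] at h3
      have h4 : ∀ c c' : Assign ℕ M, (c.sum c').pull (fun _ => Sum.map e' e') =
          (c.pull fun _ => e').sum (c'.pull fun _ => e') := by
        intro c c'; funext s i; cases i <;> rfl
      rwa [h4, h4] at h3
    refine ⟨fun s => Sum.elim (fun j => z j.2 s (e' j.1)) (fun j => d j.2 s (e' j.1)), ?_⟩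
    rintro (⟨χ, _ | i⟩ | ⟨ψ, _ | i⟩) hi
    · refine (Formula.realize_subst _ _ _).2 ?_
      have := hχ m hm χ _ hi
      rw [← h0] at this
      exact this
    · refine (Formula.realize_subst _ _ _).2 ?_
      exact hχ (d i) (h2 i).1 χ _ hi
    · refine (Formula.realize_iff _ _ _).2 ?_
      rw [Formula.realize_subst, Formula.realize_subst, hpull (B := W), hpull (B := W)]
      have h5 : ψ.Realize (((z 0).pull fun _ => e').sum n) ↔
          ψ.Realize (((z (k + 1)).pull fun _ => e').sum (n.map σ.toFun)) := by
        rw [h0, h1, ← Assign.pull_map, ← Assign.map_sum, σ.realize_map]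
      exact h5
    · refine (Formula.realize_iff _ _ _).2 ?_
      rw [Formula.realize_subst, Formula.realize_subst, hpull (B := W), hpull (B := W)]
      exact hψ ψ _ hi i)
  obtain ⟨zy, rfl⟩ : ∃ b, b = a := ⟨a, rfl⟩
  let z : ℕ → Assign W M := fun i s j => zy s (.inl (j, i))
  let y : ℕ → Assign W M := fun i s j => zy s (.inr (j, i))
  have hz0 : ∃ ρ : Aut M, n.map ρ.toFun = z 0 :=
    S.exists_aut le_rfl _ _ fun χ hχ => by
      have h1 := ha (.inl (⟨χ, hχ⟩, none))
      rw [Formula.realize_subst] at h1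
      exact h1
  have hy : ∀ i, ∃ ρ : Aut M, n.map ρ.toFun = y i := fun i =>
    S.exists_aut le_rfl _ _ fun χ hχ => by
      have h1 := ha (.inl (⟨χ, hχ⟩, some i))
      rw [Formula.realize_subst] at h1
      exact h1
  have hzy : ∀ i, ∃ τ : Aut M, ((z i).sum (y i)).map τ.toFun = (z (i + 1)).sum (y i) := by
    refine fun i => S.exists_aut (mk_sum_self_eq W).le _ _ fun ψ hψ => ?_
    have h1 := (Formula.realize_iff _ _ _).1 (ha (.inr (ψ, some i)))
    rw [Formula.realize_subst, Formula.realize_subst, hpull (B := W), hpull (B := W)] at h1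
    exact h1.1 hψ
  have hend : ∃ σ' : Aut M, ((z 0).sum n).map σ'.toFun = (z (k + 1)).sum (n.map σ.toFun) := by
    refine S.exists_aut (mk_sum_self_eq W).le _ _ fun ψ hψ => ?_
    have h1 := (Formula.realize_iff _ _ _).1 (ha (.inr (ψ, none)))
    rw [Formula.realize_subst, Formula.realize_subst, hpull (B := W), hpull (B := W)] at h1
    exact h1.1 hψ
  have hsum : ∀ {a b a' b' : Assign W M} {τ : Aut M}, (a.sum b).map τ.toFun = a'.sum b' →
      a.map τ.toFun = a' ∧ b.map τ.toFun = b' := fun h =>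
    ⟨funext fun s => funext fun j => congrFun (congrFun h s) (.inl j),
      funext fun s => funext fun j => congrFun (congrFun h s) (.inr j)⟩
  -- A conjugate of `n` enumerates a model, so fixing it suffices for membership.
  have hfix : ∀ {c : Assign W M} {τ : Aut M}, (∃ ρ : Aut M, n.map ρ.toFun = c) →
      c.map τ.toFun = c → τ ∈ AutL M := by
    rintro _ τ ⟨ρ, rfl⟩ h
    exact Subgroup.subset_closure ((hn.map ρ).mem_fixesModel h)
  have hchain : ∀ i, ∃ τ ∈ AutL M, (z 0).map τ.toFun = z i := by
    intro i
    induction i with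
    | zero => exact ⟨1, one_mem _, rfl⟩
    | succ i ih =>
      obtain ⟨τ, hτ, h1⟩ := ih
      obtain ⟨τ', h2⟩ := hzy i
      refine ⟨τ' * τ, mul_mem (hfix (hy i) (hsum h2).2) hτ, ?_⟩
      rw [Assign.map_mul, h1, (hsum h2).1]
  -- Both τ and σ' send z₀ to z_{k+1}, while σ' and σ agree on `n`. So τ⁻¹σ' fixes the model z₀,
  -- σ⁻¹σ' fixes `n`, and σ is a product of τ with these two.
  obtain ⟨τ, hτ, h1⟩ := hchain (k + 1)
  obtain ⟨σ', h2⟩ := hend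
  have h3 : τ⁻¹ * σ' ∈ AutL M := by
    refine hfix hz0 ?_
    rw [Assign.map_mul, (hsum h2).1, ← h1, TypeSpace.map_inv_map]
  have h4 : σ⁻¹ * σ' ∈ AutL M := by
    refine hfix ⟨1, rfl⟩ (c := n) ?_
    rw [Assign.map_mul, (hsum h2).2, TypeSpace.map_inv_map]
  have h5 : σ = τ * (τ⁻¹ * σ') * (σ⁻¹ * σ')⁻¹ := by group
  rw [h5]
  exact mul_mem (mul_mem hτ h3) (inv_mem h4)

end SmallModel

/-- The number `k` is the length of a path of L₁-neighbours from `p` to `p'`. It works for all `δ`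
and `Ψ` at once, since every `nearFormula` with satisfiable `δ` belongs to L₁². Both directions are
kept for the symmetric case. -/
theorem exists_chainFormula_mem {T : L.Theory} (hT : Theory.IsComplete.{u, v, w} T)
    (hM : T.IsModel M) {p p' : TypeSpace M}
    (h : Relation.EqvGen (LascarDistLEOne.{u, v, w} T) p p') :
    ∃ k, ∀ (δ : L.Formula ℕ) (Ψ : Finset (L.Formula (ℕ ⊕ ℕ))), (∃ d : Assign ℕ M, δ.Realize d) →
      ∀ j c, ((chainFormula δ Ψ j, c) ∈ p'.formulas → (chainFormula δ Ψ (j + k), c) ∈ p.formulas) ∧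
        ((chainFormula δ Ψ j, c) ∈ p.formulas → (chainFormula δ Ψ (j + k), c) ∈ p'.formulas) := by
  have := hM.nonempty
  induction h with
  | rel p p' h =>
    refine ⟨1, fun δ Ψ hδ j c => ⟨fun h' => ?_, fun h' => ?_⟩⟩
    · refine TypeSpace.mem_left_of_lascarDistLEOne h
        (nearFormula_mem (Ψ := Ψ) hT hM hδ) h' fun a z h1 h2 => ?_
      rw [realize_nearFormula] at h1
      rw [realize_chainFormula] at h2 ⊢
      exact ⟨z, h1, h2⟩
    · refine TypeSpace.mem_right_of_lascarDistLEOne h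
        (nearFormula_mem (Ψ := Ψ) hT hM hδ) h' fun a z h1 h2 => ?_
      rw [realize_nearFormula] at h1
      rw [realize_chainFormula] at h2 ⊢
      exact ⟨z, h1.symm, h2⟩
  | refl p => exact ⟨0, fun _ _ _ _ _ => ⟨id, id⟩⟩
  | symm p p' h ih =>
    obtain ⟨k, hk⟩ := ih
    exact ⟨k, fun δ Ψ hδ j c => (hk δ Ψ hδ j c).symm⟩
  | trans p p' p'' h h' ih ih' =>
    obtain ⟨k, hk⟩ := ih
    obtain ⟨k', hk'⟩ := ih'
    refine ⟨k + k', fun δ Ψ hδ j c => ⟨fun h => ?_, fun h => ?_⟩⟩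
    · have := (hk δ Ψ hδ _ c).1 ((hk' δ Ψ hδ j c).1 h)
      rwa [show j + k' + k = j + (k + k') by omega] at this
    · have := (hk' δ Ψ hδ _ c).2 ((hk δ Ψ hδ j c).2 h)
      rwa [show j + k + k' = j + (k + k') by omega] at this

/-- An automorphism preserving all Lascar classes of types is a strong Lascar automorphism. -/
theorem SmallModel.mem_AutL_of_eqvGen {κ : Cardinal.{max u v w}} {W : Type (max u v w)}
    (S : SmallModel κ M W) {n : Assign W M} (hn : IsModelEnum n) {T : L.Theory}
    (hT : Theory.IsComplete.{u, v, w} T) (hM : T.IsModel M) {σ : Aut M}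
    (h : ∀ p : TypeSpace M,
      Relation.EqvGen (LascarDistLEOne.{u, v, w} T) p (TypeSpace.act σ p)) : σ ∈ AutL M := by
  classical
  have := hM.nonempty
  have h1 : ∀ m : Assign ℕ M, ∃ k, ∀ (δ : L.Formula ℕ) (Ψ : Finset (L.Formula (ℕ ⊕ ℕ))),
      (∃ d : Assign ℕ M, δ.Realize d) → NearChain δ Ψ k m (m.map σ.toFun) := by
    intro m
    have h2 := h (TypeSpace.tp m)
    rw [TypeSpace.act_tp] at h2
    obtain ⟨k, hk⟩ := exists_chainFormula_mem hT hM h2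
    refine ⟨k, fun δ Ψ hδ => ?_⟩
    -- The type of σm contains a chain from `x` to σm by reflexivity; transfer to the type of `m`
    -- lengthens it by `k`.
    have := (hk δ Ψ hδ 0 (m.map σ.toFun)).1
      (TypeSpace.mem_tp.2 (realize_chainFormula.2 (Near.refl hδ _)))
    rw [Nat.zero_add, TypeSpace.mem_tp, realize_chainFormula] at this
    exact this
  have h2 : ∃ k, ∀ (m : Assign ℕ M) (δ : L.Formula ℕ) (Ψ : Finset (L.Formula (ℕ ⊕ ℕ))),
      (∃ d : Assign ℕ M, δ.Realize d) → NearChain δ Ψ k m (m.map σ.toFun) := by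
    -- Uniformity: counterexamples for all lengths form countably many countable tuples, which are
    -- coded by one tuple through `Nat.pair`. The length valid for that tuple contradicts the
    -- counterexample with the same index.
    by_contra hc
    push Not at hc
    choose m δ Ψ hδ hm using hc
    obtain ⟨k, hk⟩ := h1 fun s j => m j.unpair.1 s j.unpair.2
    refine hm k ?_
    have h3 := (hk (δ k) ((Ψ k).image fun ψ => ψ.subst fun _ => Sum.map (Nat.pair k) id)
      (hδ k)).pull
    have h4 : Assign.pull (fun _ => Nat.pair k)
        (fun s j => m j.unpair.1 s j.unpair.2 : Assign ℕ M) = m k := by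
      funext s j
      simp [Assign.pull]
    rwa [← Assign.pull_map, h4] at h3
  obtain ⟨k, hk⟩ := h2
  exact S.mem_AutL_of_nearChain hn k fun χ e hχ Ψ => ⟨_, hχ, hk _ χ Ψ ⟨_, hχ⟩⟩

end MSLanguage

/-! ## Homomorphisms to type spaces -/

namespace MSLanguage

variable {L : MSLanguage.{u, v}}

/-- The atomic facts of a pattern structure. -/
def PatternFact (L : MSLanguage.{u, v}) (A : Type y) [L.patternLanguage.Structure A] :
    Type (max u v y) :=
  Σ k : ℕ, {t : L.patternLanguage.Relations k × (Fin k → A) //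
    FirstOrder.Language.Structure.RelMap t.1 t.2}

section Approx

variable {A : Type y} [L.patternLanguage.Structure A] {I : Type x} {W : Type z}

/-- The formula stating that for all values of the parameters there are tuples, indexed by `A`,
that satisfy the given formulas and the given pattern facts. -/
noncomputable def approxFormula [Infinite W] (R : Finset (PatternFact L A × I))
    (B : Finset (A × L.Formula (ℕ ⊕ ℕ) × (L.Sorts → ℕ → W))) : L.Formula W :=
  Formula.allL (V := (PatternFact L A × I) × ℕ) (Formula.exL (V := A × ℕ)
    ((Formula.bigAnd B fun c => c.2.1.subst fun s =>
        Sum.elim (fun k => .inl (c.1, k)) fun k => .inr (.inr (c.2.2 s k))).and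
      (Formula.bigAnd R fun ρ => (ρ.1.2.1.1.2.subst fun _ k => .inr (.inl (ρ, k))).imp
        (Formula.bigOr Finset.univ fun i => ((ρ.1.2.1.1.1 i).subst fun _ =>
          Sum.elim (fun k => .inl (ρ.1.2.1.2 i, k)) fun k => .inr (.inl (ρ, k))).neg))))

theorem realize_approxFormula [Infinite W] {M : L.Sorts → Type w} [L.Structure M]
    [∀ s, Nonempty (M s)] (R : Finset (PatternFact L A × I))
    (B : Finset (A × L.Formula (ℕ ⊕ ℕ) × (L.Sorts → ℕ → W))) (m : Assign W M) :
    (approxFormula R B).Realize m ↔ ∀ β : PatternFact L A × I → Assign ℕ M,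
      ∃ ξ : A → Assign ℕ M, (∀ c ∈ B, c.2.1.Realize ((ξ c.1).sum (m.pull c.2.2))) ∧
        ∀ ρ ∈ R, ρ.1.2.1.1.2.Realize (β ρ) →
          ∃ i, ¬ (ρ.1.2.1.1.1 i).Realize ((ξ (ρ.1.2.1.2 i)).sum (β ρ)) := by
  rw [approxFormula, Formula.realize_allL]
  have key : ∀ (b : Assign ((PatternFact L A × I) × ℕ) M) (a : Assign (A × ℕ) M),
      ((Formula.bigAnd B fun c => c.2.1.subst fun s =>
        Sum.elim (fun k => .inl (c.1, k)) fun k => .inr (.inr (c.2.2 s k))).and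
      (Formula.bigAnd R fun ρ => (ρ.1.2.1.1.2.subst fun _ k => .inr (.inl (ρ, k))).imp
        (Formula.bigOr Finset.univ fun i => ((ρ.1.2.1.1.1 i).subst fun _ =>
          Sum.elim (fun k => .inl (ρ.1.2.1.2 i, k)) fun k => .inr (.inl (ρ, k))).neg)) :
          L.Formula ((A × ℕ) ⊕ (((PatternFact L A × I) × ℕ) ⊕ W))).Realize (a.sum (b.sum m)) ↔
      (∀ c ∈ B, c.2.1.Realize (Assign.sum (fun s k => a s (c.1, k)) (m.pull c.2.2))) ∧
        ∀ ρ ∈ R, ρ.1.2.1.1.2.Realize (fun s k => b s (ρ, k)) →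
          ∃ i, ¬ (ρ.1.2.1.1.1 i).Realize
            (Assign.sum (fun s k => a s (ρ.1.2.1.2 i, k)) (fun s k => b s (ρ, k))) := by
    intro b a
    have h1 : ∀ c : A × L.Formula (ℕ ⊕ ℕ) × (L.Sorts → ℕ → W), (a.sum (b.sum m)).pull
        (fun s => Sum.elim (fun k => .inl (c.1, k)) fun k => .inr (.inr (c.2.2 s k))) =
          Assign.sum (fun s k => a s (c.1, k)) (m.pull c.2.2) := by
      intro c; funext s i; cases i <;> rfl
    have h2 : ∀ (p : A) (ρ : PatternFact L A × I), (a.sum (b.sum m)).pull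
        (fun _ => Sum.elim (fun k => .inl (p, k)) fun k => .inr (.inl (ρ, k))) =
          Assign.sum (fun s k => a s (p, k)) (fun s k => b s (ρ, k)) := by
      intro p ρ; funext s i; cases i <;> rfl
    simp only [Formula.realize_and, Formula.realize_bigAnd, Formula.realize_imp,
      Formula.realize_bigOr, Formula.realize_neg, Formula.realize_subst, h1, h2, Finset.mem_univ,
      true_and]
    exact Iff.rfl
  constructor
  · intro h β
    obtain ⟨a, ha⟩ := (Formula.realize_exL _ _).1 (h fun s q => β q.1 s q.2)
    exact ⟨fun p s k => a s (p, k), (key _ _).1 ha⟩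
  · intro h b
    obtain ⟨ξ, hξ⟩ := h fun ρ s k => b s (ρ, k)
    exact (Formula.realize_exL _ _).2 ⟨fun s q => ξ q.1 s q.2, (key _ _).2 hξ⟩

/-- For given values of the parameters only finitely many formulas matter, so each type can be
replaced by a tuple of `M` deciding them in the same way. -/
theorem realize_approxFormula_of_types [Infinite W] {M : L.Sorts → Type w} [L.Structure M]
    [∀ s, Nonempty (M s)] (R : Finset (PatternFact L A × I))
    (B : Finset (A × L.Formula (ℕ ⊕ ℕ) × (L.Sorts → ℕ → W))) (m : Assign W M)
    (j : A → TypeSpace M) (hB : ∀ c ∈ B, (c.2.1, m.pull c.2.2) ∈ (j c.1).formulas)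
    (hR : ∀ ρ ∈ R, FirstOrder.Language.Structure.RelMap ρ.1.2.1.1 fun i => j (ρ.1.2.1.2 i)) :
    (approxFormula R B).Realize m := by
  classical
  rw [realize_approxFormula]
  intro β
  let G : Set (L.Formula (ℕ ⊕ ℕ) × Assign ℕ M) :=
    (fun c : A × L.Formula (ℕ ⊕ ℕ) × (L.Sorts → ℕ → W) => (c.2.1, m.pull c.2.2)) '' B ∪
      ⋃ ρ ∈ R, Set.range fun i => (ρ.1.2.1.1.1 i, β ρ)
  have hG : G.Finite := (B.finite_toSet.image _).union
    (R.finite_toSet.biUnion fun ρ _ => Set.finite_range _)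
  choose ξ hξ using fun p : A => (j p).exists_realize_iff G hG
  refine ⟨ξ, fun c hc => (hξ c.1 (c.2.1, m.pull c.2.2) (Or.inl ⟨c, hc, rfl⟩)).2 (hB c hc),
    fun ρ hρ h => ?_⟩
  obtain ⟨i, hi⟩ := (TypeSpace.relMap_iff _ _).1 (hR ρ hρ) _ h
  refine ⟨i, fun h' => hi ?_⟩
  exact (hξ _ (ρ.1.2.1.1.1 i, β ρ) (Or.inr (Set.mem_biUnion hρ ⟨i, rfl⟩))).1 h'

/-- Compactness: the index set `I` is taken to be all parameter tuples, and each pair of a fact and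
a parameter is one condition on `ξ`. The homomorphism sends `p` to the limit of the types of `ξ p`.
-/
theorem exists_hom_of_approx [Infinite W] {M : L.Sorts → Type w} [L.Structure M]
    [∀ s, Nonempty (M s)] (m : Assign W M)
    (Γ : Set (A × L.Formula (ℕ ⊕ ℕ) × (L.Sorts → ℕ → W)))
    (h : ∀ (R : Finset (PatternFact L A × Assign ℕ M)) (B : Finset _), ↑B ⊆ Γ →
      (approxFormula R B).Realize m) :
    ∃ g : A →[L.patternLanguage] TypeSpace M,
      ∀ c ∈ Γ, (c.2.1, m.pull c.2.2) ∈ (g c.1).formulas := by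
  classical
  obtain ⟨U, hU⟩ := exists_ultrafilter_of_finite (I := Γ ⊕ PatternFact L A × Assign ℕ M)
    (X := A → Assign ℕ M)
    (fun i ξ => Sum.elim (fun c => c.1.2.1.Realize ((ξ c.1.1).sum (m.pull c.1.2.2)))
      (fun ρ => ρ.1.2.1.1.2.Realize ρ.2 →
          ∃ i, ¬ (ρ.1.2.1.1.1 i).Realize ((ξ (ρ.1.2.1.2 i)).sum ρ.2)) i) (by
      intro F
      obtain ⟨ξ, h1, h2⟩ := (realize_approxFormula _ _ _).1
        (h (F.preimage Sum.inr Sum.inr_injective.injOn)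
          ((F.preimage Sum.inl Sum.inl_injective.injOn).image Subtype.val)
          (by intro c hc; simp at hc; exact hc.1)) fun ρ => ρ.2
      refine ⟨ξ, ?_⟩
      rintro (c | ρ) hi
      · exact h1 _ (Finset.mem_image_of_mem _ (Finset.mem_preimage.2 hi))
      · exact h2 _ (Finset.mem_preimage.2 hi))
  refine ⟨⟨fun p => TypeSpace.lim U fun ξ => TypeSpace.tp (ξ p), fun f _ => f.elim,
    fun {k} t p ht => ?_⟩, fun c hc => hU (.inl ⟨c, hc⟩)⟩
  exact TypeSpace.relMap_lim_tp t p fun b => hU (.inr (⟨k, (t, p), ht⟩, b))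

end Approx

variable {M : L.Sorts → Type w} [L.Structure M]

/-- A homomorphism of type spaces reflects patterns. -/
theorem exists_pattern_of_hom (f : TypeSpace M →[L.patternLanguage] TypeSpace M)
    {W : Type x} [Nonempty W] (n : Assign W M) (χ : L.Formula W) (hχ : χ.Realize n)
    (C : Finset (TypeSpace M × L.Formula (ℕ ⊕ ℕ) × (L.Sorts → ℕ → W)))
    (hC : ∀ c ∈ C, (c.2.1, n.pull c.2.2) ∈ (f c.1).formulas) :
    ∃ m : Assign W M, χ.Realize m ∧ ∀ c ∈ C, (c.2.1, m.pull c.2.2) ∈ c.1.formulas := by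
  classical
  obtain ⟨e, e', he⟩ := exists_nat_coding ((χ.freeVars.image Prod.snd) ∪
    ⋃ c ∈ C, (fun q : L.Sorts × (ℕ ⊕ ℕ) => Sum.elim (fun _ => Classical.arbitrary W)
      (fun k => c.2.2 q.1 k) q.2) '' c.2.1.freeVars)
    ((χ.finite_freeVars.image _).union
      (C.finite_toSet.biUnion fun c _ => c.2.1.finite_freeVars.image _))
  have hχ' : (χ.subst fun _ => e').Realize (n.pull fun _ => e) := by
    rw [Formula.realize_subst]
    refine (χ.realize_congr fun q hq => ?_).2 hχ
    exact congrArg (n q.1) (he _ (Or.inl ⟨q, hq, rfl⟩))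
  let φ : C → L.Formula (ℕ ⊕ ℕ) := fun c =>
    c.1.2.1.subst fun s => Sum.elim Sum.inl fun k => Sum.inr (e' (c.1.2.2 s k))
  have hφ : ∀ (c : C) (a b : Assign ℕ M), (φ c).Realize (a.sum b) ↔
      c.1.2.1.Realize (a.sum ((b.pull fun _ => e').pull c.1.2.2)) := by
    intro c a b
    simp only [φ, Formula.realize_subst]
    have : (a.sum b).pull (fun s => Sum.elim Sum.inl fun k => Sum.inr (e' (c.1.2.2 s k))) =
        a.sum ((b.pull fun _ => e').pull c.1.2.2) := by
      funext s i; cases i <;> rfl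
    rw [this]
  let t : L.patternLanguage.Relations (Fintype.card C) :=
    pat (fun i => φ ((Fintype.equivFin C).symm i)) (χ.subst fun _ => e')
  let p : Fin (Fintype.card C) → TypeSpace M := fun i => ((Fintype.equivFin C).symm i).1.1
  by_contra hc
  -- If no `m` existed, the types `c.1` would satisfy R_t; so would their images under `f`, but
  -- there `n` is a forbidden parameter.
  have hp : FirstOrder.Language.Structure.RelMap t p := by
    rw [TypeSpace.relMap_iff]
    intro b hb
    by_contra hc'
    push Not at hc'
    refine hc ⟨b.pull fun _ => e', (Formula.realize_subst _ _ _).1 hb, fun c hc => ?_⟩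
    have h1 := hc' (Fintype.equivFin C ⟨c, hc⟩)
    simp only [t, p, pat, Equiv.symm_apply_apply] at h1
    exact (TypeSpace.mem_congr _ fun a => hφ ⟨c, hc⟩ a b).1 h1
  obtain ⟨i, hi⟩ := (TypeSpace.relMap_iff _ _).1 (f.map_rel t p hp) _ hχ'
  refine hi ?_
  have h1 := hC _ ((Fintype.equivFin C).symm i).2
  refine (TypeSpace.mem_congr _ fun a => ?_).1 h1
  refine Iff.trans ?_ (hφ _ a _).symm
  refine Formula.realize_congr _ ?_
  rintro ⟨s, k | k⟩ hk
  · rfl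
  · refine (congrArg (n s) (he _ (Or.inr ?_))).symm
    exact Set.mem_biUnion ((Fintype.equivFin C).symm i).2 ⟨_, hk, rfl⟩

/-- Up to Lascar neighbours, an endomorphism of the type space is the action of
an automorphism. -/
theorem SmallModel.exists_aut_of_endo {κ : Cardinal.{max u v w}} {W : Type (max u v w)}
    (S : SmallModel κ M W) (n : Assign W M)
    (f : TypeSpace M →[L.patternLanguage] TypeSpace M) :
    ∃ (σ : Aut M) (i : TypeSpace M →[L.patternLanguage] TypeSpace M),
      (∀ p φ (e : L.Sorts → ℕ → W), (φ, n.pull e) ∈ p.formulas →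
        (φ, n.pull e) ∈ (i p).formulas) ∧
      ∀ p φ (e : L.Sorts → ℕ → W), (φ, n.pull e) ∈ (f p).formulas →
        (φ, n.pull e) ∈ (TypeSpace.act σ (i p)).formulas := by
  classical
  have := S.infinite
  have := S.nonempty
  -- The right copy of `W` names `n`, the left one the tuple `m` to be found. The requirements on
  -- `i` are that i(p) extends p over `n`, and that i(p) over `m` looks like f(p) over `n`.
  let Γ : Set (TypeSpace M × L.Formula (ℕ ⊕ ℕ) × (L.Sorts → ℕ → W ⊕ W)) :=
    {c | (∃ e, (c.2.2 = fun s k => .inr (e s k)) ∧ (c.2.1, n.pull e) ∈ c.1.formulas) ∨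
      ∃ e, (c.2.2 = fun s k => .inl (e s k)) ∧ (c.2.1, n.pull e) ∈ (f c.1).formulas}
  obtain ⟨m, hm⟩ := S.exists_realize (V := W) (V' := W) le_rfl le_rfl n
    (I := {χ : L.Formula W // χ.Realize n} ⊕
      Finset (PatternFact L (TypeSpace M) × Assign ℕ M) × {B : Finset _ // ↑B ⊆ Γ})
    (Sum.elim (fun χ => χ.1.subst fun _ => Sum.inl) fun x => approxFormula x.1 x.2.1) (by
      intro F
      let D : Finset (TypeSpace M × L.Formula (ℕ ⊕ ℕ) × (L.Sorts → ℕ → W ⊕ W)) :=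
        F.biUnion (Sum.elim (fun _ => ∅) fun x => x.2.1)
      let toC : TypeSpace M × L.Formula (ℕ ⊕ ℕ) × (L.Sorts → ℕ → W ⊕ W) →
        TypeSpace M × L.Formula (ℕ ⊕ ℕ) × (L.Sorts → ℕ → W) := fun c =>
          (c.1, c.2.1, fun s k => Sum.elim id id (c.2.2 s k))
      -- The finitely many formulas of f(p) over `n` reappear in p over some `m`, so the identity
      -- may play the role of `i` at this finite stage. Since `approxFormula` is first order in `m`
      -- and `n`, saturation then gives one `m` for all stages.
      obtain ⟨m, hm, hC⟩ := exists_pattern_of_hom f n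
        (Formula.bigAnd F fun i => Sum.elim (fun χ => χ.1) (fun _ => Formula.truth) i)
        (by
          rw [Formula.realize_bigAnd]
          rintro (χ | x) -
          · exact χ.2
          · exact fun h => h)
        ((D.image toC).filter fun c => (c.2.1, n.pull c.2.2) ∈ (f c.1).formulas)
        (fun c hc => (Finset.mem_filter.1 hc).2)
      refine ⟨m, ?_⟩
      rintro (χ | ⟨R, B, hB⟩) hi
      · exact (Formula.realize_subst _ _ _).2 ((Formula.realize_bigAnd _ _ _).1 hm _ hi)
      · refine realize_approxFormula_of_types R B _ id (fun c hc => ?_) fun ρ _ => ρ.1.2.2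
        have hcD : c ∈ D := Finset.mem_biUnion.2 ⟨_, hi, hc⟩
        rcases hB hc with ⟨e, he, h1⟩ | ⟨e, he, h1⟩
        · have h2 : (m.sum n).pull c.2.2 = n.pull e := by rw [he]; rfl
          rw [h2]
          exact h1
        · have h2 : (m.sum n).pull c.2.2 = m.pull e := by rw [he]; rfl
          have h3 : toC c = (c.1, c.2.1, e) := by simp only [toC, he]; rfl
          rw [h2]
          refine hC (c.1, c.2.1, e) (Finset.mem_filter.2 ⟨?_, h1⟩)
          rw [← h3]
          exact Finset.mem_image_of_mem _ hcD)
  obtain ⟨σ, hσ⟩ := S.exists_aut le_rfl n m fun χ hχ => by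
    have h1 := hm (.inl ⟨χ, hχ⟩)
    rw [Sum.elim_inl, Formula.realize_subst] at h1
    exact h1
  obtain ⟨i, hi⟩ := exists_hom_of_approx (A := TypeSpace M) (m.sum n) Γ
    fun R B hB => hm (.inr (R, ⟨B, hB⟩))
  -- As σ takes `n` to `m`, what i(p) says about `m` is what σ⁻¹i(p) says about `n`.
  refine ⟨σ⁻¹, i, fun p φ e h => ?_, fun p φ e h => ?_⟩
  · exact hi (p, φ, fun s k => .inr (e s k)) (Or.inl ⟨e, rfl, h⟩)
  · have h1 := hi (p, φ, fun s k => .inl (e s k)) (Or.inr ⟨e, rfl, h⟩)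
    rw [TypeSpace.mem_act, inv_inv, Assign.pull_map, hσ]
    exact h1

end MSLanguage

/-! ## Positive primitive formulas and homomorphisms -/

namespace FirstOrder.Language

variable {K : FirstOrder.Language.{u, v}} {A : Type w} {B : Type x} [K.Structure A] [K.Structure B]

theorem BoundedFormula.IsAtomicConj.realize_hom {α : Type y} {n : ℕ} {φ : K.BoundedFormula α n}
    (hφ : φ.IsAtomicConj) (f : A →[K] B) {a : α → A} {xs : Fin n → A} (h : φ.Realize a xs) :
    φ.Realize (f ∘ a) (f ∘ xs) := by
  induction hφ with
  | top => exact BoundedFormula.realize_top.2 trivial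
  | atomic hφ =>
    cases hφ with
    | equal t t' =>
      rw [BoundedFormula.realize_bdEqual] at h ⊢
      rw [← Sum.comp_elim, HomClass.realize_term, HomClass.realize_term, h]
    | rel R ts =>
      rw [BoundedFormula.realize_rel] at h ⊢
      simp only [← Sum.comp_elim, HomClass.realize_term]
      exact f.map_rel R _ h
  | inf _ _ ih ih' =>
    rw [BoundedFormula.realize_inf] at h ⊢
    exact ⟨ih h.1, ih' h.2⟩

theorem BoundedFormula.IsPP.realize_hom {α : Type y} {n : ℕ} {φ : K.BoundedFormula α n}
    (hφ : φ.IsPP) (f : A →[K] B) {a : α → A} {xs : Fin n → A} (h : φ.Realize a xs) :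
    φ.Realize (f ∘ a) (f ∘ xs) := by
  induction hφ with
  | conj hφ => exact hφ.realize_hom f h
  | ex _ ih =>
    rw [BoundedFormula.realize_ex] at h ⊢
    obtain ⟨y, hy⟩ := h
    refine ⟨f y, ?_⟩
    rw [← Fin.comp_snoc]
    exact ih hy

theorem Formula.realize_hom_of_isPP {α : Type y} {φ : K.Formula α} (hφ : BoundedFormula.IsPP φ)
    (f : A →[K] B) {a : α → A} (h : φ.Realize a) : φ.Realize fun i => f (a i) := by
  have := hφ.realize_hom f h
  rw [Formula.Realize]
  convert this
  rfl

theorem BoundedFormula.IsPP.exs {α : Type y} {n : ℕ} {φ : K.BoundedFormula α n} (hφ : φ.IsPP) :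
    BoundedFormula.IsPP φ.exs := by
  induction n with
  | zero => exact hφ
  | succ n ih => exact ih hφ.ex

theorem BoundedFormula.isAtomicConj_foldr {α : Type y} {n : ℕ} (l : List (K.BoundedFormula α n))
    (hl : ∀ φ ∈ l, φ.IsAtomic) : (l.foldr (· ⊓ ·) ⊤).IsAtomicConj := by
  induction l with
  | nil => exact .top
  | cons φ l ih =>
    exact .inf (.atomic (hl φ (by simp))) (ih fun ψ hψ => hl ψ (by simp [hψ]))

end FirstOrder.Language

namespace MSLanguage

variable {L : MSLanguage.{u, v}} {T : L.Theory} {M : L.Sorts → Type w} [L.Structure M]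

theorem model_patternTheory_of_hom (hM : T.IsModel M) {A : Type y} [L.patternLanguage.Structure A]
    (f : A →[L.patternLanguage] TypeSpace M) : A ⊨ patternTheory.{u, v, w} T := by
  rw [FirstOrder.Language.Theory.model_iff]
  rintro _ ⟨ψ, hψ, rfl, h⟩
  refine (FirstOrder.Language.Formula.realize_not).2 fun hA => h M hM ?_
  have := FirstOrder.Language.Formula.realize_hom_of_isPP hψ f hA
  rwa [Subsingleton.elim (fun i => f ((default : Empty → A) i)) default] at this

/-- The models of the theory of patterns have homomorphisms to the type spaces. -/
theorem exists_hom_of_model (hT : Theory.IsComplete.{u, v, w} T) (hM : T.IsModel M) {A : Type y}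
    [L.patternLanguage.Structure A] (hA : A ⊨ patternTheory.{u, v, w} T) :
    Nonempty (A →[L.patternLanguage] TypeSpace M) := by
  classical
  have := hM.nonempty
  obtain ⟨g, -⟩ := exists_hom_of_approx (A := A) (W := ℕ) (M := M)
    (fun s _ => Classical.arbitrary (M s)) ∅ (by
      intro R B hB
      obtain rfl : B = ∅ := by simpa using hB
      let D : Finset A := R.biUnion fun ρ => Finset.univ.image ρ.1.2.1.2
      have hD : ∀ ρ : R, ∀ i, ρ.1.1.2.1.2 i ∈ D := fun ρ i =>
        Finset.mem_biUnion.2 ⟨ρ.1, ρ.2, Finset.mem_image_of_mem _ (Finset.mem_univ _)⟩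
      let φ : R → L.patternLanguage.BoundedFormula Empty (Fintype.card D) := fun ρ =>
        ρ.1.1.2.1.1.boundedFormula fun i => .var (.inr (Fintype.equivFin D ⟨_, hD ρ i⟩))
      -- The pp sentence asserting that the finite diagram `R` occurs. It holds in `A`, so its
      -- negation is not in the theory of patterns and it holds in the type space of some model.
      let ψ : L.patternLanguage.Sentence :=
        (((Finset.univ : Finset R).toList.map φ).foldr (· ⊓ ·) ⊤).exs
      have hψ : BoundedFormula.IsPP ψ := by
        refine BoundedFormula.IsPP.exs (.conj (BoundedFormula.isAtomicConj_foldr _ ?_))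
        intro χ hχ
        obtain ⟨ρ, -, rfl⟩ := List.mem_map.1 hχ
        exact .rel _ _
      have key : ¬ ∀ (N : L.Sorts → Type w) [L.Structure N], T.IsModel N →
          ¬ (TypeSpace N ⊨ ψ) := by
        intro h
        have h1 : A ⊨ FirstOrder.Language.Formula.not ψ :=
          (FirstOrder.Language.Theory.model_iff _).1 hA _ ⟨ψ, hψ, rfl, h⟩
        refine h1 (BoundedFormula.realize_exs.2 ⟨fun i => ((Fintype.equivFin D).symm i).1, ?_⟩)
        rw [BoundedFormula.realize_foldr_inf]
        intro χ hχ
        obtain ⟨ρ, -, rfl⟩ := List.mem_map.1 hχ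
        rw [BoundedFormula.realize_rel]
        simpa using ρ.1.1.2.2
      push Not at key
      obtain ⟨N, _, hN, hψN⟩ := key
      obtain ⟨q, hq⟩ := BoundedFormula.realize_exs.1 hψN
      rw [BoundedFormula.realize_foldr_inf] at hq
      have := hN.nonempty
      -- Types over `N` cannot be moved to `M`, but the first-order formula approximating them can,
      -- by completeness.
      refine hT.forall_realize hN hM _ (fun a => ?_) _
      obtain ⟨p₀⟩ : Nonempty (TypeSpace N) :=
        ⟨TypeSpace.tp fun s _ => Classical.arbitrary (N s)⟩
      refine realize_approxFormula_of_types R ∅ a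
        (fun p => if h : p ∈ D then q (Fintype.equivFin D ⟨p, h⟩) else p₀) (by simp) ?_
      intro ρ hρ
      have h1 := hq (φ ⟨ρ, hρ⟩) (List.mem_map.2 ⟨_, by simp, rfl⟩)
      rw [BoundedFormula.realize_rel] at h1
      convert h1 using 1
      funext i
      have h2 := hD ⟨ρ, hρ⟩ i
      simp only [dif_pos h2]
      rfl)
  exact ⟨g⟩

end MSLanguage

/-! ## Existence of the core -/

/-- In a compact Hausdorff semigroup with continuous right multiplications there is an idempotent
`e` such that the elements `e * x * e` form a group with neutral element `e`. -/
theorem exists_idempotent_isGroup {H : Type x} [Semigroup H] [TopologicalSpace H] [CompactSpace H]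
    [T2Space H] [Nonempty H] (hc : ∀ r : H, Continuous fun h : H => h * r) :
    ∃ e : H, e * e = e ∧ ∀ x, ∃ h, e * h * e = h ∧ h * (e * x * e) = e ∧ (e * x * e) * h = e := by
  -- Closed left ideals; the idempotent is taken in a minimal one.
  let 𝓘 : Set (Set H) := {I | IsClosed I ∧ I.Nonempty ∧ ∀ h, ∀ x ∈ I, h * x ∈ I}
  obtain ⟨I, hI⟩ : ∃ I, Minimal (· ∈ 𝓘) I := by
    refine zorn_superset 𝓘 fun c hcs hc' => ?_
    refine ⟨⋂₀ c, ⟨isClosed_sInter fun t ht => (hcs ht).1, ?_, ?_⟩,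
      fun t ht => Set.sInter_subset_of_mem ht⟩
    · obtain rfl | hne := c.eq_empty_or_nonempty
      · simp
      · have := hne.to_subtype
        rw [Set.sInter_eq_iInter]
        refine IsCompact.nonempty_iInter_of_directed_nonempty_isCompact_isClosed _ ?_
          (fun t => (hcs t.2).2.1) (fun t => (hcs t.2).1.isCompact) fun t => (hcs t.2).1
        exact DirectedOn.directed_val (IsChain.directedOn hc'.symm)
    · exact fun h x hx t ht => (hcs ht).2.2 h x (hx t ht)
  obtain ⟨hIc, hIne, hImul⟩ := hI.prop
  obtain ⟨e, heI, he⟩ := exists_idempotent_in_compact_subsemigroup hc I hIne hIc.isCompact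
    fun x _ y hy => hImul x y hy
  have hex : ∀ x, ∃ h, e * h * e = h ∧ h * (e * x * e) = e := by
    intro x
    have hy : e * x * e ∈ I := hImul _ _ heI
    -- This left ideal is closed, being a continuous image of a compact space, so by minimality it
    -- contains `e`. This gives left inverses, and applying it twice makes them two-sided.
    have hmem : Set.range (fun h => h * (e * x * e)) ∈ 𝓘 := by
      refine ⟨(isCompact_range (hc _)).isClosed, Set.range_nonempty _, ?_⟩
      rintro h _ ⟨k, rfl⟩
      exact ⟨h * k, mul_assoc _ _ _⟩
    have hsub := hI.le_of_le hmem (by rintro _ ⟨k, rfl⟩; exact hImul _ _ hy)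
    obtain ⟨h, hh⟩ := hsub heI
    refine ⟨e * h * e, ?_, ?_⟩
    · simp only [mul_assoc, he]
      simp only [← mul_assoc, he]
    · have : e * h * e * (e * x * e) = e * (h * ((e * e) * x * e)) := by simp only [mul_assoc]
      rw [this, he]
      exact (congrArg (e * ·) hh).trans he
  refine ⟨e, he, fun x => ?_⟩
  obtain ⟨h, hh, hx⟩ := hex x
  refine ⟨h, hh, hx, ?_⟩
  obtain ⟨k, hk, hkh⟩ := hex h
  rw [hh] at hkh
  have h1 : k = e * x * e := by
    have h2 : k * (h * (e * x * e)) = e * (e * x * e) := by rw [← mul_assoc, hkh]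
    rw [hx] at h2
    have h3 : k * e = k := by rw [← hk]; simp only [mul_assoc, he]
    rw [← h3, h2]
    simp only [← mul_assoc, he]
  rw [← h1, hkh]

namespace FirstOrder.Language

variable {K : FirstOrder.Language.{u, v}} {A : Type w} [K.Structure A]

/-- A pair of inverse endomorphisms is an automorphism. -/
def Equiv.ofHom (f g : A →[K] A) (h : ∀ a, g (f a) = a) (h' : ∀ a, f (g a) = a) : A ≃[K] A where
  toFun := f
  invFun := g
  left_inv := h
  right_inv := h'
  map_fun' := fun F x => f.map_fun F x
  map_rel' := fun R x => by
    refine ⟨fun h1 => ?_, fun h1 => f.map_rel R x h1⟩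
    have h2 := g.map_rel R _ h1
    convert h2 using 1
    exact funext fun i => (h (x i)).symm

end FirstOrder.Language

namespace MSLanguage

variable {L : MSLanguage.{u, v}} {T : L.Theory} {M : L.Sorts → Type w} [L.Structure M]

/-! ### The compact semigroup of endomorphisms. -/

namespace TypeSpace

/-- The monoid of endomorphisms of the type space. -/
instance endMonoid : Monoid (TypeSpace M →[L.patternLanguage] TypeSpace M) where
  mul f g := f.comp g
  one := FirstOrder.Language.Hom.id _ _
  mul_assoc _ _ _ := rfl
  one_mul _ := rfl
  mul_one _ := rfl

theorem end_mul_apply (f g : TypeSpace M →[L.patternLanguage] TypeSpace M) (p : TypeSpace M) :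
    (f * g) p = f (g p) := rfl

/-- The topology of pointwise convergence on the endomorphisms of the type space. -/
instance endTopology : TopologicalSpace (TypeSpace M →[L.patternLanguage] TypeSpace M) :=
  TopologicalSpace.generateFrom
    {U | ∃ (p : TypeSpace M) (φ : L.Formula (ℕ ⊕ ℕ) × Assign ℕ M), U = {f | φ ∈ (f p).formulas}}

theorem isOpen_end (p : TypeSpace M) (φ : L.Formula (ℕ ⊕ ℕ) × Assign ℕ M) :
    IsOpen {f : TypeSpace M →[L.patternLanguage] TypeSpace M | φ ∈ (f p).formulas} :=
  TopologicalSpace.isOpen_generateFrom_of_mem ⟨p, φ, rfl⟩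

/-- The pointwise limit of homomorphisms along an ultrafilter. -/
def limHom {I : Type x} {A : Type y} [L.patternLanguage.Structure A] (U : Ultrafilter I)
    (f : I → A →[L.patternLanguage] TypeSpace M) : A →[L.patternLanguage] TypeSpace M where
  toFun := fun a => lim U fun i => f i a
  map_fun' := fun f _ => f.elim
  map_rel' := fun t a h => relMap_lim t _ (.of_forall fun i => (f i).map_rel t a h)

instance end_compactSpace : CompactSpace (TypeSpace M →[L.patternLanguage] TypeSpace M) := by
  refine ⟨isCompact_iff_ultrafilter_le_nhds.2 fun U _ => ⟨limHom U id, trivial, ?_⟩⟩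
  rw [TopologicalSpace.nhds_generateFrom]
  refine le_iInf₂ fun s hs => ?_
  obtain ⟨h1, p, φ, rfl⟩ := hs
  exact Filter.le_principal_iff.2 h1

instance end_t2Space : T2Space (TypeSpace M →[L.patternLanguage] TypeSpace M) := by
  refine ⟨fun f g hfg => ?_⟩
  obtain ⟨p, hp⟩ : ∃ p, f p ≠ g p := by
    by_contra! hc
    exact hfg (FirstOrder.Language.Hom.ext hc)
  obtain ⟨φ, b, h1, h2⟩ : ∃ φ b, (φ, b) ∈ (f p).formulas ∧ (φ, b) ∉ (g p).formulas := by
    by_contra! hc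
    exact hp (ext_of_imp hc)
  refine ⟨_, _, isOpen_end p (φ, b), isOpen_end p (φ.neg, b), h1, (g p).neg_mem.2 h2, ?_⟩
  rw [Set.disjoint_left]
  exact fun k hk hk' => (k p).neg_mem.1 hk' hk

/-- Multiplication on the right only changes the point of evaluation from `p` to `r p`. -/
theorem continuous_end_mul (r : TypeSpace M →[L.patternLanguage] TypeSpace M) :
    Continuous fun f : TypeSpace M →[L.patternLanguage] TypeSpace M => f * r := by
  refine continuous_generateFrom_iff.2 ?_
  rintro _ ⟨p, φ, rfl⟩
  exact isOpen_end (r p) φ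

end TypeSpace

/-- The type space has a core in which every endomorphism is an automorphism. -/
theorem exists_isCore (hT : Theory.IsComplete.{u, v, w} T) (hM : T.IsModel M) :
    ∃ J : L.patternLanguage.Substructure (TypeSpace M), IsCore.{u, v, w} T J ∧
      ∀ k : J →[L.patternLanguage] J, ∃ g : J ≃[L.patternLanguage] J, ∀ p, g p = k p := by
  obtain ⟨e, he, hgrp⟩ := exists_idempotent_isGroup (TypeSpace.continuous_end_mul (M := M))
  have hee : ∀ p, e (e p) = e p := fun p => by rw [← TypeSpace.end_mul_apply, he]
  let J : L.patternLanguage.Substructure (TypeSpace M) := e.range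
  have hJ : ∀ p : J, e p = p := by
    rintro ⟨_, ⟨p, rfl⟩⟩
    exact hee p
  let ι : J →[L.patternLanguage] TypeSpace M := J.subtype.toHom
  have hι : ∀ p : J, ι p = p.1 := fun _ => rfl
  let ρ : TypeSpace M →[L.patternLanguage] J := e.codRestrict J fun p => ⟨p, rfl⟩
  have hρ : ∀ p, (ρ p).1 = e p := fun _ => rfl
  have hend : ∀ k : J →[L.patternLanguage] J, ∃ g : J ≃[L.patternLanguage] J, ∀ p, g p = k p := by
    intro k
    -- Extended through the retraction `e`, `k` satisfies exe = x, so it has an inverse in the group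
    -- at `e`; restricting that inverse to `J` inverts `k`.
    let x : TypeSpace M →[L.patternLanguage] TypeSpace M := ι.comp (k.comp ρ)
    have hx : e * x * e = x := by
      refine FirstOrder.Language.Hom.ext fun p => ?_
      change e (k (ρ (e p))).1 = (k (ρ p)).1
      rw [hJ, show ρ (e p) = ρ p from Subtype.ext (hee p)]
    obtain ⟨h, -, h2, h3⟩ := hgrp x
    rw [hx] at h2 h3
    have hρJ : ∀ p : J, ρ p = p := fun p => Subtype.ext (hJ p)
    refine ⟨.ofHom k (ρ.comp (h.comp ι)) (fun p => ?_) (fun p => ?_), fun p => rfl⟩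
    · have h4 : h (k (ρ p)).1 = e p := DFunLike.congr_fun h2 p.1
      apply Subtype.ext
      change e (h (k p).1) = p
      rw [hρJ] at h4
      rw [h4, hJ, hJ]
    · have h4 : (k (ρ (h p))).1 = e p := DFunLike.congr_fun h3 p.1
      apply Subtype.ext
      change (k (ρ (h p))).1 = p
      rw [h4, hJ]
  refine ⟨J, ⟨⟨model_patternTheory_of_hom hM ι, fun B _ hB f n φ hφ a ha => ?_⟩, fun B _ hB => ?_⟩,
    hend⟩
  · obtain ⟨k⟩ := exists_hom_of_model hT hM hB
    -- Going from `J` to `B` and back is an automorphism of `J`; undoing it returns the pp formula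
    -- to the original parameters.
    obtain ⟨g, hg⟩ := hend (ρ.comp (k.comp f))
    have h1 := FirstOrder.Language.Formula.realize_hom_of_isPP hφ (ρ.comp k) ha
    have h2 := FirstOrder.Language.Formula.realize_hom_of_isPP hφ g.symm.toHom h1
    convert h2 using 1
    funext i
    change a i = g.symm (ρ (k (f (a i))))
    have h3 := hg (a i)
    change g (a i) = ρ (k (f (a i))) at h3
    rw [← h3]
    exact (g.symm_apply_apply _).symm
  · obtain ⟨k⟩ := exists_hom_of_model hT hM hB
    exact ⟨ρ.comp k⟩

/-- Every endomorphism of the core is an automorphism. -/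
theorem IsCore.exists_equiv (hT : Theory.IsComplete.{u, v, w} T) (hM : T.IsModel M)
    {A : Type (max u v w)} [L.patternLanguage.Structure A] (hA : IsCore.{u, v, w} T A)
    (k : A →[L.patternLanguage] A) : ∃ g : A ≃[L.patternLanguage] A, ∀ p, g p = k p := by
  obtain ⟨J, hJ, hend⟩ := exists_isCore hT hM
  obtain ⟨a₀⟩ := hJ.2 A hA.1.1
  obtain ⟨b⟩ := hA.2 J hJ.1.1
  obtain ⟨g₀, hg₀⟩ := hend (a₀.comp b)
  let a : A →[L.patternLanguage] J := g₀.symm.toHom.comp a₀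
  have hab : ∀ p, a (b p) = p := fun p => by
    change g₀.symm (a₀ (b p)) = p
    have h1 : g₀ p = a₀ (b p) := hg₀ p
    rw [← h1]
    exact g₀.symm_apply_apply p
  have hinj : ∀ p q, a p = a q → p = q := by
    intro p q hpq
    -- The equation of two variables is pp, so existential closedness makes `a` injective. Having
    -- the right inverse `b`, it is an isomorphism, and `k` is studied on `J`.
    have h1 := hA.1.2 J hJ.1.1 a 2
      (FirstOrder.Language.Term.equal (.var 0) (.var 1))
      (.conj (.atomic (.equal _ _))) ![p, q] (by
        rw [FirstOrder.Language.Formula.realize_equal]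
        simpa using hpq)
    rw [FirstOrder.Language.Formula.realize_equal] at h1
    simpa using h1
  have hba : ∀ p, b (a p) = p := fun p => hinj _ _ (hab _)
  obtain ⟨g, hg⟩ := hend (a.comp (k.comp b))
  have hg' : ∀ p, g p = a (k (b p)) := hg
  refine ⟨.ofHom k (b.comp (g.symm.toHom.comp a)) (fun p => ?_) (fun p => ?_), fun p => rfl⟩
  · change b (g.symm (a (k p))) = p
    have h1 := hg' (a p)
    rw [hba] at h1
    rw [← h1]
    exact (congrArg b (g.symm_apply_apply _)).trans (hba p)
  · change k (b (g.symm (a p))) = p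
    apply hinj
    rw [← hg']
    exact g.apply_symm_apply _

/-- The type space retracts to each copy of the core. -/
theorem IsCore.exists_retraction (hT : Theory.IsComplete.{u, v, w} T) (hM : T.IsModel M)
    {J : L.patternLanguage.Substructure (TypeSpace M)} (hJ : IsCore.{u, v, w} T J) :
    ∃ r : TypeSpace M →[L.patternLanguage] J, ∀ p : J, r p = p := by
  obtain ⟨r₀⟩ := hJ.2 (TypeSpace M)
    (model_patternTheory_of_hom hM (FirstOrder.Language.Hom.id _ _))
  obtain ⟨g, hg⟩ := hJ.exists_equiv hT hM (r₀.comp J.subtype.toHom)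
  refine ⟨g.symm.toHom.comp r₀, fun p => ?_⟩
  change g.symm (r₀ p) = p
  have h1 : g p = r₀ p := hg p
  rw [← h1]
  exact g.symm_apply_apply p

end MSLanguage

/-! ## The topologies on the core and its automorphism group -/

namespace FirstOrder.Language

variable {K : FirstOrder.Language.{u, v}} {A : Type w} [K.Structure A]

theorem BoundedFormula.IsPP.subst {α : Type x} {β : Type y} {n : ℕ} {φ : K.BoundedFormula α n}
    (hφ : φ.IsPP) (f : α → K.Term β) : (φ.subst f).IsPP := by
  induction hφ with
  | conj h =>
    refine .conj ?_
    induction h with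
    | top => exact .top
    | atomic h =>
      cases h with
      | equal t t' => exact .atomic (.equal _ _)
      | rel R ts => exact .atomic (.rel _ _)
    | inf _ _ ih ih' => exact .inf ih ih'
  | ex _ ih => exact .ex ih

theorem Formula.realize_subst_var {α : Type x} {β : Type y} {φ : K.Formula α} {f : α → β}
    {a : β → A} : Formula.Realize (BoundedFormula.subst φ fun i => .var (f i)) a ↔
      φ.Realize (a ∘ f) :=
  BoundedFormula.realize_subst

theorem continuous_eval (a : A) :
    @Continuous (A ≃[K] A) A _ (ppTopology (K := K) A) fun g => g a := by
  let _ := ppTopology (K := K) A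
  refine continuous_generateFrom_iff.2 ?_
  rintro U ⟨k, R, c, hR, rfl⟩
  refine TopologicalSpace.isOpen_generateFrom_of_mem
    ⟨1, k, BoundedFormula.subst R fun i => .var (Fin.cases (Sum.inl 0) Sum.inr i), fun _ => a, c,
      hR.subst _, ?_⟩
  ext g
  simp only [Set.mem_preimage, Set.mem_ofPred_eq]
  rw [Formula.realize_subst_var]
  have h : Sum.elim (fun _ => g a) c ∘
      (fun i : Fin (k + 1) => (Fin.cases (Sum.inl 0) Sum.inr i : Fin 1 ⊕ Fin k)) =
      Fin.cons (g a) c := by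
    funext i
    refine Fin.cases ?_ (fun j => ?_) i <;> rfl
  rw [h]

/-- The preimage of this image in the automorphism group is the union of the open sets {g : g(na) ∈
U} over infinitesimal `n`. -/
theorem isOpen_image_mk_setOf_apply_mem (a : A) {U : Set A}
    (hU : IsOpen[ppTopology (K := K) A] U) :
    IsOpen ((fun g : A ≃[K] A => (g : (A ≃[K] A) ⧸ infinitesimal K A)) '' {g | g a ∈ U}) := by
  refine isOpen_coinduced.2 ?_
  have h : (fun g : A ≃[K] A => (g : (A ≃[K] A) ⧸ infinitesimal K A)) ⁻¹'
      ((fun g : A ≃[K] A => (g : (A ≃[K] A) ⧸ infinitesimal K A)) '' {g | g a ∈ U}) =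
      ⋃ n : infinitesimal K A, (fun g : A ≃[K] A => g (n.1 a)) ⁻¹' U := by
    ext g
    simp only [Set.mem_preimage, Set.mem_image, Set.mem_ofPred_eq, Set.mem_iUnion]
    constructor
    · rintro ⟨k, hk, hkg⟩
      refine ⟨⟨g⁻¹ * k, QuotientGroup.eq.1 hkg.symm⟩, ?_⟩
      rw [← aut_mul_apply, mul_inv_cancel_left]
      exact hk
    · rintro ⟨n, hn⟩
      refine ⟨g * n, hn, ?_⟩
      exact QuotientGroup.mk_mul_of_mem g n.2
  change IsOpen ((fun g : A ≃[K] A => (g : (A ≃[K] A) ⧸ infinitesimal K A)) ⁻¹' _)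
  rw [h]
  exact isOpen_iUnion fun n =>
    @IsOpen.preimage _ A _ (ppTopology (K := K) A) _ (continuous_eval _) _ hU

instance t2Space_quotient_infinitesimal : T2Space ((A ≃[K] A) ⧸ infinitesimal K A) := by
  refine ⟨fun x y hxy => ?_⟩
  obtain ⟨g, rfl⟩ := QuotientGroup.mk_surjective x
  obtain ⟨h, rfl⟩ := QuotientGroup.mk_surjective y
  have h1 : ¬ ∀ U : Set A, IsOpen[ppTopology (K := K) A] U → U.Nonempty →
      ((g⁻¹ * h : A ≃[K] A) '' U ∩ U).Nonempty := fun hc => hxy (QuotientGroup.eq.2 hc)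
  push Not at h1
  obtain ⟨U, hU, ⟨a, ha⟩, hgU⟩ := h1
  -- As g⁻¹hU misses U, the open sets gU and hU are disjoint; x and y are separated by where their
  -- representatives may send `a`.
  refine ⟨_, _, isOpen_image_mk_setOf_apply_mem a (aut_isOpen_image g hU),
    isOpen_image_mk_setOf_apply_mem a (aut_isOpen_image h hU), ⟨g, ⟨a, ha, rfl⟩, rfl⟩,
    ⟨h, ⟨a, ha, rfl⟩, rfl⟩, ?_⟩
  rw [Set.disjoint_left]
  rintro _ ⟨k, hk, rfl⟩ ⟨k', hk', hkk'⟩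
  let n : A ≃[K] A := k⁻¹ * k'
  have hn : n ∈ infinitesimal K A := QuotientGroup.eq.1 hkk'.symm
  have hkn : ∀ b, k (n b) = k' b := fun b => by rw [← aut_mul_apply, mul_inv_cancel_left]
  let _ := ppTopology (K := K) A
  -- If k' = kn with `n` infinitesimal, then `n` moves some `b` of this neighbourhood of `a` into
  -- it; so k'b = k(nb) lies in both hU and gU.
  obtain ⟨_, ⟨b, ⟨-, hb⟩, rfl⟩, ⟨hb', -⟩⟩ := hn (k ⁻¹' (g '' U) ∩ k' ⁻¹' (h '' U))
    (((aut_isOpen_image g hU).preimage (aut_continuous k)).inter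
      ((aut_isOpen_image h hU).preimage (aut_continuous k'))) ⟨a, hk, hk'⟩
  obtain ⟨c, hc, hgc⟩ := hb'
  obtain ⟨d, hd, hhd⟩ := hb
  rw [hkn, ← hhd] at hgc
  refine Set.notMem_empty c (hgU ▸ ⟨⟨d, hd, ?_⟩, hc⟩)
  rw [aut_mul_apply, ← hgc, aut_inv_apply_self]

end FirstOrder.Language

namespace MSLanguage

variable {L : MSLanguage.{u, v}} {T : L.Theory} {M : L.Sorts → Type w} [L.Structure M]

namespace TypeSpace

/-- Positive primitive formulas are preserved by limits of types. -/
theorem realize_lim_of_isPP {I : Type x} (U : Ultrafilter I) {α : Type y} {n : ℕ}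
    {φ : L.patternLanguage.BoundedFormula α n} (hφ : φ.IsPP) {a : I → α → TypeSpace M}
    {p : I → Fin n → TypeSpace M} (h : ∀ᶠ i in U, φ.Realize (a i) (p i)) :
    φ.Realize (fun k => lim U fun i => a i k) (fun k => lim U fun i => p i k) := by
  have hterm : ∀ {n : ℕ} (t : L.patternLanguage.Term (α ⊕ Fin n)) (a : I → α → TypeSpace M)
      (p : I → Fin n → TypeSpace M),
      t.realize (Sum.elim (fun k => lim U fun i => a i k) (fun k => lim U fun i => p i k)) =
        lim U fun i => t.realize (Sum.elim (a i) (p i)) := by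
    intro n t a p
    match t with
    | .var (.inl k) => rfl
    | .var (.inr k) => rfl
    | .func f _ => exact f.elim
  induction hφ with
  | conj hφ =>
    induction hφ with
    | top => exact BoundedFormula.realize_top.2 trivial
    | atomic hφ =>
      cases hφ with
      | equal t t' =>
        simp only [BoundedFormula.realize_bdEqual] at h ⊢
        rw [hterm, hterm]
        exact lim_congr h
      | rel R ts =>
        simp only [BoundedFormula.realize_rel] at h ⊢
        simp only [hterm]
        exact relMap_lim R _ h
    | inf _ _ ih ih' =>
      simp only [BoundedFormula.realize_inf] at h ⊢
      exact ⟨ih (h.mono fun _ => And.left), ih' (h.mono fun _ => And.right)⟩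
  | ex _ ih =>
    simp only [BoundedFormula.realize_ex] at h ⊢
    obtain ⟨q, hq⟩ := h.choice
    refine ⟨lim U q, ?_⟩
    convert ih hq using 1
    funext k
    refine Fin.lastCases ?_ (fun j => ?_) k <;> simp

theorem lascarDistLEOne_lim {I : Type x} {U : Ultrafilter I} {p p' : I → TypeSpace M}
    (h : ∀ᶠ i in U, LascarDistLEOne.{u, v, w} T (p i) (p' i)) :
    LascarDistLEOne.{u, v, w} T (lim U p) (lim U p') := by
  simp only [lascarDistLEOne_iff] at h ⊢
  obtain ⟨q, hq⟩ := h.choice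
  refine ⟨lim U q, fun φ b => ?_, fun φ b => ?_, fun θ hθ b => ?_⟩
  · exact Filter.eventually_congr (hq.mono fun i hi => hi.1 φ b)
  · exact Filter.eventually_congr (hq.mono fun i hi => hi.2.1 φ b)
  · exact hq.mono fun i hi => hi.2.2 θ hθ b

end TypeSpace

theorem isCompact_lascarSet (hT : Theory.IsComplete.{u, v, w} T) (hM : T.IsModel M)
    {J : L.patternLanguage.Substructure (TypeSpace M)} (hJ : IsCore.{u, v, w} T J) :
    IsCompact (lascarSet.{u, v, w} T J) := by
  obtain ⟨r, hr⟩ := hJ.exists_retraction hT hM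
  refine isCompact_iff_ultrafilter_le_nhds.2 fun U hU => ?_
  have hU : ∀ᶠ g in U, g ∈ lascarSet.{u, v, w} T J := Filter.le_principal_iff.1 hU
  let ι : J →[L.patternLanguage] TypeSpace M := J.subtype.toHom
  have hι : ∀ p, r (ι p) = p := hr
  -- The pointwise limit leaves `J`; retracting gives an endomorphism of `J`, hence an automorphism.
  -- Since L₁ and pp formulas survive limits and homomorphisms, it lies in the set and is a limit of
  -- the ultrafilter.
  obtain ⟨h, hh⟩ := hJ.exists_equiv hT hM
    (r.comp (TypeSpace.limHom U fun g : J ≃[L.patternLanguage] J => ι.comp g.toHom))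
  have hh : ∀ p, h p = r (TypeSpace.lim U fun g : J ≃[L.patternLanguage] J => ι (g p)) := hh
  refine ⟨h, fun p => ?_, ?_⟩
  · have h1 := TypeSpace.lascarDistLEOne_lim (U := U) (p := fun _ => ι p) (p' := fun g => ι (g p))
      (hU.mono fun g hg => (hg p).hom ι)
    have h2 := h1.hom r
    rwa [TypeSpace.lim_const, hι, ← hh] at h2
  · rw [TopologicalSpace.nhds_generateFrom]
    refine le_iInf₂ fun s hs => ?_
    obtain ⟨h1, n, m, R, a, b, hR, rfl⟩ := hs
    refine Filter.le_principal_iff.2 ?_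
    by_contra hc
    have hc' : ∀ᶠ g : J ≃[L.patternLanguage] J in U, R.Realize (Sum.elim (fun i => g (a i)) b) := by
      refine (Ultrafilter.eventually_not.2 hc).mono fun g hg => ?_
      exact not_not.1 hg
    refine h1 ?_
    have h2 := TypeSpace.realize_lim_of_isPP U hR (hc'.mono fun g hg =>
      FirstOrder.Language.Formula.realize_hom_of_isPP hR ι hg)
    have h3 := hR.realize_hom r h2
    rw [FirstOrder.Language.Formula.Realize]
    convert h3 using 1
    · funext i
      cases i with
      | inl i => exact hh (a i)
      | inr i =>
        change b i = r (TypeSpace.lim U fun _ => ι (b i))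
        rw [TypeSpace.lim_const, hι]

theorem isClosed_lascarSetQuot (hT : Theory.IsComplete.{u, v, w} T) (hM : T.IsModel M)
    {J : L.patternLanguage.Substructure (TypeSpace M)} (hJ : IsCore.{u, v, w} T J) :
    IsClosed (lascarSetQuot.{u, v, w} T J) :=
  ((isCompact_lascarSet hT hM hJ).image continuous_coinduced_rng).isClosed

end MSLanguage

/-! ## The automorphism group of the core and the Lascar group -/

theorem mk_mem_closure_image_iff {G : Type x} [Group G] {N : Subgroup G} [N.Normal] {C : Set G}
    (hN : N ≤ Subgroup.closure C) (g : G) :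
    (g : G ⧸ N) ∈ Subgroup.closure ((fun k : G => (k : G ⧸ N)) '' C) ↔
      g ∈ Subgroup.closure C := by
  have h3 : Subgroup.closure ((fun k : G => (k : G ⧸ N)) '' C) =
      (Subgroup.closure C).map (QuotientGroup.mk' N) :=
    (MonoidHom.map_closure (QuotientGroup.mk' N) C).symm
  rw [h3]
  refine ⟨?_, fun hk => Subgroup.mem_map_of_mem (QuotientGroup.mk' N) hk⟩
  rintro ⟨k', hk', hkk'⟩
  have h5 := mul_mem hk' (hN (QuotientGroup.eq.1 (show (k' : G ⧸ N) = g from hkk')))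
  rwa [mul_inv_cancel_left] at h5

theorem mk_mk_eq_iff_of_le_closure {G : Type x} [Group G] {N : Subgroup G} [N.Normal] {C : Set G}
    (hN : N ≤ Subgroup.closure C)
    [(Subgroup.closure ((fun k : G => (k : G ⧸ N)) '' C)).Normal] (g h : G) :
    (((g : G ⧸ N) : (G ⧸ N) ⧸ Subgroup.closure ((fun k : G => (k : G ⧸ N)) '' C)) =
      ((h : G ⧸ N) : (G ⧸ N) ⧸ Subgroup.closure ((fun k : G => (k : G ⧸ N)) '' C))) ↔
        g * h⁻¹ ∈ Subgroup.closure C := by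
  rw [QuotientGroup.eq_iff_div_mem, ← QuotientGroup.mk_div, div_eq_mul_inv]
  exact mk_mem_closure_image_iff hN _

namespace MSLanguage

variable {L : MSLanguage.{u, v}} {T : L.Theory} {M : L.Sorts → Type w} [L.Structure M]

theorem eqvGen_lascarDistLEOne_hom {A : Type y} {B : Type z} [L.patternLanguage.Structure A]
    [L.patternLanguage.Structure B] (f : A →[L.patternLanguage] B) {p p' : A}
    (h : Relation.EqvGen (LascarDistLEOne.{u, v, w} T) p p') :
    Relation.EqvGen (LascarDistLEOne.{u, v, w} T) (f p) (f p') := by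
  induction h with
  | rel _ _ h => exact .rel _ _ (h.hom f)
  | refl _ => exact .refl _
  | symm _ _ _ ih => exact ih.symm
  | trans _ _ _ _ _ ih ih' => exact ih.trans _ _ _ ih'

theorem eqvGen_act_of_mem_AutL (hM : T.IsModel M) {σ : Aut M} (hσ : σ ∈ AutL M) (p : TypeSpace M) :
    Relation.EqvGen (LascarDistLEOne.{u, v, w} T) p (TypeSpace.act σ p) := by
  induction hσ using Subgroup.closure_induction generalizing p with
  | mem σ hσ => exact .rel _ _ (lascarDistLEOne_act hM hσ p)
  | one => rw [TypeSpace.act_one]; exact .refl _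
  | mul σ τ _ _ ih ih' =>
    rw [TypeSpace.act_mul]
    exact (ih' p).trans _ _ _ (ih _)
  | inv σ _ ih =>
    have h := (ih (TypeSpace.act σ⁻¹ p)).symm
    rwa [← TypeSpace.act_mul, mul_inv_cancel, TypeSpace.act_one] at h

/-- For each definable closeness relation and each type there is a tuple of `M` close to the
realizations of the type. -/
theorem TypeSpace.exists_mem_of_mem_lascarNeighbours (hM : T.IsModel M) (p : TypeSpace M)
    {θ : L.Formula (ℕ ⊕ ℕ)} (hθ : θ ∈ lascarNeighbours.{u, v, w} T) :
    ∃ c : Assign ℕ M, (θ, c) ∈ p.formulas := by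
  -- The cover is taken over `M` itself; any tuple of `M` in the class containing `p` will do.
  obtain ⟨m, χ, g, h1, h2⟩ := IsElementary.exists_cover (N := M) (f := fun _ => id)
    (fun _ _ => Iff.rfl) hM.nonempty hM hθ
  obtain ⟨a, ha⟩ := p.exists_realize_iff
    (Set.range fun i => (χ, (g i).map fun _ => id)) (Set.finite_range _)
  obtain ⟨i, hi⟩ := h1 a
  refine ⟨a, p.mem_of_forall (Set.finite_singleton (χ, (g i).map fun _ => id))
    (Set.singleton_subset_iff.2 ((ha _ ⟨i, rfl⟩).1 hi)) fun a' ha' => h2 i a' a (ha' _ rfl) hi⟩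

section Core

variable {κ : Cardinal.{max u v w}} {W : Type (max u v w)} [Nonempty W] {n : Assign W M}
  {J : L.patternLanguage.Substructure (TypeSpace M)}
  {r : TypeSpace M →[L.patternLanguage] J}

/-- The endomorphism of the type space given by an automorphism of a retract. -/
def extendAut (r : TypeSpace M →[L.patternLanguage] J) (g : J ≃[L.patternLanguage] J) :
    TypeSpace M →[L.patternLanguage] TypeSpace M :=
  J.subtype.toHom.comp (g.toHom.comp r)

theorem extendAut_apply (g : J ≃[L.patternLanguage] J) (p : TypeSpace M) :
    extendAut r g p = g (r p) := rfl

/-- Infinitesimality yields `p` such that `p` and `gp` are both near one fixed type e₀, through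
tuples `c` and `c'` of `M`. Since i(p) is a neighbour of `p` and σi(p) one of `gp`, a realization
approximating i(p) is joined to its image under σ by a chain of length independent of `χ` and `Ψ`.
-/
theorem SmallModel.mem_AutL_of_infinitesimal (S : SmallModel κ M W) (hn : IsModelEnum n)
    (hT : Theory.IsComplete.{u, v, w} T) (hM : T.IsModel M) (hr : ∀ p : J, r p = p)
    {g : J ≃[L.patternLanguage] J} (hg : g ∈ infinitesimal L.patternLanguage J) {σ : Aut M}
    {i : TypeSpace M →[L.patternLanguage] TypeSpace M}
    (hi : ∀ p φ (e : L.Sorts → ℕ → W), (φ, n.pull e) ∈ p.formulas →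
      (φ, n.pull e) ∈ (i p).formulas)
    (hσ : ∀ p φ (e : L.Sorts → ℕ → W), (φ, n.pull e) ∈ (extendAut r g p).formulas →
      (φ, n.pull e) ∈ (TypeSpace.act σ (i p)).formulas) : σ ∈ AutL M := by
  classical
  have := hM.nonempty
  refine S.mem_AutL_of_nearChain hn 5 fun χ e hχ Ψ => ?_
  let χ' : L.Formula (ℕ ⊕ ℕ) := χ.subst fun _ => Sum.inl
  have hχ' : ∀ a b : Assign ℕ M, χ'.Realize (a.sum b) ↔ χ.Realize a := fun a b =>
    Formula.realize_subst _ _ _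
  have hθ : nearFormula χ Ψ ∈ lascarNeighbours.{u, v, w} T := nearFormula_mem hT hM ⟨_, hχ⟩
  let φ : L.Formula (ℕ ⊕ ℕ) := χ'.and (nearFormula χ Ψ)
  have hφ : ∀ a b : Assign ℕ M, φ.Realize (a.sum b) ↔ χ.Realize a ∧ Near χ Ψ a b := by
    intro a b
    rw [Formula.realize_and, hχ', realize_nearFormula]
  -- Any type in `J` containing `χ` would do; the retraction preserves parameter-free formulas.
  let e₀ : J := r (TypeSpace.tp (n.pull fun _ => e))
  have he₀ : ∀ b, (χ', b) ∈ e₀.1.formulas := by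
    have h1 : FirstOrder.Language.Structure.RelMap (pat ![χ'.neg] Formula.truth)
        ![TypeSpace.tp (n.pull fun _ => e)] := by
      rw [TypeSpace.relMap_pat_one]
      intro b hb
      rw [TypeSpace.neg_mem, TypeSpace.mem_tp, hχ'] at hb
      exact hb hχ
    have h2 := (J.subtype.toHom.comp r).map_rel _ _ h1
    have h3 : FirstOrder.Language.Structure.RelMap (pat ![χ'.neg] Formula.truth) ![e₀.1] := by
      convert h2 using 1
      funext k
      fin_cases k
      rfl
    rw [TypeSpace.relMap_pat_one] at h3
    exact fun b => by_contra fun hc => h3 b (e₀.1.neg_mem.2 hc)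
  let U : Set J := {p | ∃ c, (φ, c) ∈ p.1.formulas ∧ (φ, c) ∈ e₀.1.formulas}
  have hU : IsOpen[ppTopology (K := L.patternLanguage) J] U := by
    refine TopologicalSpace.isOpen_generateFrom_of_mem
      ⟨1, FirstOrder.Language.Relations.formula (n := 2) (pat ![φ, φ] Formula.truth)
        fun k => .var k, ![e₀], .conj (.atomic (.rel _ _)), ?_⟩
    ext p
    have h1 : FirstOrder.Language.Structure.RelMap (pat ![φ, φ] Formula.truth)
        (Fin.cons p ![e₀] : Fin 2 → J) ↔ ∀ b, (φ, b) ∈ p.1.formulas → (φ, b) ∉ e₀.1.formulas := by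
      rw [← TypeSpace.relMap_pat_two]
      have h2 : (![p.1, e₀.1] : Fin 2 → TypeSpace M) =
          fun k => ((Fin.cons p ![e₀] : Fin 2 → J) k).1 := by
        funext k
        fin_cases k <;> rfl
      rw [h2]
      rfl
    rw [Set.mem_ofPred_eq, Set.mem_ofPred_eq, FirstOrder.Language.Formula.realize_rel]
    refine Iff.trans ?_ (not_congr h1).symm
    push Not
    rfl
  have hUne : U.Nonempty := by
    obtain ⟨c, hc⟩ := TypeSpace.exists_mem_of_mem_lascarNeighbours hM e₀.1 hθ
    have h1 : (φ, c) ∈ e₀.1.formulas := by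
      refine e₀.1.mem_of_forall (Set.toFinite {(χ', c), (nearFormula χ Ψ, c)})
        (Set.insert_subset (he₀ c) (Set.singleton_subset_iff.2 hc)) fun a ha => ?_
      rw [Formula.realize_and]
      exact ⟨ha _ (Set.mem_insert _ _), ha _ (Set.mem_insert_of_mem _ rfl)⟩
    exact ⟨e₀, c, h1, h1⟩
  obtain ⟨_, ⟨p, ⟨c, hpc, hc⟩, rfl⟩, ⟨c', hpc', hc'⟩⟩ := hg U hU hUne
  have h1 : (chainFormula χ Ψ 1, c) ∈ (i p.1).formulas := by
    refine TypeSpace.mem_right_of_lascarDistLEOne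
      (hn.lascarDistLEOne hM (T := T) fun φ e => hi p.1 φ e) hθ hpc fun a z h h' => ?_
    rw [realize_nearFormula] at h
    rw [realize_chainFormula]
    exact ⟨z, h.symm, ((hφ _ _).1 h').2⟩
  have h2 : (chainFormula χ Ψ 1, c') ∈ (TypeSpace.act σ (i p.1)).formulas := by
    have hpc'' : (φ, c') ∈ (extendAut r g p.1).formulas := by
      rw [extendAut_apply, hr]
      exact hpc'
    refine TypeSpace.mem_right_of_lascarDistLEOne
      (hn.lascarDistLEOne hM (T := T) fun φ e => hσ p.1 φ e) hθ hpc'' fun a z h h' => ?_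
    rw [realize_nearFormula] at h
    rw [realize_chainFormula]
    exact ⟨z, h.symm, ((hφ _ _).1 h').2⟩
  -- `χ'` has no parameters, but `hi` speaks of tuples from `n`, so an arbitrary such tuple is
  -- supplied.
  have h3 : (χ', n.pull fun _ _ => e 0) ∈ (i p.1).formulas := by
    refine hi _ _ _ (p.1.mem_of_forall (Set.finite_singleton (φ, c))
      (Set.singleton_subset_iff.2 hpc) fun a ha => ?_)
    exact (hχ' _ _).2 ((hφ _ _).1 (ha _ rfl)).1
  obtain ⟨m, hm⟩ := (i p.1).exists_realize_iff {(chainFormula χ Ψ 1, c),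
    (chainFormula χ Ψ 1, c'.map σ⁻¹.toFun), (χ', n.pull fun _ _ => e 0)} (Set.toFinite _)
  have hm1 := realize_chainFormula.1 ((hm _ (by simp)).2 h1)
  have hm2 := (realize_chainFormula.1 ((hm _ (by simp)).2 (TypeSpace.mem_act.1 h2))).map σ
  rw [TypeSpace.map_map_inv] at hm2
  obtain ⟨z, hz⟩ := e₀.1.exists_realize_iff {(φ, c), (φ, c')} (Set.toFinite _)
  have hz1 := ((hφ _ _).1 ((hz _ (by simp)).2 hc)).2
  have hz2 := ((hφ _ _).1 ((hz _ (by simp)).2 hc')).2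
  refine ⟨m, (hχ' _ _).1 ((hm _ (by simp)).2 h3), ?_⟩
  -- The route is m, c, z, c', σm with 2 + 1 + 1 + 2 = 6 steps, which is index 5; `z` approximates
  -- e₀.
  exact ((hm1.trans (k := 0) hz1.symm).trans (k := 0) hz2).trans hm2.symm

section Restriction

variable {β : (TypeSpace M →[L.patternLanguage] TypeSpace M) → (J ≃[L.patternLanguage] J)}

/-- Restriction to `J` through `r` is not visibly multiplicative. With `k` arbitrary the quotients
telescope along a product of generators, and for a generator kq and σkq are neighbours, hence so are
their images under `r`. -/
theorem restrict_act_mul_inv_mem (hM : T.IsModel M) (hβ : ∀ k (p : J), β k p = r (k p)) {σ : Aut M}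
    (hσ : σ ∈ AutL M) (k : TypeSpace M →[L.patternLanguage] TypeSpace M) :
    β (TypeSpace.actHom M σ * k) * (β k)⁻¹ ∈ Subgroup.closure (lascarSet.{u, v, w} T J) := by
  induction hσ using Subgroup.closure_induction generalizing k with
  | mem σ hσ =>
    refine Subgroup.subset_closure fun p => ?_
    obtain ⟨q, rfl⟩ : ∃ q, β k q = p := ⟨_, aut_apply_inv_self (β k) p⟩
    rw [aut_mul_apply, aut_inv_apply_self, hβ, hβ]
    exact (lascarDistLEOne_act hM hσ (k q)).hom r
  | one =>
    have : TypeSpace.actHom M 1 * k = k :=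
      FirstOrder.Language.Hom.ext fun p => TypeSpace.act_one _
    rw [this, mul_inv_cancel]
    exact one_mem _
  | mul σ τ _ _ ih ih' =>
    have : TypeSpace.actHom M (σ * τ) * k = TypeSpace.actHom M σ * (TypeSpace.actHom M τ * k) :=
      FirstOrder.Language.Hom.ext fun p => TypeSpace.act_mul _ _ _
    rw [this]
    have h := mul_mem (ih (TypeSpace.actHom M τ * k)) (ih' k)
    rwa [mul_assoc, inv_mul_cancel_left] at h
  | inv σ _ ih =>
    have : TypeSpace.actHom M σ * (TypeSpace.actHom M σ⁻¹ * k) = k :=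
      FirstOrder.Language.Hom.ext fun p => by
        change TypeSpace.act σ (TypeSpace.act σ⁻¹ (k p)) = k p
        rw [← TypeSpace.act_mul, mul_inv_cancel, TypeSpace.act_one]
    have h := inv_mem (ih (TypeSpace.actHom M σ⁻¹ * k))
    rwa [this, mul_inv_rev, inv_inv] at h

/-- Both β(i) and β(σi)g⁻¹ move every type to an L₁-neighbour, as the types compared agree over `n`.
Between them lies β(σi)β(i)⁻¹, which is controlled by σ ∈ Aut_L(M). -/
theorem mem_closure_lascarSet_of_mem_AutL (hn : IsModelEnum n) (hM : T.IsModel M)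
    (hr : ∀ p : J, r p = p) (hβ : ∀ k (p : J), β k p = r (k p)) {g : J ≃[L.patternLanguage] J}
    {σ : Aut M} {i : TypeSpace M →[L.patternLanguage] TypeSpace M}
    (hi : ∀ p φ (e : L.Sorts → ℕ → W), (φ, n.pull e) ∈ p.formulas →
      (φ, n.pull e) ∈ (i p).formulas)
    (hσ : ∀ p φ (e : L.Sorts → ℕ → W), (φ, n.pull e) ∈ (extendAut r g p).formulas →
      (φ, n.pull e) ∈ (TypeSpace.act σ (i p)).formulas) (h : σ ∈ AutL M) :
    g ∈ Subgroup.closure (lascarSet.{u, v, w} T J) := by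
  have h1 := restrict_act_mul_inv_mem (T := T) hM hβ h i
  have h2 : β i ∈ Subgroup.closure (lascarSet.{u, v, w} T J) := by
    refine Subgroup.subset_closure fun p => ?_
    have h3 := (hn.lascarDistLEOne hM (T := T) fun φ e => hi p.1 φ e).hom r
    rwa [hr, ← hβ] at h3
  have h3 : β (TypeSpace.actHom M σ * i) * g⁻¹ ∈ Subgroup.closure (lascarSet.{u, v, w} T J) := by
    refine Subgroup.subset_closure fun p => ?_
    obtain ⟨q, rfl⟩ : ∃ q, g q = p := ⟨_, aut_apply_inv_self g p⟩
    rw [aut_mul_apply, aut_inv_apply_self, hβ]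
    have h4 := (hn.lascarDistLEOne hM (T := T) fun φ e => hσ q.1 φ e).hom r
    rwa [extendAut_apply, hr, hr] at h4
  have h4 := mul_mem (inv_mem h3) (mul_mem h1 h2)
  rwa [inv_mul_cancel_right, mul_inv_rev, inv_inv, inv_mul_cancel_right] at h4

end Restriction

/-- A retraction moves types inside their Lascar classes. -/
theorem SmallModel.eqvGen_retraction (S : SmallModel κ M W) (hn : IsModelEnum n)
    (hM : T.IsModel M) (hr : ∀ p : J, r p = p) (p : TypeSpace M) :
    Relation.EqvGen (LascarDistLEOne.{u, v, w} T) (r p).1 p := by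
  obtain ⟨σ, i, hi, hσ⟩ := S.exists_aut_of_endo n (J.subtype.toHom.comp r)
  have h1 : ∀ p : TypeSpace M,
      Relation.EqvGen (LascarDistLEOne.{u, v, w} T) (r p).1 (TypeSpace.act σ p) := fun p =>
    (Relation.EqvGen.rel _ _ (hn.lascarDistLEOne hM fun φ e => hσ p φ e)).trans _ _ _
      (eqvGen_lascarDistLEOne_hom (TypeSpace.actHom M σ)
        (.rel _ _ (hn.lascarDistLEOne hM fun φ e => hi p φ e))).symm
  -- Since r(rp) = rp, the type rp is equivalent to both σp and σ(rp), the latter to σσp. Cancelling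
  -- σ gives p E σp, so rp E p.
  have h2 := h1 (r p).1
  rw [hr] at h2
  have h3 : Relation.EqvGen (LascarDistLEOne.{u, v, w} T) (TypeSpace.act σ p)
      (TypeSpace.act σ (TypeSpace.act σ p)) :=
    ((h1 p).symm.trans _ _ _ h2).trans _ _ _
      (eqvGen_lascarDistLEOne_hom (TypeSpace.actHom M σ) (h1 p))
  have h4 := eqvGen_lascarDistLEOne_hom (TypeSpace.actHom M σ⁻¹) h3
  simp only [TypeSpace.actHom_apply, ← TypeSpace.act_mul, ← mul_assoc, inv_mul_cancel, one_mul,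
    TypeSpace.act_one] at h4
  exact (h1 p).trans _ _ _ h4.symm

/-- The subgroup generated by the Lascar neighbours consists of the automorphisms preserving the
Lascar classes, and contains the infinitesimal automorphisms. -/
theorem SmallModel.closure_lascarSet (S : SmallModel κ M W) (hn : IsModelEnum n)
    (hT : Theory.IsComplete.{u, v, w} T) (hM : T.IsModel M) (hJ : IsCore.{u, v, w} T J)
    (hr : ∀ p : J, r p = p) :
    infinitesimal L.patternLanguage J ≤ Subgroup.closure (lascarSet.{u, v, w} T J) ∧
    ∀ g : J ≃[L.patternLanguage] J, g ∈ Subgroup.closure (lascarSet.{u, v, w} T J) ↔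
      ∀ p : J, Relation.EqvGen (LascarDistLEOne.{u, v, w} T) (g p).1 p.1 := by
  choose β hβ using fun k : TypeSpace M →[L.patternLanguage] TypeSpace M =>
    hJ.exists_equiv hT hM (r.comp (k.comp J.subtype.toHom))
  have hβ : ∀ k (p : J), β k p = r (k p) := hβ
  refine ⟨fun g hg => ?_, fun g => ⟨fun hg => ?_, fun hg => ?_⟩⟩
  · obtain ⟨σ, i, hi, hσ⟩ := S.exists_aut_of_endo n (extendAut r g)
    exact mem_closure_lascarSet_of_mem_AutL hn hM hr hβ hi hσ
      (S.mem_AutL_of_infinitesimal hn hT hM hr hg hi hσ)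
  · induction hg using Subgroup.closure_induction with
    | mem g hg =>
      exact fun p => (Relation.EqvGen.rel _ _ ((hg p).hom J.subtype.toHom)).symm
    | one => exact fun p => .refl _
    | mul g h _ _ ih ih' => exact fun p => (ih (h p)).trans _ _ _ (ih' p)
    | inv g _ ih =>
      intro p
      have h := (ih (g⁻¹ p)).symm
      rwa [aut_apply_inv_self] at h
  · obtain ⟨σ, i, hi, hσ⟩ := S.exists_aut_of_endo n (extendAut r g)
    refine mem_closure_lascarSet_of_mem_AutL hn hM hr hβ hi hσ
      (S.mem_AutL_of_eqvGen hn hT hM fun p => ?_)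
    -- The path p, rp, g(rp), σi(p), σp shows that σ preserves all classes.
    have h1 := (S.eqvGen_retraction hn hM hr p).symm.trans _ _ _ (hg (r p)).symm
    have h2 : Relation.EqvGen (LascarDistLEOne.{u, v, w} T) (g (r p)).1 _ :=
      .rel _ _ (hn.lascarDistLEOne hM fun φ e => hσ p φ e)
    exact (h1.trans _ _ _ h2).trans _ _ _
      (eqvGen_lascarDistLEOne_hom (TypeSpace.actHom M σ)
        (.rel _ _ (hn.lascarDistLEOne hM fun φ e => hi p φ e))).symm

/-- Because 𝔤 lies in the subgroup generated by L₁, the double quotient is Aut(J) modulo that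
subgroup, whose elements are recognised by their action on E-classes. -/
theorem SmallModel.mk_mk_eq_iff (S : SmallModel κ M W) (hn : IsModelEnum n)
    (hT : Theory.IsComplete.{u, v, w} T) (hM : T.IsModel M) (hJ : IsCore.{u, v, w} T J)
    (hr : ∀ p : J, r p = p) (g h : J ≃[L.patternLanguage] J) :
    (((g : HausdorffAut L J) : HausdorffAut L J ⧸ lascarSubgroup.{u, v, w} T J) =
        ((h : HausdorffAut L J) : HausdorffAut L J ⧸ lascarSubgroup.{u, v, w} T J)) ↔
      ∀ p : J, Relation.EqvGen (LascarDistLEOne.{u, v, w} T) (g p).1 (h p).1 := by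
  obtain ⟨h1, h2⟩ := S.closure_lascarSet hn hT hM hJ hr
  have : (Subgroup.closure ((fun k : J ≃[L.patternLanguage] J => (k : HausdorffAut L J)) ''
      lascarSet.{u, v, w} T J)).Normal := lascarSubgroup_normal T J
  refine (mk_mk_eq_iff_of_le_closure h1 g h).trans ((h2 _).trans ?_)
  refine ⟨fun h5 p => ?_, fun h5 p => ?_⟩
  · have h6 := h5 (h p)
    rwa [aut_mul_apply, aut_inv_apply_self] at h6
  · have h6 := h5 (h⁻¹ p)
    rwa [aut_apply_inv_self] at h6

theorem SmallModel.exists_mulEquiv (S : SmallModel κ M W) (hn : IsModelEnum n)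
    (hT : Theory.IsComplete.{u, v, w} T) (hM : T.IsModel M) (hJ : IsCore.{u, v, w} T J)
    (hr : ∀ p : J, r p = p) {α : Aut M → (J ≃[L.patternLanguage] J)}
    (hα : ∀ σ (p : J), α σ p = r (TypeSpace.act σ p)) :
    ∃ Φ : (Aut M ⧸ AutL M) ≃* (HausdorffAut L J ⧸ lascarSubgroup.{u, v, w} T J),
      ∀ σ : Aut M, Φ (QuotientGroup.mk σ) = QuotientGroup.mk (QuotientGroup.mk (α σ)) := by
  have hE := S.eqvGen_retraction hn (T := T) hM hr
  have hαE : ∀ σ (p : J), Relation.EqvGen (LascarDistLEOne.{u, v, w} T) (α σ p).1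
      (TypeSpace.act σ p) := fun σ p => by
    rw [hα]
    exact hE _
  have hact : ∀ (σ : Aut M) {p q : TypeSpace M},
      Relation.EqvGen (LascarDistLEOne.{u, v, w} T) p q →
      Relation.EqvGen (LascarDistLEOne.{u, v, w} T) (TypeSpace.act σ p) (TypeSpace.act σ q) :=
    fun σ _ _ h => eqvGen_lascarDistLEOne_hom (TypeSpace.actHom M σ) h
  have hmk := S.mk_mk_eq_iff hn hT hM hJ hr
  let F : Aut M →* HausdorffAut L J ⧸ lascarSubgroup.{u, v, w} T J :=
    MonoidHom.mk' (fun σ => QuotientGroup.mk (QuotientGroup.mk (α σ))) fun σ τ => by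
      refine (hmk (α (σ * τ)) (α σ * α τ)).2 fun p => ?_
      refine (hαE (σ * τ) p).trans _ _ _ ?_
      rw [TypeSpace.act_mul, aut_mul_apply]
      exact ((hαE σ (α τ p)).trans _ _ _ (hact σ (hαE τ p))).symm
  have hF : ∀ σ, F σ = QuotientGroup.mk (QuotientGroup.mk (α σ)) := fun _ => rfl
  -- If α(σ) preserves classes on `J`, then p E rp E α(σ)(rp) E σ(rp) E σp for every type over `M`,
  -- and such σ are strong Lascar automorphisms.
  have hker : F.ker = AutL M := by
    ext σ
    rw [MonoidHom.mem_ker, hF]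
    refine (hmk (α σ) 1).trans ⟨fun h => ?_, fun h p => ?_⟩
    · refine S.mem_AutL_of_eqvGen hn hT hM fun p => ?_
      refine ((hE p).symm.trans _ _ _ (h (r p)).symm).trans _ _ _ ?_
      exact (hαE σ (r p)).trans _ _ _ (hact σ (hE p))
    · exact (hαE σ p).trans _ _ _ (eqvGen_act_of_mem_AutL hM h p.1).symm
  have hsurj : Function.Surjective F := by
    intro x
    obtain ⟨y, rfl⟩ := QuotientGroup.mk_surjective x
    obtain ⟨g, rfl⟩ := QuotientGroup.mk_surjective y
    -- A preimage of `g` is the automorphism approximating its extension: α(σ)p E σp E σi(p) E gp.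
    obtain ⟨σ, i, hi, hσ⟩ := S.exists_aut_of_endo n (extendAut r g)
    refine ⟨σ, (hmk (α σ) g).2 fun p => ?_⟩
    refine ((hαE σ p).trans _ _ _ (hact σ
      (.rel _ _ (hn.lascarDistLEOne hM fun φ e => hi p.1 φ e)))).trans _ _ _ ?_
    have h1 : Relation.EqvGen (LascarDistLEOne.{u, v, w} T) (extendAut r g p.1) _ :=
      .rel _ _ (hn.lascarDistLEOne hM fun φ e => hσ p.1 φ e)
    rw [extendAut_apply, hr] at h1
    exact h1.symm
  refine ⟨(QuotientGroup.quotientMulEquivOfEq hker.symm).trans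
    (QuotientGroup.quotientKerEquivOfSurjective F hsurj), fun σ => rfl⟩

end Core

end MSLanguage

theorem mainTheorem2 (L : MSLanguage.{u, v}) (T : L.Theory)
    (hT : MSLanguage.Theory.IsComplete.{u, v, w} T)
    (M : L.Sorts → Type w) [L.Structure M] (hM : T.IsModel M)
    (κ : Cardinal.{max u v w})
    (hκ : (2 : Cardinal.{max u v w}) ^ Cardinal.lift.{w} (Cardinal.mk (L.Formula ℕ)) < κ)
    (hsat : MSLanguage.IsSaturated κ M) (hhom : MSLanguage.IsStronglyHomogeneous κ M) :
    (∃ J : L.patternLanguage.Substructure (MSLanguage.TypeSpace M),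
      MSLanguage.IsCore.{u, v, w} T J) ∧
    ∀ J : L.patternLanguage.Substructure (MSLanguage.TypeSpace M),
      MSLanguage.IsCore.{u, v, w} T J →
      (∃ r : MSLanguage.TypeSpace M →[L.patternLanguage] J, ∀ p : J, r p = p) ∧
      IsClosed (MSLanguage.lascarSetQuot.{u, v, w, max u v w} T J) ∧
      (∀ h g : MSLanguage.HausdorffAut L J, g ∈ MSLanguage.lascarSetQuot.{u, v, w, max u v w} T J →
        h * g * h⁻¹ ∈ MSLanguage.lascarSetQuot.{u, v, w, max u v w} T J) ∧
      ∀ r : MSLanguage.TypeSpace M →[L.patternLanguage] J, (∀ p : J, r p = p) →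
        ∃ α : MSLanguage.Aut M → (J ≃[L.patternLanguage] J),
          (∀ (σ : MSLanguage.Aut M) (p : J), α σ p = r (MSLanguage.TypeSpace.act σ p)) ∧
          ∃ Φ : (MSLanguage.Aut M ⧸ MSLanguage.AutL M) ≃*
              (MSLanguage.HausdorffAut L J ⧸ MSLanguage.lascarSubgroup.{u, v, w, max u v w} T J),
            ∀ σ : MSLanguage.Aut M,
              Φ (QuotientGroup.mk σ) = QuotientGroup.mk (QuotientGroup.mk (α σ)) := by
  have := hM.nonempty
  obtain ⟨W, hW, n, hn, hsmall⟩ := MSLanguage.exists_isModelEnum hκ M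
  have S : MSLanguage.SmallModel κ M W := ⟨hM.nonempty, hsat, hhom, hW, hsmall⟩
  obtain ⟨J₀, hJ₀, -⟩ := MSLanguage.exists_isCore hT hM
  refine ⟨⟨J₀, hJ₀⟩, fun J hJ => ⟨hJ.exists_retraction hT hM,
    MSLanguage.isClosed_lascarSetQuot hT hM hJ, MSLanguage.lascarSetQuot_conj T J, fun r hr => ?_⟩⟩
  -- Each r ∘ σ|_J is an endomorphism of the core, hence an automorphism.
  choose α hα using fun σ : MSLanguage.Aut M =>
    hJ.exists_equiv hT hM (r.comp ((MSLanguage.TypeSpace.actHom M σ).comp J.subtype.toHom))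
  exact ⟨α, hα, S.exists_mulEquiv hn hT hM hJ hr hα⟩
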